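/- Let $L,\nu,T>0$, $Q=[0,L]^3$. Let $\mathscr H$ be the set of smooth, $L$-periodic, divergence-free vector fields on $\mathbb R^3$ with zero average over $Q$, and let $H$ be its closure in $[L^2(Q)]^3$, with inner product $(\cdot,\cdot)$ and norm $|\cdot|$. Let $\Pi$ be the orthogonal projection of $[L^2(Q)]^3$ onto $H$, $A=-\Pi\Delta$ the Stokes operator with periodic boundary conditions, and $B(u,u)=\Pi[(u\cdot\nabla)u]$. Let $(w_j)_{j\ge1}$ be an orthonormal basis of $H$ consisting of (smooth) eigenfunctions of $A$, with eigenvalues $0<\lambda_1\le\lambda_2\le\cdots$. For $m\ge0$ let $V^m=D(A^{m/2})$ with norm $\|u\|_m=|A^{m/2}u|=\big(\sum_j\lambda_j^m(u,w_j)^2\big)^{1/2}$, write $V=V^1$, and let $P_nu=\sum_{j=1}^n(u,w_j)w_j$. Let $m\ge 3$ be an integer, $u_0\in V^m$, $f\in L^2(0,T;V^m)$, and let $u$ be a strong solution on $[0,T]$ of $$\frac{du}{dt}+\nu Au+B(u,u)=f(t),\qquad u(0)=u_0,$$ that is, $u\in L^\infty(0,T;V)\cap L^2(0,T;V^2)$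 and, for every $\varphi\in\mathscr H$ and every $t\in[0,T]$, $$(u(t),\varphi)=(u_0,\varphi)+\int_0^t\Big[(f,\varphi)+\nu(u,\Delta\varphi)-((u\cdot\nabla)u,\varphi)\Big]\,ds .$$ Then for every $n$ the Galerkin equation $$\frac{du_n}{dt}+\nu Au_n+P_nB(u_n,u_n)=P_nf(t),\qquad u_n(0)=P_nu_0,$$ has exactly one continuous solution $u_n:[0,T]\to P_nH$ (the equation being understood integrated in time), the functions $u$ and $u_n$ all belong to $L^\infty(0,T;V^m)\cap L^2(0,T;V^{m+1})$, and, as $n\to\infty$, $$\|u_n-u\|_{L^\infty(0,T;V^m)}\to0\qquad\text{and}\qquad\|u_n-u\|_{L^2(0,T;V^{m+1})}\to0 .$$ -/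

import Mathlib

open MeasureTheory Filter Topology Set
open scoped ENNReal

namespace NavierStokes

noncomputable section

/-- Three-dimensional Euclidean space. -/
abbrev E3 : Type := EuclideanSpace ℝ (Fin 3)

/-- The standard basis vector in the direction `i`. -/
def basisVec (i : Fin 3) : E3 := EuclideanSpace.single i 1

/-- The periodic cell `Q = [0, L]^3`. -/
def cell (L : ℝ) : Set E3 := {x | ∀ i, x i ∈ Icc 0 L}

/-- Lebesgue measure on the periodic cell. -/
def cellMeasure (L : ℝ) : Measure E3 := volume.restrict (cell L)

/-- The Hilbert space `[L^2(Q)]^3`. -/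
abbrev L2 (L : ℝ) : Type := Lp E3 2 (cellMeasure L)

/-- `v` is periodic with period `L` in each coordinate direction. -/
def IsPeriodic (L : ℝ) (v : E3 → E3) : Prop :=
  ∀ (i : Fin 3) (x : E3), v (x + L • basisVec i) = v x

/-- The partial derivative `∂_i v`. -/
def partialDeriv (i : Fin 3) (v : E3 → E3) (x : E3) : E3 := fderiv ℝ v x (basisVec i)

/-- The class `ℋ` of smooth periodic divergence-free vector fields with zero average. -/
structure IsSolenoidal (L : ℝ) (v : E3 → E3) : Prop where
  smooth : ContDiff ℝ ((⊤ : ℕ∞) : WithTop ℕ∞) v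
  periodic : IsPeriodic L v
  div_free : ∀ x, ∑ i, partialDeriv i v x i = 0
  zero_mean : ∫ x, v x ∂(cellMeasure L) = 0

/-- The space `H`, the closure of `ℋ` in `[L^2(Q)]^3` (`ℋ` is a linear space). -/
def H (L : ℝ) : Submodule ℝ (L2 L) :=
  (Submodule.span ℝ
    {u : L2 L | ∃ v, IsSolenoidal L v ∧ ∀ᵐ x ∂(cellMeasure L), u x = v x}).topologicalClosure

/-- The `[L^2(Q)]^3` pairing `(u, v)`. -/
def pairing (L : ℝ) (u v : E3 → E3) : ℝ := ∫ x, inner ℝ (u x) (v x) ∂(cellMeasure L)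

/-- `g` is the weak partial derivative `∂_i u` of the periodic field `u`. -/
def IsWeakPartial (L : ℝ) (i : Fin 3) (u g : L2 L) : Prop :=
  ∀ ψ : E3 → E3, ContDiff ℝ ((⊤ : ℕ∞) : WithTop ℕ∞) ψ → IsPeriodic L ψ →
    pairing L u (partialDeriv i ψ) = -pairing L g ψ

open Classical in
/-- The weak partial derivative of `u` in the direction `i` (it is unique if it exists, as it
does for every `u` in `V`; the value is `0` if there is none). -/
def weakPartial (L : ℝ) (i : Fin 3) (u : L2 L) : L2 L :=
  if h : ∃ g, IsWeakPartial L i u g then h.choose else 0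

/-- The convective term `(u · ∇) v`. -/
def convect (L : ℝ) (u v : L2 L) (x : E3) : E3 :=
  ∑ i, u x i • weakPartial L i v x

/-- For a test field `φ ∈ ℋ`, the pairing of `f - ν A u - B(u, u)` with `φ`. Here
`(A u, φ) = (u, A φ) = -(u, Δ φ)`, and `(B(u, u), φ) = (Π[(u · ∇) u], φ) = ((u · ∇) u, φ)`,
because `φ` lies in `H`. -/
def rhs (L ν : ℝ) (f u : L2 L) (φ : E3 → E3) : ℝ :=
  pairing L f φ + ν * pairing L u (Laplacian.laplacian φ) - pairing L (convect L u u) φ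

/-- An orthonormal basis of `H` made of eigenfunctions of the Stokes operator
(`A w = -Δ w = λ w`), listed in the order of non-decreasing eigenvalues; the indices start
from `0`. The order within an eigenspace, and the basis of it, are arbitrary. -/
structure StokesBasis (L : ℝ) where
  /-- the eigenfunctions, which are smooth -/
  w : ℕ → E3 → E3
  /-- the eigenvalues -/
  ev : ℕ → ℝ
  solenoidal : ∀ j, IsSolenoidal L (w j)
  eigen : ∀ j x, -Laplacian.laplacian (w j) x = ev j • w j x
  mono : Monotone ev
  orthonormal : ∀ i j, pairing L (w i) (w j) = if i = j then 1 else 0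
  complete : ∀ u ∈ H L, (∀ j, pairing L u (w j) = 0) → u = 0

namespace StokesBasis

variable {L : ℝ} (S : StokesBasis L)

/-- The norm `‖u‖_m = |A^{m/2} u| = (∑ λ_j^m (u, w_j)^2)^{1/2}` of `u ∈ H`, with value `∞` if
`u` does not lie in the domain of `A^{m/2}`. It does not depend on the choice of the basis. -/
def vNorm (m : ℕ) (u : L2 L) : ℝ≥0∞ :=
  (∑' j, ENNReal.ofReal (S.ev j ^ m * pairing L u (S.w j) ^ 2)) ^ (1 / 2 : ℝ)

/-- The space `V^m = D(A^{m/2})`. -/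
def V (m : ℕ) : Set (L2 L) := {u | u ∈ H L ∧ S.vNorm m u < ∞}

/-- The norm of `L^p(0, T; V^m)`. -/
def bochnerNorm (p : ℝ≥0∞) (m : ℕ) (T : ℝ) (u : ℝ → L2 L) : ℝ≥0∞ :=
  eLpNorm (fun t => S.vNorm m (u t)) p (volume.restrict (Ioo 0 T))

/-- Membership in `L^p(0, T; V^m)`. -/
structure MemBochner (p : ℝ≥0∞) (m : ℕ) (T : ℝ) (u : ℝ → L2 L) : Prop where
  measurable : AEStronglyMeasurable u (volume.restrict (Ioo 0 T))
  mem_V : ∀ᵐ t ∂(volume.restrict (Ioo 0 T)), u t ∈ S.V m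
  norm_lt_top : S.bochnerNorm p m T u < ∞

/-- `u` is a strong solution on `[0, T]` of `du/dt + ν A u + B(u, u) = f`, `u(0) = u₀`: it lies
in `L^∞(0, T; V) ∩ L^2(0, T; V^2)` and satisfies the equation, integrated in time, against
every test field `φ ∈ ℋ`. -/
structure IsStrongSolution (ν T : ℝ) (u₀ : L2 L) (f u : ℝ → L2 L) : Prop where
  mem_H : ∀ t ∈ Icc 0 T, u t ∈ H L
  mem_V_one : S.MemBochner ∞ 1 T u
  mem_V_two : S.MemBochner 2 2 T u
  equation : ∀ φ, IsSolenoidal L φ → ∀ t ∈ Icc 0 T,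
    pairing L (u t) φ = pairing L u₀ φ + ∫ s in (0 : ℝ)..t, rhs L ν (f s) (u s) φ

/-- The space `P_n H`, the span of the first `n` eigenfunctions. -/
def galerkinSpace (n : ℕ) : Set (L2 L) :=
  {v | ∃ c : Fin n → ℝ, ∀ᵐ x ∂(cellMeasure L), v x = ∑ j, c j • S.w j x}

/-- `v` solves on `[0, T]` the Galerkin equation
`dv/dt + ν A v + P_n B(v, v) = P_n f`, `v(0) = P_n u₀`: it is a continuous function with values
in `P_n H`, and the equation, integrated in time, holds in each of the components
`(·, w_k)`, `k < n`. -/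
structure IsGalerkinSolution (n : ℕ) (ν T : ℝ) (u₀ : L2 L) (f v : ℝ → L2 L) : Prop where
  mem_space : ∀ t ∈ Icc 0 T, v t ∈ S.galerkinSpace n
  continuousOn : ContinuousOn v (Icc 0 T)
  equation : ∀ k < n, ∀ t ∈ Icc 0 T,
    pairing L (v t) (S.w k) =
      pairing L u₀ (S.w k) + ∫ s in (0 : ℝ)..t, rhs L ν (f s) (v s) (S.w k)

end StokesBasis

end

end NavierStokes

/-!
In the basis `w_j` of Stokes eigenfunctions the equation becomes a system of scalar equations for
the coefficients `c_j = (u, w_j)`, and the norm of `V^k` becomes `∑ λ_j^k c_j²` (`energy`). Two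
facts drive the proof.

*Gain of one derivative.* If `c_j' + ν λ_j c_j = g_j`, then `‖c(t)‖²_{k+1} + ν ∫ ‖c‖²_{k+2} ≤
‖c(0)‖²_{k+1} + ν⁻¹ ∫ ‖g‖²_k` (`energy_inequality`).

*Estimates of the convective term.* In dimension three `‖B(a, b)‖₀² ≤ C ‖a‖₁² ‖b‖₂²`, `‖B(a, b)‖₀²
≤ C ‖a‖₂² ‖b‖₁²`, and `‖B(a, b)‖²_{k+1} ≤ C_k ‖a‖²_{k+2} ‖b‖²_{k+2}`. By Parseval's identity on
the cell an eigenfunction has Fourier coefficients only at the wave vectors of squared length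
`λ_j`, so on finite combinations of eigenfunctions `‖·‖_k` is the usual Sobolev norm
(`StokesBasis.fourierEnergy_combo`), and by duality the component of a smooth field in `H` is
controlled by the Sobolev norm of the field (`StokesBasis.ofReal_sum_le_fourierEnergy`). Products
become convolutions of Fourier coefficients, and the estimates follow from the Cauchy-Schwarz
inequality and the convergence of `∑ |κ|⁻⁴` over `ℤ³ \ {0}` (`tsum_conv_sq_le_one_one`,
`tsum_conv_sq_le_two_zero`, `tsum_weight_conv_sq_le`).

Everything else is abstract. A `GalerkinFrame` records an orthonormal system, its eigenvalues and
the components `T k` of the quadratic term, with these estimates and the skew symmetry. The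
components `T k (x, y) = -∑_i ∫ x_i y · ∂_i w_k` are bounded bilinear forms on `[L²(Q)]³`, since
the derivative falls on the smooth eigenfunction, and they agree with the pairing of `(u · ∇) u`
with `w_k` whenever `u ∈ V` (`StokesBasis.pairing_convect`). The Galerkin equation is an ordinary
differential equation with a dissipative vector field and an integrable forcing, so it is uniquely
solvable on the whole interval (`GalerkinFrame.galerkin_exists_unique`).

Convergence in `L^∞(0, T; V) ∩ L²(0, T; V²)` (`GalerkinFrame.Scheme.levelConv_zero`) is a
stability argument around the strong solution. The difference of `u_n` and `P_n u` starts from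
zero and is driven by a remainder that tends to zero; the term that is quadratic in the difference
is absorbed by the dissipation as long as the difference is small, and Grönwall's inequality keeps
it small. Each further level follows from the one below (`GalerkinFrame.Scheme.levelConv_succ`):
the convergence already known makes `∫ ‖u_n‖²_{k+2}` bounded, Grönwall's inequality then bounds
`u_n`, and with it `u`, in `L^∞(0, T; V^{k+2})`, and with this bound the difference of the
quadratic terms tends to zero in `L²(0, T; V^{k+1})`. The gain of one derivative turns this into
convergence in `L^∞(0, T; V^{k+2}) ∩ L²(0, T; V^{k+3})`.
-/

namespace NavierStokes

/-! ### Integral equations with integrable right-hand side -/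

theorem ae_hasDerivAt_primitive {g : ℝ → ℝ} {a b : ℝ} (hg : IntervalIntegrable g volume a b)
    (c₀ : ℝ) : ∀ᵐ x, x ∈ uIcc a b → HasDerivAt (fun t => c₀ + ∫ s in a..t, g s) (g x) x := by
  filter_upwards [hg.ae_hasDerivAt_integral] with x hx hxab
  exact (hx hxab a left_mem_uIcc).const_add c₀

theorem absolutelyContinuous_primitive {g : ℝ → ℝ} {a b : ℝ}
    (hg : IntervalIntegrable g volume a b) (c₀ : ℝ) :
    AbsolutelyContinuousOnInterval (fun t => c₀ + ∫ s in a..t, g s) a b := by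
  have h1 : AbsolutelyContinuousOnInterval (fun _ : ℝ => c₀) a b :=
    ((LipschitzWith.const c₀).lipschitzOnWith).absolutelyContinuousOnInterval
  exact h1.add (hg.absolutelyContinuousOnInterval_intervalIntegral left_mem_uIcc)

/-- A function with an integrable derivative satisfies `c² = c(0)² + 2 ∫ c' c`. -/
theorem sq_eq_add_integral {c g : ℝ → ℝ} {c₀ t : ℝ} (ht : 0 ≤ t)
    (hg : IntervalIntegrable g volume 0 t)
    (hc : ∀ s ∈ Icc 0 t, c s = c₀ + ∫ r in (0 : ℝ)..s, g r) :
    c t ^ 2 = c₀ ^ 2 + 2 * ∫ s in (0 : ℝ)..t, g s * c s := by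
  have hac := absolutelyContinuous_primitive hg c₀
  have h := hac.integral_deriv_mul_eq_sub hac
  have hcongr : ∫ x in (0 : ℝ)..t, (deriv (fun t => c₀ + ∫ s in (0 : ℝ)..t, g s) x *
      (c₀ + ∫ s in (0 : ℝ)..x, g s) + (c₀ + ∫ s in (0 : ℝ)..x, g s) *
      deriv (fun t => c₀ + ∫ s in (0 : ℝ)..t, g s) x) = ∫ s in (0 : ℝ)..t, 2 * (g s * c s) := by
    apply intervalIntegral.integral_congr_ae
    filter_upwards [ae_hasDerivAt_primitive hg c₀] with x hx hxm
    have hxu : x ∈ uIcc 0 t := uIoc_subset_uIcc hxm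
    rw [(hx hxu).deriv, hc x (by rwa [uIcc_of_le ht] at hxu)]
    ring
  rw [hcongr, intervalIntegral.integral_const_mul] at h
  rw [h, hc t ⟨ht, le_rfl⟩, intervalIntegral.integral_same]
  ring

theorem absolutelyContinuous_exp_neg {A : ℝ → ℝ} {a b : ℝ}
    (hA : AbsolutelyContinuousOnInterval A a b) (h0 : ∀ x ∈ uIcc a b, 0 ≤ A x) :
    AbsolutelyContinuousOnInterval (fun t => Real.exp (-A t)) a b := by
  rw [absolutelyContinuousOnInterval_iff] at hA ⊢
  intro ε hε
  obtain ⟨δ, hδ, h⟩ := hA ε hε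
  refine ⟨δ, hδ, fun E hE hlt => lt_of_le_of_lt (Finset.sum_le_sum fun i hi => ?_) (h E hE hlt)⟩
  have key : ∀ x y : ℝ, 0 ≤ x → 0 ≤ y → Real.exp (-x) - Real.exp (-y) ≤ |x - y| := by
    intro x y hx hy
    rcases le_total y x with hxy | hxy
    · have : Real.exp (-x) ≤ Real.exp (-y) := Real.exp_le_exp.2 (by linarith)
      linarith [abs_nonneg (x - y)]
    · have h1 : 1 - (y - x) ≤ Real.exp (-(y - x)) := by
        linarith [Real.add_one_le_exp (-(y - x))]
      have h2 : Real.exp (-y) = Real.exp (-x) * Real.exp (-(y - x)) := by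
        rw [← Real.exp_add]; ring_nf
      have h3 : Real.exp (-x) ≤ 1 := Real.exp_le_one_iff.2 (by linarith)
      have h4 := Real.exp_pos (-x)
      rw [abs_sub_comm, abs_of_nonneg (by linarith), h2]
      nlinarith
  have h1 := h0 _ (hE.1 i hi).1
  have h2 := h0 _ (hE.1 i hi).2
  simp only [Real.dist_eq]
  rw [abs_le]
  have k1 := key _ _ h1 h2
  have k2 := key _ _ h2 h1
  rw [abs_sub_comm] at k2
  constructor <;> linarith

/-- Grönwall's inequality in integral form, with an integrable coefficient. -/
theorem gronwall_integral {a y : ℝ → ℝ} {K t : ℝ} (ht : 0 ≤ t)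
    (ha : IntervalIntegrable a volume 0 t) (ha0 : ∀ s, 0 ≤ a s)
    (hy : ContinuousOn y (Icc 0 t))
    (h : ∀ s ∈ Icc 0 t, y s ≤ K + ∫ r in (0 : ℝ)..s, a r * y r) :
    y t ≤ K * Real.exp (∫ s in (0 : ℝ)..t, a s) := by
  have hay : IntervalIntegrable (fun s => a s * y s) volume 0 t :=
    ha.mul_continuousOn (by rwa [uIcc_of_le ht])
  have hac := absolutelyContinuous_primitive hay K
  have hA : AbsolutelyContinuousOnInterval (fun s => ∫ r in (0 : ℝ)..s, a r) 0 t :=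
    ha.absolutelyContinuousOnInterval_intervalIntegral left_mem_uIcc
  have hE := absolutelyContinuous_exp_neg hA (fun x hx => by
    rw [uIcc_of_le ht] at hx
    exact intervalIntegral.integral_nonneg hx.1 fun s _ => ha0 s)
  have hprod := hac.integral_deriv_mul_eq_sub hE
  have hle : ∫ x in (0 : ℝ)..t, (deriv (fun s => K + ∫ r in (0 : ℝ)..s, a r * y r) x *
      Real.exp (-∫ r in (0 : ℝ)..x, a r) + (K + ∫ r in (0 : ℝ)..x, a r * y r) *
      deriv (fun s => Real.exp (-∫ r in (0 : ℝ)..s, a r)) x) ≤ 0 := by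
    rw [intervalIntegral.integral_of_le ht]
    apply integral_nonpos_of_ae
    rw [EventuallyLE, ae_restrict_iff' measurableSet_Ioc]
    filter_upwards [ae_hasDerivAt_primitive hay K, ha.ae_hasDerivAt_integral] with x hx hx' hxm
    have hxu : x ∈ uIcc 0 t := by rw [uIcc_of_le ht]; exact Ioc_subset_Icc_self hxm
    have hd : HasDerivAt (fun s => Real.exp (-∫ r in (0 : ℝ)..s, a r))
        (Real.exp (-∫ r in (0 : ℝ)..x, a r) * -a x) x := ((hx' hxu 0 left_mem_uIcc).neg).exp
    rw [(hx hxu).deriv, hd.deriv]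
    have h1 := h x (Ioc_subset_Icc_self hxm)
    have h2 := mul_nonneg (ha0 x) (Real.exp_pos (-∫ r in (0 : ℝ)..x, a r)).le
    simp only [Pi.zero_apply]
    nlinarith
  rw [hprod] at hle
  simp only [intervalIntegral.integral_same, neg_zero, Real.exp_zero, mul_one, add_zero] at hle
  have h1 := h t ⟨ht, le_rfl⟩
  rw [Real.exp_neg] at hle
  have hp := Real.exp_pos (∫ s in (0 : ℝ)..t, a s)
  have h2 : (K + ∫ r in (0 : ℝ)..t, a r * y r) ≤ K * Real.exp (∫ s in (0 : ℝ)..t, a s) := by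
    rwa [sub_nonpos, ← div_eq_mul_inv, div_le_iff₀ hp] at hle
  exact h1.trans h2

/-- Grönwall's inequality, for a coefficient with values in `[0, ∞]` and finite integral. -/
theorem gronwall_lintegral {a : ℝ → ℝ≥0∞} {y : ℝ → ℝ} {K T : ℝ}
    (ha : AEMeasurable a (volume.restrict (Ioc 0 T))) (haT : ∫⁻ s in Ioc 0 T, a s ≠ ∞)
    (hK : 0 ≤ K) (hy : ContinuousOn y (Icc 0 T)) (hy0 : ∀ t ∈ Icc 0 T, 0 ≤ y t)
    {t : ℝ} (ht : t ∈ Icc 0 T)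
    (h : ∀ s ∈ Icc 0 t, ENNReal.ofReal (y s) ≤
      ENNReal.ofReal K + ∫⁻ r in Ioc 0 s, a r * ENNReal.ofReal (y r)) :
    y t ≤ K * Real.exp (∫⁻ s in Ioc 0 T, a s).toReal := by
  have hint : IntegrableOn (fun s => (a s).toReal) (Ioc 0 T) :=
    integrable_toReal_of_lintegral_ne_top ha haT
  have hsub : Ioc 0 t ⊆ Ioc 0 T := Ioc_subset_Ioc_right ht.2
  have hfin : ∀ᵐ s ∂(volume.restrict (Ioc 0 T)), a s < ∞ := ae_lt_top' ha haT
  have hint' : IntervalIntegrable (fun s => (a s).toReal) volume 0 t :=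
    (intervalIntegrable_iff_integrableOn_Ioc_of_le ht.1).2 (hint.mono_set hsub)
  have hyt : ContinuousOn y (Icc 0 t) := hy.mono (Icc_subset_Icc_right ht.2)
  have hay : IntervalIntegrable (fun s => (a s).toReal * y s) volume 0 t :=
    hint'.mul_continuousOn (by rwa [uIcc_of_le ht.1])
  have key := gronwall_integral (K := K) ht.1 hint' (fun _ => ENNReal.toReal_nonneg) hyt (by
    intro s hs
    have hsT : Ioc 0 s ⊆ Ioc 0 T := Ioc_subset_Ioc_right (hs.2.trans ht.2)
    have hnn : 0 ≤ᵐ[volume.restrict (Ioc 0 s)] fun r => (a r).toReal * y r := by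
      filter_upwards [ae_restrict_mem measurableSet_Ioc] with r hr
      exact mul_nonneg ENNReal.toReal_nonneg (hy0 r (Ioc_subset_Icc_self (hsT hr)))
    have heq : ∫⁻ r in Ioc 0 s, a r * ENNReal.ofReal (y r) =
        ENNReal.ofReal (∫ r in (0 : ℝ)..s, (a r).toReal * y r) := by
      rw [intervalIntegral.integral_of_le hs.1, ofReal_integral_eq_lintegral_ofReal
        (((intervalIntegrable_iff_integrableOn_Ioc_of_le ht.1).1 hay).mono_set
          (Ioc_subset_Ioc_right hs.2)) hnn]
      apply lintegral_congr_ae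
      filter_upwards [ae_restrict_of_ae_restrict_of_subset hsT hfin] with r hr
      rw [ENNReal.ofReal_mul ENNReal.toReal_nonneg, ENNReal.ofReal_toReal hr.ne]
    have h1 := h s hs
    have h0 : 0 ≤ ∫ r in (0 : ℝ)..s, (a r).toReal * y r := by
      rw [intervalIntegral.integral_of_le hs.1]
      exact integral_nonneg_of_ae hnn
    rw [heq, ← ENNReal.ofReal_add hK h0, ENNReal.ofReal_le_ofReal_iff (by positivity)] at h1
    exact h1)
  refine key.trans (mul_le_mul_of_nonneg_left (Real.exp_le_exp.2 ?_) hK)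
  rw [← integral_toReal ha hfin, intervalIntegral.integral_of_le ht.1]
  exact setIntegral_mono_set hint (Eventually.of_forall fun _ => ENNReal.toReal_nonneg)
    hsub.eventuallyLE

/-- Grönwall's inequality in a bootstrap form: the integral inequality is only known as long as
`y` does not exceed `δ`, and the resulting bound is smaller than `δ`. -/
theorem gronwall_bootstrap {a : ℝ → ℝ≥0∞} {y : ℝ → ℝ} {K T δ : ℝ}
    (ha : AEMeasurable a (volume.restrict (Ioc 0 T))) (haT : ∫⁻ s in Ioc 0 T, a s ≠ ∞)
    (hK : 0 ≤ K) (hy : ContinuousOn y (Icc 0 T)) (hy0 : ∀ t ∈ Icc 0 T, 0 ≤ y t)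
    (hδ : K * Real.exp (∫⁻ s in Ioc 0 T, a s).toReal < δ) (hyδ : y 0 < δ)
    (h : ∀ t ∈ Icc 0 T, (∀ s ∈ Icc 0 t, y s ≤ δ) → ENNReal.ofReal (y t) ≤
      ENNReal.ofReal K + ∫⁻ r in Ioc 0 t, a r * ENNReal.ofReal (y r)) :
    ∀ t ∈ Icc 0 T, y t ≤ K * Real.exp (∫⁻ s in Ioc 0 T, a s).toReal := by
  have main : ∀ t ∈ Icc 0 T, (∀ s ∈ Icc 0 t, y s ≤ δ) →
      y t ≤ K * Real.exp (∫⁻ s in Ioc 0 T, a s).toReal := fun t ht hs =>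
    gronwall_lintegral ha haT hK hy hy0 ht fun s hs' =>
      h s ⟨hs'.1, hs'.2.trans ht.2⟩ fun r hr => hs r ⟨hr.1, hr.2.trans hs'.2⟩
  -- The set of times up to which `y ≤ δ` is closed, and open to the right by the strict inequality
  -- `hδ`.
  have hle : ∀ t ∈ Icc 0 T, y t ≤ δ := by
    have hcl : IsClosed ({t | y t ≤ δ} ∩ Icc 0 T) := by
      have := hy.preimage_isClosed_of_isClosed isClosed_Icc (isClosed_Iic (a := δ))
      rwa [inter_comm] at this
    have hall : ∀ t ∈ Icc 0 T, ∀ s ∈ Icc 0 t, y s ≤ δ := by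
      have hs : Icc (0 : ℝ) T ⊆ {t | ∀ s ∈ Icc 0 t, y s ≤ δ} := by
        refine IsClosed.Icc_subset_of_forall_mem_nhdsWithin ?_ ?_ ?_
        · rw [← closure_subset_iff_isClosed]
          intro t ht
          have htT : t ∈ Icc 0 T :=
            isClosed_Icc.closure_subset_iff.2 inter_subset_right ht
          refine ⟨fun s hs => ?_, htT⟩
          rcases hs.2.lt_or_eq with hlt | rfl
          · obtain ⟨r, hr1, hr2⟩ := mem_closure_iff.1 ht (Ioi s) isOpen_Ioi hlt
            exact hr2.1 s ⟨hs.1, le_of_lt hr1⟩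
          · have : s ∈ {t | y t ≤ δ} ∩ Icc 0 T := by
              refine hcl.closure_subset_iff.2 (fun r hr => ⟨hr.1 r ⟨hr.2.1, le_rfl⟩, hr.2⟩) ht
            exact this.1
        · intro s hs
          have : s = 0 := le_antisymm hs.2 hs.1
          rw [this]; exact hyδ.le
        · rintro t ⟨ht, htI⟩
          have hlt : y t < δ := (main t ⟨htI.1, htI.2.le⟩ ht).trans_lt hδ
          have hev : ∀ᶠ s in 𝓝[Icc 0 T] t, y s < δ :=
            (hy t ⟨htI.1, htI.2.le⟩).eventually_lt continuousWithinAt_const hlt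
          obtain ⟨ε, hε, hball⟩ := Metric.mem_nhdsWithin_iff.1 hev
          have : Ioo t (min (t + ε) T) ∈ 𝓝[>] t := Ioo_mem_nhdsGT (by
            rw [lt_min_iff]; exact ⟨by linarith, htI.2⟩)
          filter_upwards [this] with r hr s hs
          rcases le_or_gt s t with hst | hst
          · exact ht s ⟨hs.1, hst⟩
          · have hr2 := lt_min_iff.1 hr.2
            refine le_of_lt (hball ⟨?_, hs.1, hs.2.trans hr2.2.le⟩)
            rw [Metric.mem_ball, Real.dist_eq, abs_of_pos (by linarith)]
            linarith [hs.2]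
      exact fun t ht => hs ht
    exact fun t ht => hall t ht t ⟨ht.1, le_rfl⟩
  exact fun t ht => main t ht fun s hs => hle s ⟨hs.1, hs.2.trans ht.2⟩

theorem aemeasurable_restrict_Ioc {c : ℝ → ℝ} {t : ℝ} (hc : ContinuousOn c (Icc 0 t)) :
    AEMeasurable c (volume.restrict (Ioc 0 t)) :=
  (hc.mono Ioc_subset_Icc_self).aemeasurable measurableSet_Ioc

/-- The energy inequality for the scalar equation `c' + κ c = g`. -/
theorem energy_component {c g : ℝ → ℝ} {c₀ κ t : ℝ} (hκ : 0 < κ) (ht : 0 ≤ t)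
    (hg : IntervalIntegrable g volume 0 t) (hc : ContinuousOn c (Icc 0 t))
    (heq : ∀ s ∈ Icc 0 t, c s = c₀ + ∫ r in (0 : ℝ)..s, (g r - κ * c r)) :
    ENNReal.ofReal (c t ^ 2) + ENNReal.ofReal κ * ∫⁻ s in Ioc 0 t, ENNReal.ofReal (c s ^ 2) ≤
      ENNReal.ofReal (c₀ ^ 2) +
        ENNReal.ofReal κ⁻¹ * ∫⁻ s in Ioc 0 t, ENNReal.ofReal (g s ^ 2) := by
  by_cases htop : ∫⁻ s in Ioc 0 t, ENNReal.ofReal (g s ^ 2) = ∞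
  · rw [htop, ENNReal.mul_top (by simpa using hκ)]
    simp
  have hgm : AEStronglyMeasurable g (volume.restrict (Ioc 0 t)) :=
    ((intervalIntegrable_iff_integrableOn_Ioc_of_le ht).1 hg).1
  have hc' : ContinuousOn c (uIcc 0 t) := by rwa [uIcc_of_le ht]
  have hgi : IntervalIntegrable (fun s => g s ^ 2) volume 0 t := by
    rw [intervalIntegrable_iff_integrableOn_Ioc_of_le ht]
    refine ⟨hgm.pow 2, ?_⟩
    rw [hasFiniteIntegral_iff_ofReal (Eventually.of_forall fun s => sq_nonneg (g s))]
    exact lt_top_iff_ne_top.2 htop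
  have hci : IntervalIntegrable (fun s => c s ^ 2) volume 0 t := (hc'.pow 2).intervalIntegrable
  have hgc : IntervalIntegrable (fun s => g s - κ * c s) volume 0 t :=
    hg.sub (hc'.intervalIntegrable.const_mul κ)
  have hsq := sq_eq_add_integral ht hgc heq
  have hmono : ∫ s in (0 : ℝ)..t, (g s - κ * c s) * c s ≤
      ∫ s in (0 : ℝ)..t, (κ⁻¹ / 2 * g s ^ 2 - κ / 2 * c s ^ 2) := by
    refine intervalIntegral.integral_mono_on ht (hgc.mul_continuousOn hc')
      ((hgi.const_mul _).sub (hci.const_mul _)) fun s _ => ?_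
    have : κ⁻¹ / 2 * g s ^ 2 - κ / 2 * c s ^ 2 - (g s - κ * c s) * c s =
        κ⁻¹ / 2 * (g s - κ * c s) ^ 2 := by field_simp; ring
    have h2 : 0 ≤ κ⁻¹ / 2 * (g s - κ * c s) ^ 2 := by positivity
    linarith
  rw [intervalIntegral.integral_sub (hgi.const_mul _) (hci.const_mul _),
    intervalIntegral.integral_const_mul, intervalIntegral.integral_const_mul] at hmono
  have conv : ∀ {h : ℝ → ℝ}, IntervalIntegrable (fun s => h s ^ 2) volume 0 t →
      ∫⁻ s in Ioc 0 t, ENNReal.ofReal (h s ^ 2) =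
        ENNReal.ofReal (∫ s in (0 : ℝ)..t, h s ^ 2) := by
    intro h hh
    rw [intervalIntegral.integral_of_le ht, ofReal_integral_eq_lintegral_ofReal
      ((intervalIntegrable_iff_integrableOn_Ioc_of_le ht).1 hh)
      (Eventually.of_forall fun s => sq_nonneg (h s))]
  have hg0 : 0 ≤ ∫ s in (0 : ℝ)..t, g s ^ 2 :=
    intervalIntegral.integral_nonneg ht fun s _ => sq_nonneg (g s)
  have hc0 : 0 ≤ ∫ s in (0 : ℝ)..t, c s ^ 2 :=
    intervalIntegral.integral_nonneg ht fun s _ => sq_nonneg (c s)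
  rw [conv hgi, conv hci, ← ENNReal.ofReal_mul hκ.le, ← ENNReal.ofReal_mul (inv_pos.2 hκ).le,
    ← ENNReal.ofReal_add (sq_nonneg _) (by positivity),
    ← ENNReal.ofReal_add (sq_nonneg _) (by positivity)]
  apply ENNReal.ofReal_le_ofReal
  linarith

/-- The quantity `∑ λ_j^k c_j²`: the square of the norm of `V^k`, in terms of the
coefficients. -/
noncomputable def energy (lam : ℕ → ℝ) (k : ℕ) (c : ℕ → ℝ) : ℝ≥0∞ :=
  ∑' j, ENNReal.ofReal (lam j ^ k * c j ^ 2)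

theorem aemeasurable_energy {α : Type*} [MeasurableSpace α] {μ : Measure α} {lam : ℕ → ℝ} (k : ℕ)
    {c : α → ℕ → ℝ} (hc : ∀ j, AEMeasurable (fun s => c s j) μ) :
    AEMeasurable (fun s => energy lam k (c s)) μ :=
  AEMeasurable.tsum fun j =>
    (((hc j).pow_const 2).const_mul (lam j ^ k)).ennreal_ofReal

/-- The energy inequality at level `k + 1` for the diagonal system `c' + ν λ c = g`. Only `k`
powers of `λ` fall on the right-hand side: this is the gain of one derivative. -/
theorem energy_inequality {lam : ℕ → ℝ} (hlam : ∀ j, 0 < lam j) {ν : ℝ} (hν : 0 < ν)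
    {t : ℝ} (ht : 0 ≤ t) {c g : ℝ → ℕ → ℝ} {c₀ : ℕ → ℝ}
    (hg : ∀ j, IntervalIntegrable (fun s => g s j) volume 0 t)
    (hc : ∀ j, ContinuousOn (fun s => c s j) (Icc 0 t))
    (heq : ∀ j, ∀ s ∈ Icc 0 t, c s j = c₀ j + ∫ r in (0 : ℝ)..s, (g r j - ν * lam j * c r j))
    (k : ℕ) :
    energy lam (k + 1) (c t) + ENNReal.ofReal ν * ∫⁻ s in Ioc 0 t, energy lam (k + 2) (c s) ≤
      energy lam (k + 1) c₀ + ENNReal.ofReal ν⁻¹ * ∫⁻ s in Ioc 0 t, energy lam k (g s) := by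
  have hcm : ∀ j, AEMeasurable (fun s => c s j) (volume.restrict (Ioc 0 t)) :=
    fun j => aemeasurable_restrict_Ioc (hc j)
  have hgm : ∀ j, AEMeasurable (fun s => g s j) (volume.restrict (Ioc 0 t)) := fun j =>
    ((intervalIntegrable_iff_integrableOn_Ioc_of_le ht).1 (hg j)).1.aemeasurable
  unfold energy
  rw [lintegral_tsum fun j => (((hcm j).pow_const 2).const_mul _).ennreal_ofReal,
    lintegral_tsum fun j => (((hgm j).pow_const 2).const_mul _).ennreal_ofReal,
    ← ENNReal.tsum_mul_left, ← ENNReal.tsum_mul_left, ← ENNReal.tsum_add, ← ENNReal.tsum_add]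
  refine ENNReal.tsum_le_tsum fun j => ?_
  have hl := hlam j
  have h := energy_component (mul_pos hν hl) ht (hg j) (hc j) (heq j)
  have h2 := mul_le_mul_right h (ENNReal.ofReal (lam j ^ (k + 1)))
  rw [mul_add, mul_add, ← mul_assoc, ← mul_assoc, ← ENNReal.ofReal_mul (by positivity),
    ← ENNReal.ofReal_mul (by positivity), ← ENNReal.ofReal_mul (by positivity),
    ← ENNReal.ofReal_mul (by positivity)] at h2
  have e1 : ∀ (x : ℝ) (i : ℕ), ENNReal.ofReal (lam j ^ i * x ^ 2) =
      ENNReal.ofReal (lam j ^ i) * ENNReal.ofReal (x ^ 2) := fun x i =>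
    ENNReal.ofReal_mul (by positivity)
  simp only [e1]
  rw [lintegral_const_mul' _ _ ENNReal.ofReal_ne_top,
    lintegral_const_mul' _ _ ENNReal.ofReal_ne_top,
    ← mul_assoc, ← mul_assoc, ← ENNReal.ofReal_mul (by positivity),
    ← ENNReal.ofReal_mul (by positivity), ← ENNReal.ofReal_mul (by positivity)]
  convert h2 using 4
  · ring
  · rw [← ENNReal.ofReal_mul (by positivity)]
    congr 1
    rw [pow_succ]
    field_simp

/-! ### Dissipative ordinary differential equations with integrable forcing -/

section ODE

variable {V : Type*} [NormedAddCommGroup V] [InnerProductSpace ℝ V] [FiniteDimensional ℝ V]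

theorem norm_sq_eq_add_integral {y g : ℝ → V} {y₀ : V} {t : ℝ} (ht : 0 ≤ t)
    (hg : IntervalIntegrable g volume 0 t) (hyc : ContinuousOn y (Icc 0 t))
    (hy : ∀ s ∈ Icc 0 t, y s = y₀ + ∫ r in (0 : ℝ)..s, g r) :
    ‖y t‖ ^ 2 = ‖y₀‖ ^ 2 + 2 * ∫ s in (0 : ℝ)..t, inner ℝ (g s) (y s) := by
  let b := stdOrthonormalBasis ℝ V
  have hgi : ∀ i, IntervalIntegrable (fun s => inner ℝ (b i) (g s)) volume 0 t := fun i => by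
    rw [intervalIntegrable_iff] at hg ⊢
    exact (innerSL ℝ (b i)).integrable_comp hg
  have hyi : ∀ i, ContinuousOn (fun s => inner ℝ (b i) (y s)) (uIcc 0 t) := fun i => by
    rw [uIcc_of_le ht]
    exact (innerSL ℝ (b i)).continuous.comp_continuousOn hyc
  have hi : ∀ i, inner ℝ (b i) (y t) ^ 2 = inner ℝ (b i) y₀ ^ 2 +
      2 * ∫ s in (0 : ℝ)..t, inner ℝ (b i) (g s) * inner ℝ (b i) (y s) := fun i => by
    refine sq_eq_add_integral (c := fun s => inner ℝ (b i) (y s)) ht (hgi i) fun s hs => ?_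
    have hgs : IntervalIntegrable g volume 0 s :=
      hg.mono_set (by rw [uIcc_of_le ht, uIcc_of_le hs.1]; exact Icc_subset_Icc_right hs.2)
    have := (innerSL ℝ (b i)).intervalIntegral_comp_comm hgs
    simp only [innerSL_apply_apply] at this
    rw [this, hy s hs, inner_add_right]
  have hsum : ∀ x : V, ‖x‖ ^ 2 = ∑ i, inner ℝ (b i) x ^ 2 := fun x => by
    rw [← b.sum_sq_norm_inner_right x]
    simp
  rw [hsum, hsum, Finset.sum_congr rfl fun i _ => hi i, Finset.sum_add_distrib, ← Finset.mul_sum,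
    ← intervalIntegral.integral_finsetSum fun i _ => (hgi i).mul_continuousOn (hyi i)]
  congr 3
  ext s
  rw [← b.sum_inner_mul_inner (g s) (y s)]
  exact Finset.sum_congr rfl fun i _ => by rw [real_inner_comm]

/-- An a priori bound. It comes from the identity for `‖y‖²` at the point where `‖y‖` is largest:
there `‖y‖² ≤ ‖y₀‖² + 2 ‖y‖ ∫ ‖f‖`. -/
theorem norm_le_of_dissipative {y F f : ℝ → V} {y₀ : V} {T : ℝ}
    (hF : IntervalIntegrable F volume 0 T) (hf : IntervalIntegrable f volume 0 T)
    (hyc : ContinuousOn y (Icc 0 T)) (hdis : ∀ t ∈ Icc 0 T, inner ℝ (F t) (y t) ≤ 0)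
    (hy : ∀ t ∈ Icc 0 T, y t = y₀ + ∫ s in (0 : ℝ)..t, (F s + f s)) :
    ∀ t ∈ Icc 0 T, ‖y t‖ ≤ ‖y₀‖ + 2 * ∫ s in (0 : ℝ)..T, ‖f s‖ := by
  intro t₁ ht₁
  have hT : 0 ≤ T := ht₁.1.trans ht₁.2
  obtain ⟨t, ht, hmax⟩ := isCompact_Icc.exists_isMaxOn ⟨t₁, ht₁⟩ hyc.norm
  refine (hmax ht₁).trans ?_
  change ‖y t‖ ≤ _
  have hsub : uIcc 0 t ⊆ uIcc 0 T := by
    rw [uIcc_of_le hT, uIcc_of_le ht.1]; exact Icc_subset_Icc_right ht.2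
  have hyct : ContinuousOn y (Icc 0 t) := hyc.mono (Icc_subset_Icc_right ht.2)
  have hFt := hF.mono_set hsub
  have hft := hf.mono_set hsub
  have h := norm_sq_eq_add_integral ht.1 (hFt.add hft) hyct
    fun s hs => hy s ⟨hs.1, hs.2.trans ht.2⟩
  have hi0 : ‖y₀‖ ≤ ‖y t‖ := by
    have h0 := hmax (show (0 : ℝ) ∈ Icc 0 T from ⟨le_rfl, hT⟩)
    simpa [hy 0 ⟨le_rfl, hT⟩] using h0
  have hle : ∫ s in (0 : ℝ)..t, inner ℝ (F s + f s) (y s) ≤ ∫ s in (0 : ℝ)..t, ‖f s‖ * ‖y t‖ := by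
    refine intervalIntegral.integral_mono_on ht.1 ?_ (hft.norm.mul_const _) fun s hs => ?_
    · have : ContinuousOn y (uIcc 0 t) := by rwa [uIcc_of_le ht.1]
      rw [intervalIntegrable_iff]
      have h1 := (intervalIntegrable_iff.1 (hFt.add hft))
      obtain ⟨C, hC⟩ := isCompact_Icc.exists_bound_of_continuousOn hyct
      have hym : AEStronglyMeasurable y (volume.restrict (uIoc 0 t)) :=
        (this.mono uIoc_subset_uIcc).aestronglyMeasurable measurableSet_uIoc
      refine Integrable.mono' (h1.norm.mul_const C) (h1.1.inner hym) ?_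
      filter_upwards [ae_restrict_mem measurableSet_uIoc] with s hs
      refine (norm_inner_le_norm _ _).trans ?_
      refine mul_le_mul_of_nonneg_left (hC s ?_) (norm_nonneg _)
      rw [uIoc_of_le ht.1] at hs
      exact Ioc_subset_Icc_self hs
    · have hsT : s ∈ Icc 0 T := ⟨hs.1, hs.2.trans ht.2⟩
      rw [inner_add_left]
      have h1 := hdis s hsT
      have h2 := real_inner_le_norm (f s) (y s)
      have h3 := mul_le_mul_of_nonneg_left (hmax hsT) (norm_nonneg (f s))
      simp only at h3
      linarith
  rw [intervalIntegral.integral_mul_const] at hle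
  have hmono : ∫ s in (0 : ℝ)..t, ‖f s‖ ≤ ∫ s in (0 : ℝ)..T, ‖f s‖ := by
    rw [intervalIntegral.integral_of_le ht.1, intervalIntegral.integral_of_le hT]
    exact setIntegral_mono_set ((intervalIntegrable_iff_integrableOn_Ioc_of_le hT).1 hf).norm
      (Eventually.of_forall fun _ => norm_nonneg _) (Ioc_subset_Ioc_right ht.2).eventuallyLE
  rcases (norm_nonneg (y t)).eq_or_lt with h0 | h0
  · rw [← h0] at hi0 ⊢
    have : 0 ≤ ∫ s in (0 : ℝ)..T, ‖f s‖ :=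
      intervalIntegral.integral_nonneg hT fun _ _ => norm_nonneg _
    linarith [norm_nonneg y₀]
  · have h4 : ‖y₀‖ ^ 2 ≤ ‖y₀‖ * ‖y t‖ := by
      rw [sq]; exact mul_le_mul_of_nonneg_left hi0 (norm_nonneg _)
    have h5 := mul_le_mul_of_nonneg_right hmono h0.le
    have : ‖y t‖ * ‖y t‖ ≤ (‖y₀‖ + 2 * ∫ s in (0 : ℝ)..T, ‖f s‖) * ‖y t‖ := by
      nlinarith
    exact le_of_mul_le_mul_right this h0

theorem ode_unique {G : V → V} (hG : ContDiff ℝ 1 G) {f : ℝ → V} {T : ℝ}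
    (hf : IntervalIntegrable f volume 0 T) {y₀ : V} {y z : ℝ → V}
    (hyc : ContinuousOn y (Icc 0 T)) (hzc : ContinuousOn z (Icc 0 T))
    (hy : ∀ t ∈ Icc 0 T, y t = y₀ + ∫ s in (0 : ℝ)..t, (G (y s) + f s))
    (hz : ∀ t ∈ Icc 0 T, z t = y₀ + ∫ s in (0 : ℝ)..t, (G (z s) + f s)) :
    ∀ t ∈ Icc 0 T, y t = z t := by
  intro t ht
  obtain ⟨C₁, hC₁⟩ := isCompact_Icc.exists_bound_of_continuousOn hyc
  obtain ⟨C₂, hC₂⟩ := isCompact_Icc.exists_bound_of_continuousOn hzc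
  obtain ⟨K, hK⟩ := (hG.contDiffOn (s := Metric.closedBall 0 (max C₁ C₂))).exists_lipschitzOnWith
    one_ne_zero (convex_closedBall _ _) (isCompact_closedBall _ _)
  have hGy : ∀ s ∈ Icc 0 T, ‖G (y s) - G (z s)‖ ≤ K * ‖y s - z s‖ := fun s hs =>
    hK.norm_sub_le (by simpa using Or.inl (hC₁ s hs)) (by simpa using Or.inr (hC₂ s hs))
  have hd : ContinuousOn (fun s => ‖y s - z s‖) (Icc 0 t) :=
    (hyc.sub hzc).norm.mono (Icc_subset_Icc_right ht.2)
  have h := gronwall_integral (a := fun _ => (K : ℝ)) (K := 0) ht.1 (by simp) (fun _ => K.2) hd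
    (fun s hs => by
      have hsT : s ∈ Icc 0 T := ⟨hs.1, hs.2.trans ht.2⟩
      have hsub : uIcc 0 s ⊆ Icc 0 T := by
        rw [uIcc_of_le hs.1]; exact Icc_subset_Icc_right hsT.2
      have hfs : IntervalIntegrable f volume 0 s :=
        hf.mono_set (by rwa [uIcc_of_le (ht.1.trans ht.2)])
      have hGyi : IntervalIntegrable (fun r => G (y r)) volume 0 s :=
        (hG.continuous.comp_continuousOn (hyc.mono hsub)).intervalIntegrable
      have hGzi : IntervalIntegrable (fun r => G (z r)) volume 0 s :=
        (hG.continuous.comp_continuousOn (hzc.mono hsub)).intervalIntegrable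
      rw [hy s hsT, hz s hsT, add_sub_add_left_eq_sub, zero_add,
        ← intervalIntegral.integral_sub (hGyi.add hfs) (hGzi.add hfs)]
      simp only [add_sub_add_right_eq_sub]
      refine intervalIntegral.norm_integral_le_of_norm_le hs.1 ?_ ?_
      · filter_upwards with r hr
        exact hGy r ⟨hr.1.le, hr.2.trans hsT.2⟩
      · exact (((hyc.sub hzc).norm.mono hsub).intervalIntegrable).const_mul _)
  rw [zero_mul] at h
  exact sub_eq_zero.1 (norm_le_zero_iff.1 h)

/-- The vector field `G` is cut off outside a ball that the solution cannot leave, and the forcing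
is removed by subtracting its primitive; the Picard-Lindelöf theorem then gives a solution on the
whole interval. -/
theorem ode_exists {G : V → V} (hG : ContDiff ℝ 1 G) (hdis : ∀ y, inner ℝ (G y) y ≤ 0)
    {f : ℝ → V} {T : ℝ} (hT : 0 ≤ T) (hf : IntervalIntegrable f volume 0 T) (y₀ : V) :
    ∃ y : ℝ → V, ContinuousOn y (Icc 0 T) ∧
      ∀ t ∈ Icc 0 T, y t = y₀ + ∫ s in (0 : ℝ)..t, (G (y s) + f s) := by
  have hI : 0 ≤ ∫ s in (0 : ℝ)..T, ‖f s‖ :=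
    intervalIntegral.integral_nonneg hT fun _ _ => norm_nonneg _
  -- the bound of `norm_le_of_dissipative`, enlarged by one so that it is positive
  let R : ℝ := ‖y₀‖ + 2 * (∫ s in (0 : ℝ)..T, ‖f s‖) + 1
  have hR : 0 < R := by positivity
  let χ : ContDiffBump (0 : V) := ⟨R, R + 1, hR, by linarith⟩
  let Gc : V → V := fun y => χ y • G y
  have hGc : ContDiff ℝ 1 Gc := (χ.contDiff).smul hG
  have hsupp : HasCompactSupport Gc := χ.hasCompactSupport.smul_right
  obtain ⟨K, hK⟩ := ContDiff.lipschitzWith_of_hasCompactSupport hsupp hGc one_ne_zero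
  obtain ⟨M, hM⟩ := hsupp.exists_bound_of_continuous hGc.continuous
  have hM0 : 0 ≤ M := (norm_nonneg _).trans (hM 0)
  let F : ℝ → V := fun t => ∫ s in (0 : ℝ)..t, f s
  have hF : ContinuousOn F (Icc 0 T) := by
    have := intervalIntegral.continuousOn_primitive_interval' hf left_mem_uIcc
    rwa [uIcc_of_le hT] at this
  -- The difference of the solution and `F` solves an equation with a continuous right-hand side.
  have hPL : IsPicardLindelof (fun t z => Gc (z + F t)) (tmin := 0) (tmax := T)
      ⟨0, le_rfl, hT⟩ y₀ ⟨M * T, by positivity⟩ 0 ⟨M, hM0⟩ K :=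
    { lipschitzOnWith := fun t _ => by
        have h1 : LipschitzWith (K * 1) (fun z => Gc (z + F t)) :=
          hK.comp (LipschitzWith.of_dist_le_mul fun a b => by simp)
        rw [mul_one] at h1
        exact h1.lipschitzOnWith
      continuousOn := fun z _ => hGc.continuous.comp_continuousOn (continuousOn_const.add hF)
      norm_le := fun t _ z _ => hM _
      mul_max_le := by
        simp only [sub_zero, NNReal.coe_zero, sub_self]
        rw [max_eq_left hT]
        exact le_rfl }
  obtain ⟨α, hα0, hα⟩ := hPL.exists_eq_forall_mem_Icc_hasDerivWithinAt₀
  have hαc : ContinuousOn α (Icc 0 T) := fun t ht => (hα t ht).continuousWithinAt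
  have hyc : ContinuousOn (fun t => α t + F t) (Icc 0 T) := hαc.add hF
  have hGcc : ContinuousOn (fun s => Gc (α s + F s)) (Icc 0 T) :=
    hGc.continuous.comp_continuousOn hyc
  have hsub : ∀ t ∈ Icc 0 T, uIcc 0 t ⊆ Icc 0 T := fun t ht => by
    rw [uIcc_of_le ht.1]; exact Icc_subset_Icc_right ht.2
  have heq : ∀ t ∈ Icc 0 T, α t + F t = y₀ + ∫ s in (0 : ℝ)..t, (Gc (α s + F s) + f s) := by
    intro t ht
    have hi : IntervalIntegrable (fun s => Gc (α s + F s)) volume 0 t :=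
      (hGcc.mono (hsub t ht)).intervalIntegrable
    have hft : IntervalIntegrable f volume 0 t :=
      hf.mono_set (by rw [uIcc_of_le hT]; exact hsub t ht)
    have h1 : ∫ s in (0 : ℝ)..t, Gc (α s + F s) = α t - α 0 :=
      intervalIntegral.integral_eq_sub_of_hasDerivAt_of_le ht.1
        (hαc.mono (Icc_subset_Icc_right ht.2)) (fun s hs =>
          (hα s ⟨hs.1.le, hs.2.le.trans ht.2⟩).hasDerivAt
            (Icc_mem_nhds hs.1 (hs.2.trans_le ht.2))) hi
    rw [intervalIntegral.integral_add hi hft, h1, hα0]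
    simp only [F]
    abel
  have hbound := norm_le_of_dissipative (F := fun s => Gc (α s + F s))
    (hGcc.mono (hsub T ⟨hT, le_rfl⟩)).intervalIntegrable hf hyc (fun t _ => by
      simp only [Gc, inner_smul_left]
      exact mul_nonpos_of_nonneg_of_nonpos χ.nonneg (hdis _)) heq
  refine ⟨fun t => α t + F t, hyc, fun t ht => ?_⟩
  refine (heq t ht).trans (congrArg (y₀ + ·) ?_)
  refine intervalIntegral.integral_congr fun s hs => ?_
  have hs' := hbound s (hsub t ht hs)
  have : χ (α s + F s) = 1 := χ.one_of_mem_closedBall (by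
    rw [mem_closedBall_zero_iff]
    exact hs'.trans (by simp only [χ, R]; linarith))
  simp only [Gc, this, one_smul]

end ODE

/-! ### Weighted square sums of coefficients -/

theorem energy_add_le (lam : ℕ → ℝ) (hlam : ∀ j, 0 < lam j) (k : ℕ) (a b : ℕ → ℝ) :
    energy lam k (fun j => a j + b j) ≤ 2 * (energy lam k a + energy lam k b) := by
  unfold energy
  rw [← ENNReal.tsum_add, ← ENNReal.tsum_mul_left]
  refine ENNReal.tsum_le_tsum fun j => ?_
  have hp : 0 < lam j ^ k := pow_pos (hlam j) k
  rw [← ENNReal.ofReal_add (by positivity) (by positivity), ← ENNReal.ofReal_ofNat,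
    ← ENNReal.ofReal_mul (by norm_num)]
  apply ENNReal.ofReal_le_ofReal
  nlinarith [mul_nonneg hp.le (sq_nonneg (a j - b j))]

theorem energy_mono {lam : ℕ → ℝ} (hlam : ∀ j, 0 < lam j) (k : ℕ) {a b : ℕ → ℝ}
    (h : ∀ j, |a j| ≤ |b j|) : energy lam k a ≤ energy lam k b :=
  ENNReal.tsum_le_tsum fun j => ENNReal.ofReal_le_ofReal
    (mul_le_mul_of_nonneg_left (sq_le_sq.2 (h j)) (pow_pos (hlam j) k).le)

theorem energy_neg (lam : ℕ → ℝ) (k : ℕ) (a : ℕ → ℝ) :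
    energy lam k (fun j => -a j) = energy lam k a := by
  simp [energy]

theorem energy_zero (lam : ℕ → ℝ) (k : ℕ) : energy lam k (fun _ => 0) = 0 := by
  simp [energy]

theorem energy_le_mul_succ {lam : ℕ → ℝ} (hlam : ∀ j, 0 < lam j) (hmono : Monotone lam) (k : ℕ)
    (a : ℕ → ℝ) : energy lam k a ≤ ENNReal.ofReal (lam 0)⁻¹ * energy lam (k + 1) a := by
  unfold energy
  rw [← ENNReal.tsum_mul_left]
  refine ENNReal.tsum_le_tsum fun j => ?_
  rw [← ENNReal.ofReal_mul (inv_pos.2 (hlam 0)).le]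
  apply ENNReal.ofReal_le_ofReal
  have h1 : 1 ≤ (lam 0)⁻¹ * lam j := by
    rw [← div_eq_inv_mul, one_le_div (hlam 0)]
    exact hmono (Nat.zero_le j)
  have h2 : 0 ≤ lam j ^ k * a j ^ 2 := mul_nonneg (pow_pos (hlam j) k).le (sq_nonneg _)
  calc lam j ^ k * a j ^ 2 ≤ ((lam 0)⁻¹ * lam j) * (lam j ^ k * a j ^ 2) :=
        le_mul_of_one_le_left h2 h1
    _ = (lam 0)⁻¹ * (lam j ^ (k + 1) * a j ^ 2) := by ring

theorem exists_energy_le_mul {lam : ℕ → ℝ} (hlam : ∀ j, 0 < lam j) (hmono : Monotone lam)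
    {i k : ℕ} (hik : i ≤ k) : ∃ C : ℝ≥0∞, C ≠ ∞ ∧ ∀ a, energy lam i a ≤ C * energy lam k a := by
  induction k, hik using Nat.le_induction with
  | base => exact ⟨1, ENNReal.one_ne_top, fun a => by rw [one_mul]⟩
  | succ k _ ih =>
    obtain ⟨C, hC, h⟩ := ih
    refine ⟨C * ENNReal.ofReal (lam 0)⁻¹, ENNReal.mul_ne_top hC ENNReal.ofReal_ne_top, fun a => ?_⟩
    rw [mul_assoc]
    exact (h a).trans (mul_le_mul_right (energy_le_mul_succ hlam hmono k a) C)

theorem le_energy {lam : ℕ → ℝ} (k : ℕ) (a : ℕ → ℝ) (j : ℕ) :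
    ENNReal.ofReal (lam j ^ k * a j ^ 2) ≤ energy lam k a :=
  ENNReal.le_tsum j

/-- The first `n` terms of a sequence. -/
def headSeq (n : ℕ) (a : ℕ → ℝ) (j : ℕ) : ℝ := if j < n then a j else 0

/-- A sequence without its first `n` terms. -/
def tailSeq (n : ℕ) (a : ℕ → ℝ) (j : ℕ) : ℝ := if j < n then 0 else a j

theorem energy_headSeq_le {lam : ℕ → ℝ} (hlam : ∀ j, 0 < lam j) (n k : ℕ) (a : ℕ → ℝ) :
    energy lam k (headSeq n a) ≤ energy lam k a :=
  energy_mono hlam k fun j => by unfold headSeq; split_ifs <;> simp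

theorem energy_tailSeq_le {lam : ℕ → ℝ} (hlam : ∀ j, 0 < lam j) (n k : ℕ) (a : ℕ → ℝ) :
    energy lam k (tailSeq n a) ≤ energy lam k a :=
  energy_mono hlam k fun j => by unfold tailSeq; split_ifs <;> simp

theorem energy_eq_sum {lam : ℕ → ℝ} (hlam : ∀ j, 0 < lam j) (k n : ℕ) {a : ℕ → ℝ}
    (h : ∀ j, n ≤ j → a j = 0) :
    energy lam k a = ENNReal.ofReal (∑ j ∈ Finset.range n, lam j ^ k * a j ^ 2) := by
  rw [ENNReal.ofReal_sum_of_nonneg fun j _ => mul_nonneg (pow_pos (hlam j) k).le (sq_nonneg _)]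
  refine tsum_eq_sum fun j hj => ?_
  rw [Finset.mem_range, not_lt] at hj
  simp [h j hj]

theorem tendsto_energy_tailSeq {lam : ℕ → ℝ} (k : ℕ) {a : ℕ → ℝ} (ha : energy lam k a ≠ ∞) :
    Tendsto (fun n => energy lam k (tailSeq n a)) atTop (𝓝 0) := by
  have h := ENNReal.tendsto_sum_nat_add (fun j => ENNReal.ofReal (lam j ^ k * a j ^ 2)) ha
  have key : ∀ n, ∑' j, ENNReal.ofReal (lam (j + n) ^ k * a (j + n) ^ 2) =
      energy lam k (tailSeq n a) := by
    intro n
    have h2 : ∑ j ∈ Finset.range n, ENNReal.ofReal (lam j ^ k * tailSeq n a j ^ 2) +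
        ∑' j, ENNReal.ofReal (lam (j + n) ^ k * tailSeq n a (j + n) ^ 2) =
        energy lam k (tailSeq n a) :=
      ENNReal.summable.sum_add_tsum_nat_add' (f := fun j =>
        ENNReal.ofReal (lam j ^ k * tailSeq n a j ^ 2))
    have h3 : ∑ j ∈ Finset.range n, ENNReal.ofReal (lam j ^ k * tailSeq n a j ^ 2) = 0 :=
      Finset.sum_eq_zero fun j hj => by simp [tailSeq, Finset.mem_range.1 hj]
    have h4 : ∀ j, tailSeq n a (j + n) = a (j + n) := fun j => by simp [tailSeq]
    rw [h3, zero_add] at h2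
    simp only [h4] at h2
    exact h2
  simp only [key] at h
  exact h

theorem tendsto_lintegral_energy_tailSeq {lam : ℕ → ℝ} (hlam : ∀ j, 0 < lam j) (k : ℕ)
    {α : Type*} [MeasurableSpace α] {μ : Measure α} {c : α → ℕ → ℝ}
    (hc : ∀ j, AEMeasurable (fun s => c s j) μ) (hfin : ∫⁻ s, energy lam k (c s) ∂μ ≠ ∞) :
    Tendsto (fun n => ∫⁻ s, energy lam k (tailSeq n (c s)) ∂μ) atTop (𝓝 0) := by
  rw [← lintegral_zero (μ := μ)]
  refine tendsto_lintegral_of_dominated_convergence' (fun s => energy lam k (c s)) (fun n => ?_)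
    (fun n => Eventually.of_forall fun s => energy_tailSeq_le hlam n k _) hfin ?_
  · refine aemeasurable_energy k fun j => ?_
    unfold tailSeq
    split_ifs
    · exact aemeasurable_const
    · exact hc j
  · filter_upwards [ae_lt_top' (aemeasurable_energy k hc) hfin] with s hs
    exact tendsto_energy_tailSeq k hs.ne

/-! ### Galerkin approximation in an abstract frame -/

/-- The data of an abstract Navier-Stokes equation in an inner product space `E`: an orthonormal
system `e` of eigenvectors of the linear part, with eigenvalues `lam`, in the subspace `K` of
divergence-free fields, and the components `T k` of the quadratic term on the eigenvectors
`e k`, with the continuity estimates of that term in the scale of norms `energy lam k`. -/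
structure GalerkinFrame (E : Type*) [NormedAddCommGroup E] [InnerProductSpace ℝ E] where
  /-- the eigenvectors -/
  e : ℕ → E
  /-- the eigenvalues -/
  lam : ℕ → ℝ
  /-- the components of the bilinear term -/
  T : ℕ → E →L[ℝ] E →L[ℝ] ℝ
  /-- the subspace in which the estimates hold -/
  K : Submodule ℝ E
  orthonormal : Orthonormal ℝ e
  e_mem : ∀ j, e j ∈ K
  lam_pos : ∀ j, 0 < lam j
  lam_mono : Monotone lam
  est_one_two : ∃ C : ℝ≥0∞, C ≠ ∞ ∧ ∀ x ∈ K, ∀ y ∈ K, energy lam 0 (fun j => T j x y) ≤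
    C * (energy lam 1 (fun j => inner ℝ (e j) x) * energy lam 2 (fun j => inner ℝ (e j) y))
  est_two_one : ∃ C : ℝ≥0∞, C ≠ ∞ ∧ ∀ x ∈ K, ∀ y ∈ K, energy lam 0 (fun j => T j x y) ≤
    C * (energy lam 2 (fun j => inner ℝ (e j) x) * energy lam 1 (fun j => inner ℝ (e j) y))
  est : ∀ k, ∃ C : ℝ≥0∞, C ≠ ∞ ∧ ∀ x ∈ K, ∀ y ∈ K, energy lam (k + 1) (fun j => T j x y) ≤
    C * (energy lam (k + 2) (fun j => inner ℝ (e j) x) *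
      energy lam (k + 2) (fun j => inner ℝ (e j) y))
  skew : ∀ (n : ℕ) (c : Fin n → ℝ),
    ∑ k : Fin n, T k (∑ j, c j • e j) (∑ j, c j • e j) * c k = 0

namespace GalerkinFrame

variable {E : Type*} [NormedAddCommGroup E] [InnerProductSpace ℝ E] (D : GalerkinFrame E)

/-- The coefficients of `x` in the orthonormal system. -/
def coef (x : E) (j : ℕ) : ℝ := inner ℝ (D.e j) x

/-- The orthogonal projection onto the span of the first `n` eigenvectors. -/
def proj (n : ℕ) (x : E) : E := ∑ j ∈ Finset.range n, D.coef x j • D.e j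

/-- The square of the norm of `x` in `V^k`. -/
noncomputable def normSq (k : ℕ) (x : E) : ℝ≥0∞ := energy D.lam k (D.coef x)

/-- The squared norm, at level `k`, of the bilinear term. -/
noncomputable def bilinNormSq (k : ℕ) (x y : E) : ℝ≥0∞ := energy D.lam k (fun j => D.T j x y)

theorem coef_add (x y : E) (j : ℕ) : D.coef (x + y) j = D.coef x j + D.coef y j :=
  inner_add_right _ _ _

theorem coef_sub (x y : E) (j : ℕ) : D.coef (x - y) j = D.coef x j - D.coef y j :=
  inner_sub_right _ _ _

theorem coef_sum_fin {n : ℕ} (c : Fin n → ℝ) (j : ℕ) :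
    D.coef (∑ i, c i • D.e i) j = if h : j < n then c ⟨j, h⟩ else 0 := by
  unfold coef
  rw [inner_sum]
  simp only [inner_smul_right, orthonormal_iff_ite.1 D.orthonormal]
  split_ifs with h
  · rw [Finset.sum_eq_single ⟨j, h⟩]
    · simp
    · intro i _ hi
      have : j ≠ i := fun hji => hi (Fin.ext hji.symm)
      simp [this]
    · simp
  · refine Finset.sum_eq_zero fun i _ => ?_
    have : j ≠ i := fun hji => h (hji ▸ i.2)
    simp [this]

theorem coef_proj (n : ℕ) (x : E) : D.coef (D.proj n x) = headSeq n (D.coef x) := by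
  ext j
  rw [proj, ← Fin.sum_univ_eq_sum_range (fun j => D.coef x j • D.e j) n, D.coef_sum_fin]
  unfold headSeq
  split_ifs <;> rfl

theorem proj_mem (n : ℕ) (x : E) : D.proj n x ∈ D.K :=
  D.K.sum_mem fun j _ => D.K.smul_mem _ (D.e_mem j)

theorem proj_sum_fin {n : ℕ} (c : Fin n → ℝ) :
    D.proj n (∑ i, c i • D.e i) = ∑ i, c i • D.e i := by
  rw [proj, ← Fin.sum_univ_eq_sum_range (fun j => D.coef (∑ i, c i • D.e i) j • D.e j) n]
  exact Finset.sum_congr rfl fun i _ => by rw [D.coef_sum_fin, dif_pos i.2]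

theorem normSq_proj_le (k n : ℕ) (x : E) : D.normSq k (D.proj n x) ≤ D.normSq k x := by
  unfold normSq
  rw [coef_proj]
  exact energy_headSeq_le D.lam_pos n k _

theorem normSq_sub_proj (k n : ℕ) (x : E) :
    D.normSq k (D.proj n x - x) = energy D.lam k (tailSeq n (D.coef x)) := by
  unfold normSq
  rw [← energy_neg]
  congr 1
  ext j
  rw [coef_sub, coef_proj]
  unfold headSeq tailSeq
  split_ifs <;> simp

theorem normSq_add_le (k : ℕ) (x y : E) :
    D.normSq k (x + y) ≤ 2 * (D.normSq k x + D.normSq k y) := by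
  unfold normSq
  rw [funext (D.coef_add x y)]
  exact energy_add_le _ D.lam_pos _ _ _

theorem continuous_coef (j : ℕ) : Continuous fun x => D.coef x j :=
  (innerSL ℝ (D.e j)).continuous

theorem continuous_bilin (j : ℕ) : Continuous fun x : E => D.T j x x :=
  ((D.T j).continuous).clm_apply continuous_id

section Measurability

variable {α : Type*} [MeasurableSpace α] {μ : Measure α}

theorem aemeasurable_coef {u : α → E} (hu : AEStronglyMeasurable u μ) (j : ℕ) :
    AEMeasurable (fun s => D.coef (u s) j) μ :=
  ((D.continuous_coef j).comp_aestronglyMeasurable hu).aemeasurable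

theorem aemeasurable_bilin {u : α → E} (hu : AEStronglyMeasurable u μ) (j : ℕ) :
    AEMeasurable (fun s => D.T j (u s) (u s)) μ :=
  ((D.continuous_bilin j).comp_aestronglyMeasurable hu).aemeasurable

theorem aemeasurable_normSq {u : α → E} (hu : AEStronglyMeasurable u μ) (k : ℕ) :
    AEMeasurable (fun s => D.normSq k (u s)) μ :=
  aemeasurable_energy k (D.aemeasurable_coef hu)

end Measurability

/-- The Galerkin equation on the span of the first `n` eigenvectors. -/
structure IsGalerkin (n : ℕ) (ν T : ℝ) (u₀ : E) (f v : ℝ → E) : Prop where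
  mem_span : ∀ t ∈ Icc 0 T, ∃ c : Fin n → ℝ, v t = ∑ j, c j • D.e j
  continuousOn : ContinuousOn v (Icc 0 T)
  equation : ∀ k < n, ∀ t ∈ Icc 0 T, D.coef (v t) k = D.coef u₀ k +
    ∫ s in (0 : ℝ)..t, (D.coef (f s) k - ν * D.lam k * D.coef (v s) k - D.T k (v s) (v s))

/-- The Galerkin equation in coordinates is an ordinary differential equation whose vector field
is dissipative by the skew symmetry of the trilinear form, so `ode_exists` and `ode_unique`
apply. -/
theorem galerkin_exists_unique (n : ℕ) {ν T : ℝ} (hν : 0 ≤ ν) (hT : 0 ≤ T) (u₀ : E) {f : ℝ → E}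
    (hf : ∀ k, IntervalIntegrable (fun s => D.coef (f s) k) volume 0 T) :
    ∃ v, D.IsGalerkin n ν T u₀ f v ∧ ∀ v', D.IsGalerkin n ν T u₀ f v' →
      ∀ t ∈ Icc 0 T, v' t = v t := by
  let W := EuclideanSpace ℝ (Fin n)
  have hproj : ∀ (k : Fin n) (z : W), (EuclideanSpace.proj k : W →L[ℝ] ℝ) z = z k :=
    fun _ _ => rfl
  let ι : W →L[ℝ] E := ∑ j : Fin n, (EuclideanSpace.proj j).smulRight (D.e j)
  have hι : ∀ z : W, ι z = ∑ j, z j • D.e j := fun z => by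
    simp [ι, hproj]
  let G : W → W := fun z => WithLp.toLp 2 fun k =>
    -(ν * D.lam k * z k) - D.T k (ι z) (ι z)
  have hG : ContDiff ℝ 1 G := by
    rw [contDiff_euclidean]
    intro k
    have h1 : ContDiff ℝ 1 fun z : W => z k := (EuclideanSpace.proj (𝕜 := ℝ) k).contDiff
    have h2 : ContDiff ℝ 1 fun z : W => D.T k (ι z) (ι z) :=
      (((D.T k).contDiff).comp ι.contDiff).clm_apply ι.contDiff
    exact ((contDiff_const.mul h1).neg).sub h2
  have hdis : ∀ z, inner ℝ (G z) z ≤ 0 := by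
    intro z
    have h1 : inner ℝ (G z) z = -∑ k : Fin n, ν * D.lam k * z k ^ 2 -
        ∑ k : Fin n, D.T k (∑ j, z j • D.e j) (∑ j, z j • D.e j) * z k := by
      rw [PiLp.inner_apply, ← Finset.sum_neg_distrib, ← Finset.sum_sub_distrib]
      refine Finset.sum_congr rfl fun k _ => ?_
      simp only [G, hι, RCLike.inner_apply, conj_trivial]
      ring
    rw [h1, D.skew n z, sub_zero, neg_nonpos]
    exact Finset.sum_nonneg fun k _ =>
      mul_nonneg (mul_nonneg hν (D.lam_pos k).le) (sq_nonneg _)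
  let F : ℝ → W := fun s => WithLp.toLp 2 fun k => D.coef (f s) k
  have hF : IntervalIntegrable F volume 0 T := by
    rw [intervalIntegrable_iff]
    have h1 : IntegrableOn (fun s => (fun k : Fin n => D.coef (f s) k)) (uIoc 0 T) :=
      Integrable.of_eval fun k => intervalIntegrable_iff.1 (hf k)
    exact ((EuclideanSpace.equiv (Fin n) ℝ).symm : (Fin n → ℝ) →L[ℝ] W).integrable_comp h1
  let z₀ : W := WithLp.toLp 2 fun k => D.coef u₀ k
  have hsub : ∀ t ∈ Icc 0 T, uIcc 0 t ⊆ Icc 0 T := fun t ht => by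
    rw [uIcc_of_le ht.1]; exact Icc_subset_Icc_right ht.2
  -- the vector equation is equivalent to the equations of its components
  have hcomp : ∀ z : ℝ → W, ContinuousOn z (Icc 0 T) → ∀ t ∈ Icc 0 T,
      (z t = z₀ + ∫ s in (0 : ℝ)..t, (G (z s) + F s)) ↔ ∀ k : Fin n, z t k = D.coef u₀ k +
        ∫ s in (0 : ℝ)..t, (D.coef (f s) k - ν * D.lam k * z s k -
          D.T k (ι (z s)) (ι (z s))) := by
    intro z hz t ht
    have hi : IntervalIntegrable (fun s => G (z s) + F s) volume 0 t :=
      ((hG.continuous.comp_continuousOn (hz.mono (hsub t ht))).intervalIntegrable).add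
        (hF.mono_set (by rw [uIcc_of_le hT]; exact hsub t ht))
    have hk : ∀ k : Fin n, (z₀ + ∫ s in (0 : ℝ)..t, (G (z s) + F s)) k = D.coef u₀ k +
        ∫ s in (0 : ℝ)..t, (D.coef (f s) k - ν * D.lam k * z s k -
          D.T k (ι (z s)) (ι (z s))) := by
      intro k
      have h1 := (EuclideanSpace.proj (𝕜 := ℝ) k : W →L[ℝ] ℝ).intervalIntegral_comp_comm hi
      rw [PiLp.add_apply]
      simp only [hproj] at h1
      rw [← h1]
      congr 1
      refine intervalIntegral.integral_congr fun s _ => ?_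
      change -(ν * D.lam k * z s k) - D.T k (ι (z s)) (ι (z s)) + D.coef (f s) k = _
      ring
    constructor
    · intro h k
      rw [← hk k, ← h]
    · intro h
      ext k
      rw [hk k, h k]
  have hcoef : ∀ (z : W) (k : ℕ) (hk : k < n), D.coef (ι z) k = z ⟨k, hk⟩ := fun z k hk => by
    rw [hι, D.coef_sum_fin, dif_pos hk]
  obtain ⟨z, hzc, hz⟩ := ode_exists hG hdis hT hF z₀
  refine ⟨fun t => ι (z t), ⟨fun t _ => ⟨_, hι _⟩, ι.continuous.comp_continuousOn hzc, ?_⟩, ?_⟩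
  · intro k hk t ht
    simp only [hcoef _ k hk]
    exact (hcomp z hzc t ht).1 (hz t ht) ⟨k, hk⟩
  · intro v hv t ht
    let y : ℝ → W := fun s => WithLp.toLp 2 fun k : Fin n => D.coef (v s) k
    have hyc : ContinuousOn y (Icc 0 T) := by
      refine (PiLp.continuous_toLp 2 _).comp_continuousOn (continuousOn_pi.2 fun k => ?_)
      exact (D.continuous_coef k).comp_continuousOn hv.continuousOn
    have hyv : ∀ s ∈ Icc 0 T, ι (y s) = v s := by
      intro s hs
      obtain ⟨c, hc⟩ := hv.mem_span s hs
      rw [hι, hc]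
      refine Finset.sum_congr rfl fun j _ => ?_
      simp only [y, hc, D.coef_sum_fin, dif_pos j.2]
    have hy : ∀ s ∈ Icc 0 T, y s = z₀ + ∫ r in (0 : ℝ)..s, (G (y r) + F r) := by
      intro s hs
      rw [hcomp y hyc s hs]
      intro k
      have h1 := hv.equation k k.2 s hs
      simp only [y] at h1 ⊢
      rw [h1]
      congr 1
      refine intervalIntegral.integral_congr fun r hr => ?_
      change _ = D.coef (f r) k - ν * D.lam k * D.coef (v r) k - D.T k (ι (y r)) (ι (y r))
      rw [hyv r (hsub s hs hr)]
    rw [← hyv t ht, ode_unique hG hF hyc hzc hy hz t ht]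

end GalerkinFrame

/-! ### A solution and its Galerkin approximations -/

theorem intervalIntegrable_of_energy {lam : ℕ → ℝ} (hlam : ∀ j, 0 < lam j) {k : ℕ} {T : ℝ}
    (hT : 0 ≤ T) {g : ℝ → ℕ → ℝ}
    (hm : ∀ j, AEMeasurable (fun s => g s j) (volume.restrict (Ioc 0 T)))
    (h : ∫⁻ s in Ioc 0 T, energy lam k (g s) ≠ ∞) (j : ℕ) :
    IntervalIntegrable (fun s => g s j) volume 0 T := by
  rw [intervalIntegrable_iff_integrableOn_Ioc_of_le hT]
  have h2 : MemLp (fun s => g s j) 2 (volume.restrict (Ioc 0 T)) := by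
    rw [memLp_two_iff_integrable_sq (hm j).aestronglyMeasurable]
    refine ⟨((hm j).pow_const 2).aestronglyMeasurable, ?_⟩
    rw [hasFiniteIntegral_iff_ofReal (Eventually.of_forall fun s => sq_nonneg (g s j))]
    have hp : 0 < lam j ^ k := pow_pos (hlam j) k
    refine lt_of_le_of_lt (lintegral_mono fun s => ?_)
      (lt_top_iff_ne_top.2 (?_ : ∫⁻ s in Ioc 0 T, ENNReal.ofReal (lam j ^ k)⁻¹ *
        energy lam k (g s) ≠ ∞))
    · refine le_trans (le_of_eq ?_) (mul_le_mul_right (le_energy k (g s) j) _)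
      rw [← ENNReal.ofReal_mul (by positivity)]
      congr 1
      field_simp
    · rw [lintegral_const_mul' _ _ ENNReal.ofReal_ne_top]
      exact ENNReal.mul_ne_top ENNReal.ofReal_ne_top h
  exact h2.integrable (by norm_num)

namespace GalerkinFrame

variable {E : Type*} [NormedAddCommGroup E] [InnerProductSpace ℝ E] (D : GalerkinFrame E)

/-- A solution `u` of the full equation, in coordinates, together with its Galerkin
approximations. -/
structure Scheme (ν T : ℝ) (u₀ : E) (f u : ℝ → E) (un : ℕ → ℝ → E) : Prop where
  ν_pos : 0 < ν
  T_nonneg : 0 ≤ T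
  f_meas : AEStronglyMeasurable f (volume.restrict (Ioc 0 T))
  u_meas : AEStronglyMeasurable u (volume.restrict (Ioc 0 T))
  f_int : ∀ k, IntervalIntegrable (fun s => D.coef (f s) k) volume 0 T
  u_mem : ∀ t ∈ Icc 0 T, u t ∈ D.K
  u_cont : ∀ k, ContinuousOn (fun t => D.coef (u t) k) (Icc 0 T)
  u_eq : ∀ k, ∀ t ∈ Icc 0 T, D.coef (u t) k = D.coef u₀ k +
    ∫ s in (0 : ℝ)..t, (D.coef (f s) k - ν * D.lam k * D.coef (u s) k - D.T k (u s) (u s))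
  un_gal : ∀ n, D.IsGalerkin n ν T u₀ f (un n)

/-- Boundedness of `u`, and convergence of the approximations, in `L^∞(0, T; V^(k+1))` and
`L²(0, T; V^(k+2))`. -/
structure LevelConv (k : ℕ) (T : ℝ) (u : ℝ → E) (un : ℕ → ℝ → E) : Prop where
  bound : ∃ M, M ≠ ∞ ∧ ∀ t ∈ Icc 0 T, D.normSq (k + 1) (u t) ≤ M
  integral : ∫⁻ s in Ioc 0 T, D.normSq (k + 2) (u s) ≠ ∞
  tendsto_sup : Tendsto (fun n => ⨆ t ∈ Icc 0 T, D.normSq (k + 1) (un n t - u t)) atTop (𝓝 0)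
  tendsto_integral : Tendsto (fun n => ∫⁻ s in Ioc 0 T, D.normSq (k + 2) (un n s - u s))
    atTop (𝓝 0)

variable {D} {ν T : ℝ} {u₀ : E} {f u : ℝ → E} {un : ℕ → ℝ → E}

namespace IsGalerkin

variable {n : ℕ} {v : ℝ → E}

theorem mem_K (h : D.IsGalerkin n ν T u₀ f v) {t : ℝ} (ht : t ∈ Icc 0 T) : v t ∈ D.K := by
  obtain ⟨c, hc⟩ := h.mem_span t ht
  rw [hc]
  exact D.K.sum_mem fun j _ => D.K.smul_mem _ (D.e_mem j)

theorem proj_eq (h : D.IsGalerkin n ν T u₀ f v) {t : ℝ} (ht : t ∈ Icc 0 T) :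
    D.proj n (v t) = v t := by
  obtain ⟨c, hc⟩ := h.mem_span t ht
  rw [hc, D.proj_sum_fin]

theorem coef_eq_zero (h : D.IsGalerkin n ν T u₀ f v) {t : ℝ} (ht : t ∈ Icc 0 T) {j : ℕ}
    (hj : n ≤ j) : D.coef (v t) j = 0 := by
  rw [← h.proj_eq ht, D.coef_proj, headSeq, if_neg (not_lt.2 hj)]

theorem meas (h : D.IsGalerkin n ν T u₀ f v) :
    AEStronglyMeasurable v (volume.restrict (Ioc 0 T)) :=
  (h.continuousOn.mono Ioc_subset_Icc_self).aestronglyMeasurable measurableSet_Ioc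

theorem continuousOn_coef (h : D.IsGalerkin n ν T u₀ f v) (j : ℕ) :
    ContinuousOn (fun t => D.coef (v t) j) (Icc 0 T) :=
  (D.continuous_coef j).comp_continuousOn h.continuousOn

theorem continuousOn_bilin (h : D.IsGalerkin n ν T u₀ f v) (j : ℕ) :
    ContinuousOn (fun t => D.T j (v t) (v t)) (Icc 0 T) :=
  (D.continuous_bilin j).comp_continuousOn h.continuousOn

end IsGalerkin

theorem uIcc_subset_Icc {t : ℝ} (ht : t ∈ Icc 0 T) : uIcc 0 t ⊆ Icc 0 T := by
  rw [uIcc_of_le ht.1]; exact Icc_subset_Icc_right ht.2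

theorem intervalIntegrable_restrict {g : ℝ → ℝ} (hg : IntervalIntegrable g volume 0 T) {t : ℝ}
    (ht : t ∈ Icc 0 T) : IntervalIntegrable g volume 0 t :=
  hg.mono_set (by rw [uIcc_of_le (ht.1.trans ht.2)]; exact uIcc_subset_Icc ht)

theorem intervalIntegrable_of_continuousOn_Icc {g : ℝ → ℝ} (hg : ContinuousOn g (Icc 0 T)) {t : ℝ}
    (ht : t ∈ Icc 0 T) : IntervalIntegrable g volume 0 t :=
  (hg.mono (uIcc_subset_Icc ht)).intervalIntegrable

/-- The energy inequality for `u`. -/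
theorem Scheme.energy_u (h : D.Scheme ν T u₀ f u un) (k : ℕ)
    (hTu : ∫⁻ s in Ioc 0 T, D.bilinNormSq k (u s) (u s) ≠ ∞) {t : ℝ} (ht : t ∈ Icc 0 T) :
    D.normSq (k + 1) (u t) + ENNReal.ofReal ν * ∫⁻ s in Ioc 0 t, D.normSq (k + 2) (u s) ≤
      D.normSq (k + 1) u₀ + ENNReal.ofReal ν⁻¹ * ∫⁻ s in Ioc 0 t,
        energy D.lam k (fun j => D.coef (f s) j - D.T j (u s) (u s)) := by
  have hTi := intervalIntegrable_of_energy D.lam_pos h.T_nonneg (D.aemeasurable_bilin h.u_meas) hTu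
  refine energy_inequality D.lam_pos h.ν_pos ht.1 (c := fun s => D.coef (u s))
    (g := fun s j => D.coef (f s) j - D.T j (u s) (u s)) (c₀ := D.coef u₀)
    (fun j => intervalIntegrable_restrict ((h.f_int j).sub (hTi j)) ht)
    (fun j => (h.u_cont j).mono (Icc_subset_Icc_right ht.2)) (fun j s hs => ?_) k
  rw [h.u_eq j s ⟨hs.1, hs.2.trans ht.2⟩]
  congr 1
  exact intervalIntegral.integral_congr fun r _ => by ring

/-- The energy inequality for a Galerkin approximation. -/
theorem Scheme.energy_un (h : D.Scheme ν T u₀ f u un) (k n : ℕ) {t : ℝ} (ht : t ∈ Icc 0 T) :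
    D.normSq (k + 1) (un n t) + ENNReal.ofReal ν * ∫⁻ s in Ioc 0 t, D.normSq (k + 2) (un n s) ≤
      D.normSq (k + 1) u₀ + ENNReal.ofReal ν⁻¹ * ∫⁻ s in Ioc 0 t,
        energy D.lam k (fun j => D.coef (f s) j - D.T j (un n s) (un n s)) := by
  have hg := h.un_gal n
  have key := energy_inequality D.lam_pos h.ν_pos ht.1 (c := fun s => D.coef (un n s))
    (g := fun s => headSeq n (fun j => D.coef (f s) j - D.T j (un n s) (un n s)))
    (c₀ := headSeq n (D.coef u₀))
    (fun j => by
      unfold headSeq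
      split_ifs
      · exact (intervalIntegrable_restrict (h.f_int j) ht).sub
          (intervalIntegrable_of_continuousOn_Icc (hg.continuousOn_bilin j) ht)
      · exact intervalIntegrable_const)
    (fun j => (hg.continuousOn_coef j).mono (Icc_subset_Icc_right ht.2)) (fun j s hs => by
      have hsT : s ∈ Icc 0 T := ⟨hs.1, hs.2.trans ht.2⟩
      unfold headSeq
      split_ifs with hj
      · rw [hg.equation j hj s hsT]
        congr 1
        exact intervalIntegral.integral_congr fun r _ => by ring
      · rw [hg.coef_eq_zero hsT (not_lt.1 hj)]
        symm
        rw [zero_add]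
        refine intervalIntegral.integral_zero_ae (Eventually.of_forall fun r hr => ?_)
        rw [hg.coef_eq_zero (uIcc_subset_Icc hsT (uIoc_subset_uIcc hr)) (not_lt.1 hj)]
        ring) k
  refine key.trans (add_le_add (energy_headSeq_le D.lam_pos _ _ _) (mul_le_mul_right ?_ _))
  exact lintegral_mono fun s => energy_headSeq_le D.lam_pos _ _ _

/-- The modes of the difference `u_n - u`: below `n` they are driven by the difference of the
quadratic terms, above `n` they are the modes of `-u`. -/
theorem Scheme.energy_diff (h : D.Scheme ν T u₀ f u un) (k n : ℕ)
    (hTu : ∫⁻ s in Ioc 0 T, D.bilinNormSq k (u s) (u s) ≠ ∞) {t : ℝ} (ht : t ∈ Icc 0 T) :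
    D.normSq (k + 1) (un n t - u t) +
        ENNReal.ofReal ν * ∫⁻ s in Ioc 0 t, D.normSq (k + 2) (un n s - u s) ≤
      energy D.lam (k + 1) (tailSeq n (D.coef u₀)) + ENNReal.ofReal ν⁻¹ * ∫⁻ s in Ioc 0 T,
        (energy D.lam k (headSeq n fun j => D.T j (un n s) (un n s) - D.T j (u s) (u s)) +
          energy D.lam k (tailSeq n fun j => D.coef (f s) j - D.T j (u s) (u s))) := by
  have hg := h.un_gal n
  have hTi := intervalIntegrable_of_energy D.lam_pos h.T_nonneg (D.aemeasurable_bilin h.u_meas) hTu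
  have hTn : ∀ j, IntervalIntegrable (fun s => D.T j (un n s) (un n s)) volume 0 t := fun j =>
    intervalIntegrable_of_continuousOn_Icc (hg.continuousOn_bilin j) ht
  have key := energy_inequality D.lam_pos h.ν_pos ht.1 (c := fun s => D.coef (un n s - u s))
    (g := fun s j => -(headSeq n (fun j => D.T j (un n s) (un n s) - D.T j (u s) (u s)) j +
      tailSeq n (fun j => D.coef (f s) j - D.T j (u s) (u s)) j))
    (c₀ := fun j => -tailSeq n (D.coef u₀) j)
    (fun j => by
      refine IntervalIntegrable.neg ?_
      unfold headSeq tailSeq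
      split_ifs
      · simp only [add_zero]
        exact (hTn j).sub (intervalIntegrable_restrict (hTi j) ht)
      · simp only [zero_add]
        exact intervalIntegrable_restrict ((h.f_int j).sub (hTi j)) ht)
    (fun j => by
      simp only [D.coef_sub]
      exact ((hg.continuousOn_coef j).sub (h.u_cont j)).mono (Icc_subset_Icc_right ht.2))
    (fun j s hs => by
      have hsT : s ∈ Icc 0 T := ⟨hs.1, hs.2.trans ht.2⟩
      have iF := intervalIntegrable_restrict (h.f_int j) hsT
      have iU := (intervalIntegrable_of_continuousOn_Icc (h.u_cont j) hsT).const_mul (ν * D.lam j)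
      have iT := intervalIntegrable_restrict (hTi j) hsT
      have iN := (intervalIntegrable_of_continuousOn_Icc (hg.continuousOn_coef j) hsT).const_mul
        (ν * D.lam j)
      have iTN := intervalIntegrable_of_continuousOn_Icc (hg.continuousOn_bilin j) hsT
      unfold headSeq tailSeq
      rw [D.coef_sub, h.u_eq j s hsT]
      split_ifs with hj
      · rw [hg.equation j hj s hsT, add_sub_add_left_eq_sub,
          ← intervalIntegral.integral_sub ((iF.sub iN).sub iTN) ((iF.sub iU).sub iT), neg_zero,
          zero_add]
        refine intervalIntegral.integral_congr fun r _ => ?_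
        simp only [D.coef_sub]
        ring
      · rw [hg.coef_eq_zero hsT (not_lt.1 hj), zero_sub, neg_add,
          ← intervalIntegral.integral_neg]
        congr 1
        refine intervalIntegral.integral_congr fun r hr => ?_
        simp only [D.coef_sub, hg.coef_eq_zero (uIcc_subset_Icc hsT hr) (not_lt.1 hj)]
        ring) k
  rw [energy_neg] at key
  refine key.trans (add_le_add le_rfl (mul_le_mul_right ?_ _))
  refine (lintegral_mono_set (Ioc_subset_Ioc_right ht.2)).trans (lintegral_mono fun s => ?_)
  simp only [energy_neg]
  unfold energy
  rw [← ENNReal.tsum_add]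
  refine ENNReal.tsum_le_tsum fun j => ?_
  unfold headSeq tailSeq
  split_ifs with hj <;> simp [hj]

/-- If the low modes of the difference of the quadratic terms tend to zero in
`L²(0, T; V^k)`, then the approximations converge at the level above. -/
theorem Scheme.levelConv_of_tendsto (h : D.Scheme ν T u₀ f u un) (k : ℕ)
    (hf : ∫⁻ s in Ioc 0 T, D.normSq k (f s) ≠ ∞) (hu₀ : D.normSq (k + 1) u₀ ≠ ∞)
    (hTu : ∫⁻ s in Ioc 0 T, D.bilinNormSq k (u s) (u s) ≠ ∞)
    (hd : Tendsto (fun n => ∫⁻ s in Ioc 0 T, energy D.lam k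
      (headSeq n fun j => D.T j (un n s) (un n s) - D.T j (u s) (u s))) atTop (𝓝 0)) :
    D.LevelConv k T u un := by
  have hν : ENNReal.ofReal ν ≠ 0 := by simpa using h.ν_pos
  have hgm : ∀ j, AEMeasurable (fun s => D.coef (f s) j - D.T j (u s) (u s))
      (volume.restrict (Ioc 0 T)) := fun j =>
    (D.aemeasurable_coef h.f_meas j).sub (D.aemeasurable_bilin h.u_meas j)
  have hg : ∫⁻ s in Ioc 0 T, energy D.lam k
      (fun j => D.coef (f s) j - D.T j (u s) (u s)) ≠ ∞ := by
    refine ne_top_of_le_ne_top (?_ : ∫⁻ s in Ioc 0 T, 2 * (D.normSq k (f s) +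
      D.bilinNormSq k (u s) (u s)) ≠ ∞) (lintegral_mono fun s => ?_)
    · rw [lintegral_const_mul' _ _ (by norm_num),
        lintegral_add_left' (D.aemeasurable_normSq h.f_meas k)]
      exact ENNReal.mul_ne_top (by norm_num) (ENNReal.add_ne_top.2 ⟨hf, hTu⟩)
    · have := energy_add_le D.lam D.lam_pos k (D.coef (f s)) (fun j => -D.T j (u s) (u s))
      rw [energy_neg] at this
      simp only [← sub_eq_add_neg] at this
      exact this
  set M : ℝ≥0∞ := D.normSq (k + 1) u₀ + ENNReal.ofReal ν⁻¹ * ∫⁻ s in Ioc 0 T,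
    energy D.lam k (fun j => D.coef (f s) j - D.T j (u s) (u s)) with hM
  have hMtop : M ≠ ∞ := ENNReal.add_ne_top.2 ⟨hu₀, ENNReal.mul_ne_top ENNReal.ofReal_ne_top hg⟩
  have hEu : ∀ t ∈ Icc 0 T, D.normSq (k + 1) (u t) +
      ENNReal.ofReal ν * ∫⁻ s in Ioc 0 t, D.normSq (k + 2) (u s) ≤ M := fun t ht =>
    (h.energy_u k hTu ht).trans (add_le_add le_rfl
      (mul_le_mul_right (lintegral_mono_set (Ioc_subset_Ioc_right ht.2)) _))
  have hTT : T ∈ Icc 0 T := ⟨h.T_nonneg, le_rfl⟩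
  let R : ℕ → ℝ≥0∞ := fun n => energy D.lam (k + 1) (tailSeq n (D.coef u₀)) +
    ENNReal.ofReal ν⁻¹ * ∫⁻ s in Ioc 0 T,
      (energy D.lam k (headSeq n fun j => D.T j (un n s) (un n s) - D.T j (u s) (u s)) +
        energy D.lam k (tailSeq n fun j => D.coef (f s) j - D.T j (u s) (u s)))
  have hR : Tendsto R atTop (𝓝 0) := by
    have h1 := tendsto_energy_tailSeq (lam := D.lam) (k + 1) hu₀
    have h2 := tendsto_lintegral_energy_tailSeq D.lam_pos k hgm hg
    have h3 := ENNReal.Tendsto.const_mul (a := ENNReal.ofReal ν⁻¹) (hd.add h2)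
      (Or.inr ENNReal.ofReal_ne_top)
    have h4 := h1.add h3
    simp only [add_zero, mul_zero] at h4
    refine h4.congr fun n => ?_
    simp only [R]
    congr 2
    refine (lintegral_add_right' _ (aemeasurable_energy k fun j => ?_)).symm
    unfold tailSeq
    split_ifs
    · exact aemeasurable_const
    · exact hgm j
  have hEd : ∀ n, ∀ t ∈ Icc 0 T, D.normSq (k + 1) (un n t - u t) +
      ENNReal.ofReal ν * ∫⁻ s in Ioc 0 t, D.normSq (k + 2) (un n s - u s) ≤ R n :=
    fun n t ht => h.energy_diff k n hTu ht
  refine ⟨⟨M, hMtop, fun t ht => le_self_add.trans (hEu t ht)⟩, fun htop => ?_, ?_, ?_⟩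
  · have h1 := le_add_self.trans (hEu T hTT)
    rw [htop, ENNReal.mul_top hν] at h1
    exact hMtop (top_le_iff.1 h1)
  · exact tendsto_of_tendsto_of_tendsto_of_le_of_le tendsto_const_nhds hR (fun _ => zero_le)
      fun n => iSup₂_le fun t ht => le_self_add.trans (hEd n t ht)
  · have h1 := ENNReal.Tendsto.const_mul (a := (ENNReal.ofReal ν)⁻¹) hR
      (Or.inr (ENNReal.inv_ne_top.2 hν))
    rw [mul_zero] at h1
    refine tendsto_of_tendsto_of_tendsto_of_le_of_le tendsto_const_nhds h1 (fun _ => zero_le)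
      fun n => ?_
    have h2 := mul_le_mul_right (le_add_self.trans (hEd n T hTT)) (ENNReal.ofReal ν)⁻¹
    rwa [← mul_assoc, ENNReal.inv_mul_cancel hν ENNReal.ofReal_ne_top, one_mul] at h2

end GalerkinFrame

/-! ### Convergence at the higher levels -/

namespace GalerkinFrame

variable {E : Type*} [NormedAddCommGroup E] [InnerProductSpace ℝ E] {D : GalerkinFrame E}
variable {ν T : ℝ} {u₀ : E} {f u : ℝ → E} {un : ℕ → ℝ → E}

theorem tendsto_coef_of_normSq {k : ℕ} {x : ℕ → E} {y : E}
    (h : Tendsto (fun n => D.normSq k (x n - y)) atTop (𝓝 0)) (j : ℕ) :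
    Tendsto (fun n => D.coef (x n) j) atTop (𝓝 (D.coef y j)) := by
  have hp : 0 < D.lam j ^ k := pow_pos (D.lam_pos j) k
  have h1 : Tendsto (fun n => ENNReal.ofReal (D.lam j ^ k * D.coef (x n - y) j ^ 2)) atTop (𝓝 0) :=
    tendsto_of_tendsto_of_tendsto_of_le_of_le tendsto_const_nhds h (fun _ => zero_le)
      fun n => le_energy k _ j
  have h2 := (ENNReal.tendsto_toReal ENNReal.zero_ne_top).comp h1
  have h3 := (h2.const_mul (D.lam j ^ k)⁻¹).sqrt
  simp only [ENNReal.toReal_zero, mul_zero, Real.sqrt_zero, Function.comp_def] at h3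
  have h4 : Tendsto (fun n => |D.coef (x n - y) j|) atTop (𝓝 0) := by
    refine h3.congr fun n => ?_
    rw [ENNReal.toReal_ofReal (by positivity), ← mul_assoc, inv_mul_cancel₀ hp.ne', one_mul,
      Real.sqrt_sq_eq_abs]
  have h5 := (tendsto_zero_iff_abs_tendsto_zero _).2 h4
  simp only [D.coef_sub] at h5
  exact tendsto_sub_nhds_zero_iff.1 h5

/-- The squared norms are lower semicontinuous under convergence of the coefficients. -/
theorem energy_le_of_tendsto {lam : ℕ → ℝ} {k : ℕ} {a : ℕ → ℕ → ℝ}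
    {b : ℕ → ℝ} (h : ∀ j, Tendsto (fun n => a n j) atTop (𝓝 (b j))) {B : ℝ≥0∞}
    (hB : ∀ᶠ n in atTop, energy lam k (a n) ≤ B) : energy lam k b ≤ B := by
  refine ENNReal.tsum_le_of_sum_range_le fun N => ?_
  refine le_of_tendsto (tendsto_finsetSum (Finset.range N) fun j _ =>
    ENNReal.tendsto_ofReal (((h j).pow 2).const_mul (lam j ^ k))) ?_
  filter_upwards [hB] with n hn
  exact (ENNReal.sum_le_tsum _).trans hn

theorem bilinNormSq_add_le (k : ℕ) (a b : ℕ → ℝ) {A B : ℝ≥0∞} (ha : energy D.lam k a ≤ A)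
    (hb : energy D.lam k b ≤ B) : energy D.lam k (fun j => a j + b j) ≤ 2 * (A + B) :=
  (energy_add_le _ D.lam_pos _ _ _).trans (mul_le_mul_right (add_le_add ha hb) _)

theorem normSq_un_eq {n : ℕ} {v : ℝ → E} (h : D.IsGalerkin n ν T u₀ f v) (k : ℕ) {t : ℝ}
    (ht : t ∈ Icc 0 T) : D.normSq k (v t) =
      ENNReal.ofReal (∑ j ∈ Finset.range n, D.lam j ^ k * D.coef (v t) j ^ 2) :=
  energy_eq_sum D.lam_pos k n fun _ hj => h.coef_eq_zero ht hj

/-- One level up: the estimate `‖B(v, v)‖_{k+1} ≤ C ‖v‖_{k+2}²` and Grönwall's inequality, with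
the coefficient `‖u_n‖²_{k+2}` which is integrable by the level below, bound the approximations
uniformly; then the quadratic term converges. -/
theorem Scheme.levelConv_succ (h : D.Scheme ν T u₀ f u un) (k : ℕ) (hk : D.LevelConv k T u un)
    (hf : ∫⁻ s in Ioc 0 T, D.normSq (k + 1) (f s) ≠ ∞) (hu₀ : D.normSq (k + 2) u₀ ≠ ∞) :
    D.LevelConv (k + 1) T u un := by
  obtain ⟨C, hC, hest⟩ := D.est k
  have hest' : ∀ x ∈ D.K, ∀ y ∈ D.K, D.bilinNormSq (k + 1) x y ≤
      C * (D.normSq (k + 2) x * D.normSq (k + 2) y) := hest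
  set A₀ : ℝ≥0∞ := ∫⁻ s in Ioc 0 T, D.normSq (k + 2) (u s) with hA₀
  have hA₀top : A₀ ≠ ∞ := hk.integral
  set c : ℝ≥0∞ := ENNReal.ofReal ν⁻¹ * 2 with hc
  have hctop : c ≠ ∞ := ENNReal.mul_ne_top ENNReal.ofReal_ne_top (by norm_num)
  set K : ℝ≥0∞ := D.normSq (k + 2) u₀ + c * ∫⁻ s in Ioc 0 T, D.normSq (k + 1) (f s) with hK
  have hKtop : K ≠ ∞ := ENNReal.add_ne_top.2 ⟨hu₀, ENNReal.mul_ne_top hctop hf⟩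
  set A₁ : ℝ≥0∞ := c * C * (2 * (1 + A₀)) with hA₁
  have hA₁top : A₁ ≠ ∞ := by finiteness
  set B : ℝ≥0∞ := ENNReal.ofReal (K.toReal * Real.exp A₁.toReal) with hB
  -- Grönwall's inequality bounds the approximations in the norm of order `k + 2`. The integral of
  -- its coefficient is at most `A₁`, since `u_n → u` in `L²(0, T; V^(k+2))`.
  have hun : ∀ᶠ n in atTop, ∀ t ∈ Icc 0 T, D.normSq (k + 2) (un n t) ≤ B := by
    filter_upwards [hk.tendsto_integral.eventually_le_const zero_lt_one] with n hn
    have hg := h.un_gal n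
    have hint : ∫⁻ s in Ioc 0 T, D.normSq (k + 2) (un n s) ≤ 2 * (1 + A₀) := by
      calc ∫⁻ s in Ioc 0 T, D.normSq (k + 2) (un n s)
          ≤ ∫⁻ s in Ioc 0 T, 2 * (D.normSq (k + 2) (un n s - u s) + D.normSq (k + 2) (u s)) :=
            lintegral_mono fun s => by
              have := D.normSq_add_le (k + 2) (un n s - u s) (u s)
              rwa [sub_add_cancel] at this
        _ = 2 * ((∫⁻ s in Ioc 0 T, D.normSq (k + 2) (un n s - u s)) + A₀) := by
            rw [lintegral_const_mul' _ _ (by norm_num),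
              lintegral_add_right' _ (D.aemeasurable_normSq h.u_meas _)]
        _ ≤ 2 * (1 + A₀) := by gcongr
    let y : ℝ → ℝ := fun t => ∑ j ∈ Finset.range n, D.lam j ^ (k + 2) * D.coef (un n t) j ^ 2
    have hyc : ContinuousOn y (Icc 0 T) := continuousOn_finsetSum _ fun j _ =>
      ((hg.continuousOn_coef j).pow 2).const_mul _
    have hy0 : ∀ t, 0 ≤ y t := fun t => Finset.sum_nonneg fun j _ =>
      mul_nonneg (pow_pos (D.lam_pos j) _).le (sq_nonneg _)
    have hyN : ∀ t ∈ Icc 0 T, D.normSq (k + 2) (un n t) = ENNReal.ofReal (y t) :=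
      fun t ht => normSq_un_eq hg _ ht
    let a : ℝ → ℝ≥0∞ := fun s => c * C * D.normSq (k + 2) (un n s)
    have ham : AEMeasurable a (volume.restrict (Ioc 0 T)) :=
      (D.aemeasurable_normSq hg.meas _).const_mul _
    have haint : ∫⁻ s in Ioc 0 T, a s ≤ A₁ := by
      simp only [a]
      rw [lintegral_const_mul' _ _ (ENNReal.mul_ne_top hctop hC)]
      exact mul_le_mul_right hint _
    intro t ht
    have hgr := gronwall_lintegral ham (ne_top_of_le_ne_top hA₁top haint)
      (K := K.toReal) ENNReal.toReal_nonneg hyc (fun t _ => hy0 t) ht (fun s hs => by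
        have hsT : s ∈ Icc 0 T := ⟨hs.1, hs.2.trans ht.2⟩
        have hsub : Ioc 0 s ⊆ Ioc 0 T := Ioc_subset_Ioc_right hsT.2
        rw [ENNReal.ofReal_toReal hKtop, ← hyN s hsT]
        refine (le_self_add.trans (h.energy_un (k + 1) n hsT)).trans ?_
        have h1 : ∫⁻ r in Ioc 0 s, energy D.lam (k + 1)
            (fun j => D.coef (f r) j - D.T j (un n r) (un n r)) ≤
            ∫⁻ r in Ioc 0 s, 2 * (D.normSq (k + 1) (f r) +
              C * (D.normSq (k + 2) (un n r) * ENNReal.ofReal (y r))) := by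
          refine setLIntegral_mono' measurableSet_Ioc fun r hr => ?_
          have hrT : r ∈ Icc 0 T := Ioc_subset_Icc_self (hsub hr)
          have h2 : energy D.lam (k + 1) (fun j => -D.T j (un n r) (un n r)) ≤
              C * (D.normSq (k + 2) (un n r) * ENNReal.ofReal (y r)) := by
            rw [energy_neg, ← hyN r hrT]
            exact hest' _ (hg.mem_K hrT) _ (hg.mem_K hrT)
          have h3 := bilinNormSq_add_le (D := D) (k + 1) (D.coef (f r)) _ (le_refl _) h2
          simp only [← sub_eq_add_neg] at h3
          exact h3
        refine (add_le_add le_rfl (mul_le_mul_right h1 _)).trans ?_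
        rw [lintegral_const_mul' _ _ (by norm_num), lintegral_add_left'
          ((D.aemeasurable_normSq h.f_meas _).mono_measure (Measure.restrict_mono_set _ hsub)),
          lintegral_const_mul' _ _ hC, ← mul_assoc, mul_add, ← add_assoc]
        refine add_le_add (add_le_add le_rfl (mul_le_mul_right (lintegral_mono_set hsub) _))
          (le_of_eq ?_)
        simp only [a, mul_assoc (c * C)]
        rw [lintegral_const_mul' _ _ (ENNReal.mul_ne_top hctop hC), mul_assoc c])
    rw [hyN t ht]
    refine ENNReal.ofReal_le_ofReal (hgr.trans (mul_le_mul_of_nonneg_left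
      (Real.exp_le_exp.2 (ENNReal.toReal_mono hA₁top haint)) ENNReal.toReal_nonneg))
  have hconv : ∀ t ∈ Icc 0 T, ∀ j, Tendsto (fun n => D.coef (un n t) j) atTop
      (𝓝 (D.coef (u t) j)) := fun t ht => tendsto_coef_of_normSq
    (tendsto_of_tendsto_of_tendsto_of_le_of_le tendsto_const_nhds hk.tendsto_sup
      (fun _ => zero_le) fun n =>
        le_iSup₂ (f := fun t (_ : t ∈ Icc 0 T) => D.normSq (k + 1) (un n t - u t)) t ht)
  -- The same bound holds for `u`, as a limit of the approximations.
  have hu : ∀ t ∈ Icc 0 T, D.normSq (k + 2) (u t) ≤ B := fun t ht =>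
    energy_le_of_tendsto (hconv t ht) (hun.mono fun n hn => hn t ht)
  have hBtop : B ≠ ∞ := ENNReal.ofReal_ne_top
  refine h.levelConv_of_tendsto (k + 1) hf hu₀ ?_ ?_
  · refine ne_top_of_le_ne_top (?_ : ∫⁻ s in Ioc 0 T, C * B * D.normSq (k + 2) (u s) ≠ ∞)
      (setLIntegral_mono' measurableSet_Ioc fun s hs => ?_)
    · rw [lintegral_const_mul' _ _ (ENNReal.mul_ne_top hC hBtop)]
      exact ENNReal.mul_ne_top (ENNReal.mul_ne_top hC hBtop) hA₀top
    · have hsT := Ioc_subset_Icc_self hs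
      rw [mul_assoc]
      exact (hest' _ (h.u_mem s hsT) _ (h.u_mem s hsT)).trans
        (mul_le_mul_right (mul_le_mul_left (hu s hsT) _) _)
  · have hlim := ENNReal.Tendsto.const_mul (a := 4 * C * B) hk.tendsto_integral
      (Or.inr (by finiteness))
    rw [mul_zero] at hlim
    refine tendsto_of_tendsto_of_tendsto_of_le_of_le' tendsto_const_nhds hlim
      (Eventually.of_forall fun _ => zero_le) ?_
    filter_upwards [hun] with n hn
    rw [← lintegral_const_mul' _ _ (by finiteness)]
    refine setLIntegral_mono' measurableSet_Ioc fun s hs => ?_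
    have hsT := Ioc_subset_Icc_self hs
    refine (energy_headSeq_le D.lam_pos _ _ _).trans ?_
    have hu' := h.u_mem s hsT
    have hn' := (h.un_gal n).mem_K hsT
    have hd := D.K.sub_mem hn' hu'
    have e : (fun j => D.T j (un n s) (un n s) - D.T j (u s) (u s)) =
        fun j => D.T j (un n s - u s) (un n s) + D.T j (u s) (un n s - u s) := by
      ext j; simp
    rw [e]
    have h1 : energy D.lam (k + 1) (fun j => D.T j (un n s - u s) (un n s)) ≤
        C * (D.normSq (k + 2) (un n s - u s) * B) :=
      (hest' _ hd _ hn').trans (mul_le_mul_right (mul_le_mul_right (hn s hsT) _) _)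
    have h2 : energy D.lam (k + 1) (fun j => D.T j (u s) (un n s - u s)) ≤
        C * (B * D.normSq (k + 2) (un n s - u s)) :=
      (hest' _ hu' _ hd).trans (mul_le_mul_right (mul_le_mul_left (hu s hsT) _) _)
    refine (bilinNormSq_add_le _ _ _ h1 h2).trans (le_of_eq ?_)
    ring

end GalerkinFrame

/-! ### Convergence at the first level -/

namespace GalerkinFrame

variable {E : Type*} [NormedAddCommGroup E] [InnerProductSpace ℝ E] {D : GalerkinFrame E}
variable {ν T : ℝ} {u₀ : E} {f u : ℝ → E} {un : ℕ → ℝ → E}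

/-- The energy inequality for the difference of `u_n` and the projection of `u`. -/
theorem Scheme.energy_head (h : D.Scheme ν T u₀ f u un) (k n : ℕ)
    (hTu : ∫⁻ s in Ioc 0 T, D.bilinNormSq k (u s) (u s) ≠ ∞) {t : ℝ} (ht : t ∈ Icc 0 T) :
    D.normSq (k + 1) (un n t - D.proj n (u t)) +
        ENNReal.ofReal ν * ∫⁻ s in Ioc 0 t, D.normSq (k + 2) (un n s - D.proj n (u s)) ≤
      ENNReal.ofReal ν⁻¹ * ∫⁻ s in Ioc 0 t,
        energy D.lam k (headSeq n fun j => D.T j (un n s) (un n s) - D.T j (u s) (u s)) := by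
  have hg := h.un_gal n
  have hTi := intervalIntegrable_of_energy D.lam_pos h.T_nonneg (D.aemeasurable_bilin h.u_meas) hTu
  have hTn : ∀ j, IntervalIntegrable (fun s => D.T j (un n s) (un n s)) volume 0 t := fun j =>
    intervalIntegrable_of_continuousOn_Icc (hg.continuousOn_bilin j) ht
  have hcoef : ∀ s j, D.coef (un n s - D.proj n (u s)) j =
      D.coef (un n s) j - if j < n then D.coef (u s) j else 0 := fun s j => by
    rw [D.coef_sub, D.coef_proj]; rfl
  have key := energy_inequality D.lam_pos h.ν_pos ht.1
    (c := fun s => D.coef (un n s - D.proj n (u s)))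
    (g := fun s j => -headSeq n (fun j => D.T j (un n s) (un n s) - D.T j (u s) (u s)) j)
    (c₀ := fun _ => 0)
    (fun j => by
      refine IntervalIntegrable.neg ?_
      unfold headSeq
      split_ifs
      · exact (hTn j).sub (intervalIntegrable_restrict (hTi j) ht)
      · exact intervalIntegrable_const)
    (fun j => by
      simp only [hcoef]
      split_ifs
      · exact ((hg.continuousOn_coef j).sub (h.u_cont j)).mono (Icc_subset_Icc_right ht.2)
      · exact ((hg.continuousOn_coef j).sub continuousOn_const).mono (Icc_subset_Icc_right ht.2))
    (fun j s hs => by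
      have hsT : s ∈ Icc 0 T := ⟨hs.1, hs.2.trans ht.2⟩
      have iF := intervalIntegrable_restrict (h.f_int j) hsT
      have iU := (intervalIntegrable_of_continuousOn_Icc (h.u_cont j) hsT).const_mul (ν * D.lam j)
      have iT := intervalIntegrable_restrict (hTi j) hsT
      have iN := (intervalIntegrable_of_continuousOn_Icc (hg.continuousOn_coef j) hsT).const_mul
        (ν * D.lam j)
      have iTN := intervalIntegrable_of_continuousOn_Icc (hg.continuousOn_bilin j) hsT
      simp only [hcoef]
      unfold headSeq
      split_ifs with hj
      · rw [h.u_eq j s hsT, hg.equation j hj s hsT, add_sub_add_left_eq_sub,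
          ← intervalIntegral.integral_sub ((iF.sub iN).sub iTN) ((iF.sub iU).sub iT), zero_add]
        exact intervalIntegral.integral_congr fun r _ => by ring
      · rw [hg.coef_eq_zero hsT (not_lt.1 hj), sub_zero, zero_add]
        symm
        refine intervalIntegral.integral_zero_ae (Eventually.of_forall fun r hr => ?_)
        rw [hg.coef_eq_zero (uIcc_subset_Icc hsT (uIoc_subset_uIcc hr)) (not_lt.1 hj)]
        ring) k
  rw [energy_zero, zero_add] at key
  simp only [energy_neg] at key
  exact key

/-- The quadratic terms of `u_n = w + q` and of `u` differ by terms that contain `w`, and by terms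
that contain `q - u`; each of them is small in a different way. -/
theorem bilin_diff_le {C : ℝ≥0∞}
    (h12 : ∀ x ∈ D.K, ∀ y ∈ D.K, D.bilinNormSq 0 x y ≤ C * (D.normSq 1 x * D.normSq 2 y))
    (h21 : ∀ x ∈ D.K, ∀ y ∈ D.K, D.bilinNormSq 0 x y ≤ C * (D.normSq 2 x * D.normSq 1 y))
    {x y : E} (hx : x ∈ D.K) (hy : y ∈ D.K) (n : ℕ) :
    energy D.lam 0 (fun j => D.T j x x - D.T j y y) ≤
      16 * C * (D.normSq 1 (x - D.proj n y) * D.normSq 2 (x - D.proj n y) +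
        2 * D.normSq 2 y * D.normSq 1 (x - D.proj n y) +
        (D.normSq 1 (D.proj n y - y) * D.normSq 2 y +
          D.normSq 1 y * D.normSq 2 (D.proj n y - y))) := by
  set q := D.proj n y
  set w := x - q with hw
  have hq : q ∈ D.K := D.proj_mem n y
  have hwK : w ∈ D.K := D.K.sub_mem hx hq
  have hqy : q - y ∈ D.K := D.K.sub_mem hq hy
  have e : (fun j => D.T j x x - D.T j y y) = fun j => D.T j w w + (D.T j w q + (D.T j q w +
      (D.T j (q - y) q + D.T j y (q - y)))) := by
    ext j
    have : x = w + q := by rw [hw, sub_add_cancel]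
    rw [this]
    simp only [map_add, map_sub, add_apply, sub_apply]
    ring
  have hq2 : D.normSq 2 q ≤ D.normSq 2 y := D.normSq_proj_le 2 n y
  have b1 := h12 w hwK w hwK
  have b2 := (h12 w hwK q hq).trans (mul_le_mul_right (mul_le_mul_right hq2 _) _)
  have b3 := (h21 q hq w hwK).trans (mul_le_mul_right (mul_le_mul_left hq2 _) _)
  have b4 := (h12 _ hqy q hq).trans (mul_le_mul_right (mul_le_mul_right hq2 _) _)
  have b5 := h12 y hy _ hqy
  rw [e]
  refine (bilinNormSq_add_le 0 _ _ b1 (bilinNormSq_add_le 0 _ _ b2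
    (bilinNormSq_add_le 0 _ _ b3 (bilinNormSq_add_le 0 _ _ b4 b5)))).trans ?_
  have h2 : ∀ z : ℝ≥0∞, 2 * z ≤ 16 * z := fun z => by gcongr; norm_num
  have h4 : ∀ z : ℝ≥0∞, 4 * z ≤ 16 * z := fun z => by gcongr; norm_num
  have h8 : ∀ z : ℝ≥0∞, 8 * z ≤ 16 * z := fun z => by gcongr; norm_num
  generalize D.normSq 1 w = W1
  generalize D.normSq 2 w = W2
  generalize D.normSq 2 y = Y2
  generalize D.normSq 1 y = Y1
  generalize D.normSq 1 (q - y) = Q1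
  generalize D.normSq 2 (q - y) = Q2
  calc _ = 2 * (C * (W1 * W2)) + (4 * (C * (W1 * Y2)) + (8 * (C * (Y2 * W1)) +
        (16 * (C * (Q1 * Y2)) + 16 * (C * (Y1 * Q2))))) := by ring
    _ ≤ 16 * (C * (W1 * W2)) + (16 * (C * (W1 * Y2)) + (16 * (C * (Y2 * W1)) +
        (16 * (C * (Q1 * Y2)) + 16 * (C * (Y1 * Q2))))) :=
      add_le_add (h2 _) (add_le_add (h4 _) (add_le_add (h8 _) le_rfl))
    _ = _ := by ring

theorem tendsto_remainder {M : ℝ≥0∞} (hM : M ≠ ∞)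
    (hu : AEStronglyMeasurable u (volume.restrict (Ioc 0 T)))
    (hu1 : ∀ᵐ s ∂(volume.restrict (Ioc 0 T)), D.normSq 1 (u s) ≤ M)
    (hu2 : ∫⁻ s in Ioc 0 T, D.normSq 2 (u s) ≠ ∞) :
    Tendsto (fun n => ∫⁻ s in Ioc 0 T, (D.normSq 1 (D.proj n (u s) - u s) * D.normSq 2 (u s) +
      M * D.normSq 2 (D.proj n (u s) - u s))) atTop (𝓝 0) := by
  have htm : ∀ k n, AEMeasurable (fun s => D.normSq k (D.proj n (u s) - u s))
      (volume.restrict (Ioc 0 T)) := fun k n => by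
    simp only [D.normSq_sub_proj]
    refine aemeasurable_energy k fun j => ?_
    unfold tailSeq
    split_ifs
    · exact aemeasurable_const
    · exact D.aemeasurable_coef hu j
  have h1 : Tendsto (fun n => ∫⁻ s in Ioc 0 T,
      D.normSq 1 (D.proj n (u s) - u s) * D.normSq 2 (u s)) atTop (𝓝 0) := by
    rw [← lintegral_zero (μ := volume.restrict (Ioc 0 T))]
    refine tendsto_lintegral_of_dominated_convergence' (fun s => M * D.normSq 2 (u s))
      (fun n => (htm 1 n).mul (D.aemeasurable_normSq hu 2)) (fun n => ?_) ?_ ?_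
    · filter_upwards [hu1] with s hs
      refine mul_le_mul_left (le_trans ?_ hs) _
      rw [D.normSq_sub_proj]
      exact energy_tailSeq_le D.lam_pos n 1 _
    · rw [lintegral_const_mul' _ _ hM]
      exact ENNReal.mul_ne_top hM hu2
    · filter_upwards [hu1, ae_lt_top' (D.aemeasurable_normSq hu 2) hu2] with s hs hs2
      have h3 := tendsto_energy_tailSeq (lam := D.lam) 1 (a := D.coef (u s))
        (ne_top_of_le_ne_top hM hs)
      have h4 := ENNReal.Tendsto.mul_const (b := D.normSq 2 (u s)) h3 (Or.inr hs2.ne)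
      rw [zero_mul] at h4
      simp only [D.normSq_sub_proj]
      exact h4
  have h2 := tendsto_lintegral_energy_tailSeq D.lam_pos 2 (D.aemeasurable_coef hu) hu2
  have h3 := h1.add (ENNReal.Tendsto.const_mul (a := M) h2 (Or.inr hM))
  rw [mul_zero, add_zero] at h3
  refine h3.congr fun n => ?_
  rw [lintegral_add_right' _ ((htm 2 n).const_mul M), lintegral_const_mul' _ _ hM]
  simp only [D.normSq_sub_proj]

/-- The first level. The difference `w` of `u_n` and the projection of `u` starts from zero and
satisfies `d/dt ‖w‖₁² + ν ‖w‖₂² ≤ c ‖w‖₁² ‖w‖₂² + a ‖w‖₁² + r_n` with `a = c ‖u‖₂²` integrable and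
`∫ r_n → 0`. As long as `‖w‖₁` is small the first term on the right is absorbed on the left, and
Grönwall's inequality shows that `‖w‖₁` stays small when `n` is large. -/
theorem Scheme.levelConv_zero (h : D.Scheme ν T u₀ f u un)
    (hf : ∫⁻ s in Ioc 0 T, D.normSq 0 (f s) ≠ ∞) (hu₀ : D.normSq 1 u₀ ≠ ∞)
    {M : ℝ≥0∞} (hM : M ≠ ∞)
    (hu1 : ∀ᵐ s ∂(volume.restrict (Ioc 0 T)), D.normSq 1 (u s) ≤ M)
    (hu2 : ∫⁻ s in Ioc 0 T, D.normSq 2 (u s) ≠ ∞) : D.LevelConv 0 T u un := by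
  obtain ⟨C₁, hC₁, h12⟩ := D.est_one_two
  obtain ⟨C₂, hC₂, h21⟩ := D.est_two_one
  obtain ⟨C, hC, h12', h21'⟩ : ∃ C : ℝ≥0∞, C ≠ ∞ ∧
      (∀ x ∈ D.K, ∀ y ∈ D.K, D.bilinNormSq 0 x y ≤ C * (D.normSq 1 x * D.normSq 2 y)) ∧
      ∀ x ∈ D.K, ∀ y ∈ D.K, D.bilinNormSq 0 x y ≤ C * (D.normSq 2 x * D.normSq 1 y) :=
    ⟨C₁ + C₂, ENNReal.add_ne_top.2 ⟨hC₁, hC₂⟩,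
      fun x hx y hy => (h12 x hx y hy).trans (mul_le_mul_left le_self_add _),
      fun x hx y hy => (h21 x hx y hy).trans (mul_le_mul_left le_add_self _)⟩
  have hTT : T ∈ Icc 0 T := ⟨h.T_nonneg, le_rfl⟩
  have h0T : (0 : ℝ) ∈ Icc 0 T := ⟨le_rfl, h.T_nonneg⟩
  have hν : ENNReal.ofReal ν ≠ 0 := by simpa using h.ν_pos
  set A₀ : ℝ≥0∞ := ∫⁻ s in Ioc 0 T, D.normSq 2 (u s) with hA₀
  have hTu : ∫⁻ s in Ioc 0 T, D.bilinNormSq 0 (u s) (u s) ≠ ∞ := by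
    refine ne_top_of_le_ne_top (?_ : ∫⁻ s in Ioc 0 T, C * M * D.normSq 2 (u s) ≠ ∞)
      (lintegral_mono_ae ?_)
    · rw [lintegral_const_mul' _ _ (ENNReal.mul_ne_top hC hM)]
      exact ENNReal.mul_ne_top (ENNReal.mul_ne_top hC hM) hu2
    · filter_upwards [hu1, ae_restrict_mem measurableSet_Ioc] with s hs hsm
      have hsT := h.u_mem s (Ioc_subset_Icc_self hsm)
      rw [mul_assoc]
      exact (h12' _ hsT _ hsT).trans (mul_le_mul_right (mul_le_mul_left hs _) _)
  let w : ℕ → ℝ → E := fun n s => un n s - D.proj n (u s)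
  let r : ℕ → ℝ → ℝ≥0∞ := fun n s => D.normSq 1 (D.proj n (u s) - u s) * D.normSq 2 (u s) +
    M * D.normSq 2 (D.proj n (u s) - u s)
  let ρ : ℕ → ℝ≥0∞ := fun n => ∫⁻ s in Ioc 0 T, r n s
  have hρ : Tendsto ρ atTop (𝓝 0) := tendsto_remainder hM h.u_meas hu1 hu2
  have hwc : ∀ n j, ContinuousOn (fun s => D.coef (w n s) j) (Icc 0 T) := fun n j => by
    simp only [w, D.coef_sub, D.coef_proj]
    unfold headSeq
    split_ifs
    · exact ((h.un_gal n).continuousOn_coef j).sub (h.u_cont j)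
    · exact ((h.un_gal n).continuousOn_coef j).sub continuousOn_const
  have hw0 : ∀ n, ∀ s ∈ Icc 0 T, ∀ j, n ≤ j → D.coef (w n s) j = 0 := fun n s hs j hj => by
    simp only [w, D.coef_sub, D.coef_proj, headSeq, if_neg (not_lt.2 hj),
      (h.un_gal n).coef_eq_zero hs hj, sub_zero]
  let y : ℕ → ℕ → ℝ → ℝ := fun k n t =>
    ∑ j ∈ Finset.range n, D.lam j ^ k * D.coef (w n t) j ^ 2
  have hyc : ∀ k n, ContinuousOn (y k n) (Icc 0 T) := fun k n =>
    continuousOn_finsetSum _ fun j _ => ((hwc n j).pow 2).const_mul _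
  have hy0 : ∀ k n t, 0 ≤ y k n t := fun k n t => Finset.sum_nonneg fun j _ =>
    mul_nonneg (pow_pos (D.lam_pos j) _).le (sq_nonneg _)
  have hyN : ∀ k n, ∀ t ∈ Icc 0 T, D.normSq k (w n t) = ENNReal.ofReal (y k n t) :=
    fun k n t ht => energy_eq_sum D.lam_pos k n (hw0 n t ht)
  have hym : ∀ k n, AEMeasurable (fun s => D.normSq k (w n s)) (volume.restrict (Ioc 0 T)) :=
    fun k n => aemeasurable_energy k fun j => aemeasurable_restrict_Ioc (hwc n j)
  have hZfin : ∀ n, ∫⁻ s in Ioc 0 T, D.normSq 2 (w n s) ≠ ∞ := fun n => by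
    have h1 : IntegrableOn (y 2 n) (Ioc 0 T) :=
      ((hyc 2 n).integrableOn_Icc).mono_set Ioc_subset_Icc_self
    have h2 := h1.2
    rw [hasFiniteIntegral_iff_ofReal (Eventually.of_forall (hy0 2 n))] at h2
    refine ne_of_lt (lt_of_le_of_lt (le_of_eq ?_) h2)
    exact setLIntegral_congr_fun measurableSet_Ioc fun s hs => hyN 2 n s (Ioc_subset_Icc_self hs)
  -- the right-hand side of the energy inequality
  let H : ℕ → ℝ → ℝ≥0∞ := fun n s => D.normSq 1 (w n s) * D.normSq 2 (w n s) +
    2 * D.normSq 2 (u s) * D.normSq 1 (w n s) + r n s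
  have hH : ∀ n, ∀ᵐ s ∂(volume.restrict (Ioc 0 T)), energy D.lam 0 (headSeq n fun j =>
      D.T j (un n s) (un n s) - D.T j (u s) (u s)) ≤ 16 * C * H n s := fun n => by
    filter_upwards [hu1, ae_restrict_mem measurableSet_Ioc] with s hs hsm
    have hsT := Ioc_subset_Icc_self hsm
    refine (energy_headSeq_le D.lam_pos _ _ _).trans ((bilin_diff_le h12' h21'
      ((h.un_gal n).mem_K hsT) (h.u_mem s hsT) n).trans (mul_le_mul_right ?_ _))
    exact add_le_add le_rfl (add_le_add le_rfl (mul_le_mul_left hs _))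
  set c : ℝ≥0∞ := ENNReal.ofReal ν⁻¹ * (16 * C) with hc
  have hctop : c ≠ ∞ := by finiteness
  let a : ℝ → ℝ≥0∞ := fun s => c * 2 * D.normSq 2 (u s)
  have ham : AEMeasurable a (volume.restrict (Ioc 0 T)) :=
    (D.aemeasurable_normSq h.u_meas 2).const_mul _
  have haint : ∫⁻ s in Ioc 0 T, a s = c * 2 * A₀ :=
    lintegral_const_mul' _ _ (by finiteness)
  have hafin : ∫⁻ s in Ioc 0 T, a s ≠ ∞ := by rw [haint]; finiteness
  -- As long as `‖w‖₁² ≤ δ`, the term `c ‖w‖₁² ‖w‖₂²` is at most half of the dissipation; the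
  -- summand `1` only excludes a vanishing denominator.
  set δ : ℝ := ν / (2 * (c.toReal + 1)) with hδdef
  have hν' := h.ν_pos
  have hδ : 0 < δ := by positivity
  have hcδ : c * ENNReal.ofReal δ ≤ ENNReal.ofReal (ν / 2) := by
    rw [← ENNReal.ofReal_toReal hctop, ← ENNReal.ofReal_mul ENNReal.toReal_nonneg]
    apply ENNReal.ofReal_le_ofReal
    have hp : 0 ≤ c.toReal := ENNReal.toReal_nonneg
    have : c.toReal * δ = ν / 2 * (c.toReal / (c.toReal + 1)) := by
      rw [hδdef]; field_simp
    rw [this]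
    exact mul_le_of_le_one_right (by positivity) (by rw [div_le_one (by positivity)]; linarith)
  have hνν : ENNReal.ofReal ν = ENNReal.ofReal (ν / 2) + ENNReal.ofReal (ν / 2) := by
    rw [← ENNReal.ofReal_add (by positivity) (by positivity), add_halves]
  -- the absorbed energy inequality
  have habs : ∀ n, ∀ t ∈ Icc 0 T, (∀ s ∈ Icc 0 t, y 1 n s ≤ δ) →
      D.normSq 1 (w n t) + ENNReal.ofReal (ν / 2) * ∫⁻ s in Ioc 0 t, D.normSq 2 (w n s) ≤
        c * ρ n + ∫⁻ s in Ioc 0 t, a s * ENNReal.ofReal (y 1 n s) := by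
    intro n t ht hsmall
    have hsub : Ioc 0 t ⊆ Ioc 0 T := Ioc_subset_Ioc_right ht.2
    set Z : ℝ≥0∞ := ∫⁻ s in Ioc 0 t, D.normSq 2 (w n s) with hZ
    have hZtop : Z ≠ ∞ := ne_top_of_le_ne_top (hZfin n) (lintegral_mono_set hsub)
    have h1 := h.energy_head 0 n hTu ht
    have h2 : ∫⁻ s in Ioc 0 t, energy D.lam 0 (headSeq n fun j =>
        D.T j (un n s) (un n s) - D.T j (u s) (u s)) ≤
        ∫⁻ s in Ioc 0 t, (16 * C * ENNReal.ofReal δ * D.normSq 2 (w n s) +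
          (16 * C * (2 * D.normSq 2 (u s)) * ENNReal.ofReal (y 1 n s) + 16 * C * r n s)) := by
      refine lintegral_mono_ae ?_
      filter_upwards [ae_restrict_of_ae_restrict_of_subset hsub (hH n),
        ae_restrict_mem measurableSet_Ioc] with s hs hsm
      have hsT := Ioc_subset_Icc_self (hsub hsm)
      refine hs.trans ?_
      simp only [H, hyN 1 n s hsT]
      have h3 : ENNReal.ofReal (y 1 n s) ≤ ENNReal.ofReal δ :=
        ENNReal.ofReal_le_ofReal (hsmall s (Ioc_subset_Icc_self hsm))
      calc _ ≤ 16 * C * (ENNReal.ofReal δ * D.normSq 2 (w n s) +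
            2 * D.normSq 2 (u s) * ENNReal.ofReal (y 1 n s) + r n s) := by gcongr
        _ = _ := by ring
    have hsm : ∀ {g : ℝ → ℝ≥0∞}, AEMeasurable g (volume.restrict (Ioc 0 T)) →
        AEMeasurable g (volume.restrict (Ioc 0 t)) :=
      fun hg => hg.mono_measure (Measure.restrict_mono_set _ hsub)
    have hy1m : AEMeasurable (fun s => ENNReal.ofReal (y 1 n s)) (volume.restrict (Ioc 0 T)) :=
      (aemeasurable_restrict_Ioc (hyc 1 n)).ennreal_ofReal
    have hmm : AEMeasurable (fun s => 16 * C * (2 * D.normSq 2 (u s)) * ENNReal.ofReal (y 1 n s))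
        (volume.restrict (Ioc 0 t)) :=
      (((hsm (D.aemeasurable_normSq h.u_meas 2)).const_mul 2).const_mul _).mul (hsm hy1m)
    have h4 : ENNReal.ofReal ν⁻¹ * ∫⁻ s in Ioc 0 t,
        (16 * C * ENNReal.ofReal δ * D.normSq 2 (w n s) +
          (16 * C * (2 * D.normSq 2 (u s)) * ENNReal.ofReal (y 1 n s) + 16 * C * r n s)) =
        c * ENNReal.ofReal δ * Z + ((∫⁻ s in Ioc 0 t, a s * ENNReal.ofReal (y 1 n s)) +
          c * ∫⁻ s in Ioc 0 t, r n s) := by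
      rw [lintegral_add_left' ((hsm (hym 2 n)).const_mul _), lintegral_add_left' hmm,
        lintegral_const_mul' _ _ (by finiteness), lintegral_const_mul' _ _ (by finiteness), mul_add,
        mul_add, ← lintegral_const_mul' _ _ ENNReal.ofReal_ne_top]
      simp only [a, hc, hZ, mul_assoc]
    have h5 : D.normSq 1 (w n t) + ENNReal.ofReal ν * Z ≤
        ENNReal.ofReal (ν / 2) * Z +
          (c * ρ n + ∫⁻ s in Ioc 0 t, a s * ENNReal.ofReal (y 1 n s)) := by
      refine h1.trans ((mul_le_mul_right h2 _).trans ?_)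
      rw [h4, add_comm (c * ρ n)]
      exact add_le_add (mul_le_mul_left hcδ _)
        (add_le_add le_rfl (mul_le_mul_right (lintegral_mono_set hsub) _))
    rw [hνν, add_mul, ← add_assoc, add_comm] at h5
    exact (ENNReal.add_le_add_iff_left (ENNReal.mul_ne_top ENNReal.ofReal_ne_top hZtop)).1 h5
  set A : ℝ := (∫⁻ s in Ioc 0 T, a s).toReal with hA
  let κ : ℕ → ℝ := fun n => (c * ρ n).toReal * Real.exp A
  have hcρ : Tendsto (fun n => c * ρ n) atTop (𝓝 0) := by
    have := ENNReal.Tendsto.const_mul (a := c) hρ (Or.inr hctop)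
    rwa [mul_zero] at this
  have hκ : Tendsto κ atTop (𝓝 0) := by
    have := ((ENNReal.tendsto_toReal ENNReal.zero_ne_top).comp hcρ).mul_const (Real.exp A)
    simp only [ENNReal.toReal_zero, zero_mul] at this
    exact this
  have hκe : Tendsto (fun n => ENNReal.ofReal (κ n)) atTop (𝓝 0) := by
    simpa using ENNReal.tendsto_ofReal hκ
  have hev : ∀ᶠ n in atTop, c * ρ n ≠ ∞ ∧ κ n < δ :=
    ((hcρ.eventually_lt_const zero_lt_one).mono fun n hn => ne_top_of_lt hn).and
      (hκ.eventually_lt_const hδ)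
  have hysmall : ∀ᶠ n in atTop, (∀ t ∈ Icc 0 T, y 1 n t ≤ κ n) ∧ c * ρ n ≠ ∞ ∧ κ n < δ := by
    filter_upwards [hev] with n hn
    refine ⟨?_, hn⟩
    have hy00 : y 1 n 0 = 0 := by
      have h1 := h.energy_head 0 n hTu h0T
      simp only [Ioc_self, Measure.restrict_empty, lintegral_zero_measure, mul_zero,
        add_zero] at h1
      have h2 := hyN 1 n 0 h0T
      have h3 : D.normSq 1 (w n 0) = 0 := le_antisymm h1 zero_le
      rw [h3] at h2
      exact le_antisymm (ENNReal.ofReal_eq_zero.1 h2.symm) (hy0 1 n 0)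
    refine gronwall_bootstrap (δ := δ) ham hafin ENNReal.toReal_nonneg (hyc 1 n)
      (fun t _ => hy0 1 n t) hn.2 (by rw [hy00]; exact hδ) fun t ht hs => ?_
    rw [ENNReal.ofReal_toReal hn.1, ← hyN 1 n t ht]
    exact le_self_add.trans (habs n t ht hs)
  -- smallness of `w` in the norm of the level above, integrated in time
  let ζ : ℕ → ℝ≥0∞ := fun n => (ENNReal.ofReal (ν / 2))⁻¹ *
    (c * ρ n + c * 2 * A₀ * ENNReal.ofReal (κ n))
  have hν2 : ENNReal.ofReal (ν / 2) ≠ 0 := by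
    rw [Ne, ENNReal.ofReal_eq_zero, not_le]; positivity
  have hζ : Tendsto ζ atTop (𝓝 0) := by
    have h1 := ENNReal.Tendsto.const_mul (a := c * 2 * A₀) hκe (Or.inr (by finiteness))
    have h2 := ENNReal.Tendsto.const_mul (a := (ENNReal.ofReal (ν / 2))⁻¹) (hcρ.add h1)
      (Or.inr (ENNReal.inv_ne_top.2 hν2))
    simpa only [mul_zero, add_zero] using h2
  have hZle : ∀ᶠ n in atTop, (∀ t ∈ Icc 0 T, D.normSq 1 (w n t) ≤ ENNReal.ofReal (κ n)) ∧
      ∫⁻ s in Ioc 0 T, D.normSq 2 (w n s) ≤ ζ n := by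
    filter_upwards [hysmall] with n hn
    have hle : ∀ t ∈ Icc 0 T, D.normSq 1 (w n t) ≤ ENNReal.ofReal (κ n) := fun t ht => by
      rw [hyN 1 n t ht]; exact ENNReal.ofReal_le_ofReal (hn.1 t ht)
    refine ⟨hle, ?_⟩
    have h1 := le_add_self.trans (habs n T hTT fun s hs => (hn.1 s hs).trans hn.2.2.le)
    have h2 : ∫⁻ s in Ioc 0 T, a s * ENNReal.ofReal (y 1 n s) ≤
        c * 2 * A₀ * ENNReal.ofReal (κ n) := by
      rw [← haint, ← lintegral_mul_const' _ _ ENNReal.ofReal_ne_top]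
      exact setLIntegral_mono' measurableSet_Ioc fun s hs =>
        mul_le_mul_right (ENNReal.ofReal_le_ofReal (hn.1 s (Ioc_subset_Icc_self hs))) _
    have h3 := mul_le_mul_right (h1.trans (add_le_add le_rfl h2)) (ENNReal.ofReal (ν / 2))⁻¹
    rwa [← mul_assoc, ENNReal.inv_mul_cancel hν2 ENNReal.ofReal_ne_top, one_mul] at h3
  refine h.levelConv_of_tendsto 0 hf hu₀ hTu ?_
  have hlim : Tendsto (fun n => 16 * C * (ENNReal.ofReal δ * ζ n +
      (2 * A₀ * ENNReal.ofReal (κ n) + ρ n))) atTop (𝓝 0) := by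
    have h1 := ENNReal.Tendsto.const_mul (a := ENNReal.ofReal δ) hζ (Or.inr ENNReal.ofReal_ne_top)
    have h2 := ENNReal.Tendsto.const_mul (a := 2 * A₀) hκe (Or.inr (by finiteness))
    have h3 := ENNReal.Tendsto.const_mul (a := 16 * C) (h1.add (h2.add hρ))
      (Or.inr (by finiteness))
    simpa only [mul_zero, add_zero] using h3
  refine tendsto_of_tendsto_of_tendsto_of_le_of_le' tendsto_const_nhds hlim
    (Eventually.of_forall fun _ => zero_le) ?_
  filter_upwards [hZle, hysmall] with n hn hn'
  have h1 : ∫⁻ s in Ioc 0 T, energy D.lam 0 (headSeq n fun j =>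
      D.T j (un n s) (un n s) - D.T j (u s) (u s)) ≤ ∫⁻ s in Ioc 0 T, 16 * C *
        (ENNReal.ofReal δ * D.normSq 2 (w n s) +
          (2 * D.normSq 2 (u s) * ENNReal.ofReal (κ n) + r n s)) := by
    refine lintegral_mono_ae ?_
    filter_upwards [hH n, ae_restrict_mem measurableSet_Ioc] with s hs hsm
    have hsT := Ioc_subset_Icc_self hsm
    refine hs.trans (mul_le_mul_right ?_ _)
    simp only [H]
    rw [add_assoc]
    refine add_le_add (mul_le_mul_left ((hn.1 s hsT).trans
      (ENNReal.ofReal_le_ofReal hn'.2.2.le)) _)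
      (add_le_add (mul_le_mul_right (hn.1 s hsT) _) le_rfl)
  refine h1.trans ?_
  rw [lintegral_const_mul' _ _ (by finiteness), lintegral_add_left' ((hym 2 n).const_mul _),
    lintegral_add_left' (((D.aemeasurable_normSq h.u_meas 2).const_mul 2).mul_const _),
    lintegral_const_mul' _ _ ENNReal.ofReal_ne_top, lintegral_mul_const' _ _ ENNReal.ofReal_ne_top,
    lintegral_const_mul' _ _ (by norm_num)]
  exact mul_le_mul_right (add_le_add (mul_le_mul_right hn.2 _) le_rfl) _

/-- Convergence at every level that the data allow. -/
theorem Scheme.levelConv (h : D.Scheme ν T u₀ f u un) {p : ℕ}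
    (hf : ∫⁻ s in Ioc 0 T, D.normSq p (f s) ≠ ∞) (hu₀ : D.normSq (p + 1) u₀ ≠ ∞)
    {M : ℝ≥0∞} (hM : M ≠ ∞)
    (hu1 : ∀ᵐ s ∂(volume.restrict (Ioc 0 T)), D.normSq 1 (u s) ≤ M)
    (hu2 : ∫⁻ s in Ioc 0 T, D.normSq 2 (u s) ≠ ∞) : D.LevelConv p T u un := by
  have hf' : ∀ k ≤ p, ∫⁻ s in Ioc 0 T, D.normSq k (f s) ≠ ∞ := fun k hk => by
    obtain ⟨C, hC, hle⟩ := exists_energy_le_mul D.lam_pos D.lam_mono hk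
    refine ne_top_of_le_ne_top (?_ : ∫⁻ s in Ioc 0 T, C * D.normSq p (f s) ≠ ∞)
      (lintegral_mono fun s => hle _)
    rw [lintegral_const_mul' _ _ hC]
    exact ENNReal.mul_ne_top hC hf
  have hu₀' : ∀ k ≤ p + 1, D.normSq k u₀ ≠ ∞ := fun k hk => by
    obtain ⟨C, hC, hle⟩ := exists_energy_le_mul D.lam_pos D.lam_mono hk
    exact ne_top_of_le_ne_top (ENNReal.mul_ne_top hC hu₀) (hle _)
  have key : ∀ k ≤ p, D.LevelConv k T u un := by
    intro k
    induction k with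
    | zero => exact fun _ => h.levelConv_zero (hf' 0 (Nat.zero_le p)) (hu₀' 1 (by omega)) hM hu1 hu2
    | succ k ih => exact fun hk => h.levelConv_succ k (ih (by omega)) (hf' _ hk) (hu₀' _ (by omega))
  exact key p le_rfl

end GalerkinFrame

/-! ### Weighted estimates for convolutions of sequences -/

theorem ennreal_add_pow_le (a b : ℝ≥0∞) (k : ℕ) : (a + b) ^ k ≤ 2 ^ k * (a ^ k + b ^ k) := by
  calc (a + b) ^ k ≤ (2 * max a b) ^ k := by
        refine pow_le_pow_left' ?_ k
        rw [two_mul]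
        exact add_le_add (le_max_left _ _) (le_max_right _ _)
    _ ≤ 2 ^ k * (a ^ k + b ^ k) := by
        rw [mul_pow]
        refine mul_le_mul_right ?_ _
        rcases max_choice a b with h | h <;> rw [h]
        · exact le_self_add
        · exact le_add_self

theorem tsum_mul_sq_le {ι : Type*} (f g : ι → ℝ≥0∞) :
    (∑' i, f i * g i) ^ 2 ≤ (∑' i, f i ^ 2) * ∑' i, g i ^ 2 := by
  let _ : MeasurableSpace ι := ⊤
  have h := ENNReal.lintegral_mul_le_Lp_mul_Lq (Measure.count : Measure ι)
    Real.HolderConjugate.two_two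
    (f := f) (g := g) (measurable_from_top.aemeasurable) (measurable_from_top.aemeasurable)
  simp only [Pi.mul_apply, lintegral_count, ENNReal.rpow_ofNat] at h
  have h2 := pow_le_pow_left' h 2
  rw [mul_pow, ← ENNReal.rpow_natCast, ← ENNReal.rpow_natCast, ← ENNReal.rpow_natCast,
    ← ENNReal.rpow_mul, ← ENNReal.rpow_mul] at h2
  norm_num at h2
  exact h2

section Convolution

variable {G : Type*} [AddCommGroup G]

/-- The convolution of two nonnegative sequences. -/
noncomputable def conv (α β : G → ℝ≥0∞) (κ : G) : ℝ≥0∞ := ∑' q, α (κ - q) * β q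

theorem tsum_sub_left (f : G → ℝ≥0∞) (κ : G) : ∑' q, f (κ - q) = ∑' q, f q :=
  (Equiv.subLeft κ).tsum_eq f

theorem tsum_sub_right (f : G → ℝ≥0∞) (q : G) : ∑' κ, f (κ - q) = ∑' κ, f κ :=
  (Equiv.subRight q).tsum_eq f

/-- The Cauchy-Schwarz inequality, applied to each term of the convolution with a weight that is
square summable in `q` uniformly in `κ`. -/
theorem tsum_weighted_conv_sq_le {W : G → G → ℝ≥0∞} {S : ℝ≥0∞}
    (hW : ∀ κ, ∑' q, W κ q ^ 2 ≤ S) (a b : G → ℝ≥0∞) :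
    ∑' κ, (∑' q, W κ q * (a (κ - q) * b q)) ^ 2 ≤ S * ((∑' p, a p ^ 2) * ∑' q, b q ^ 2) := by
  calc ∑' κ, (∑' q, W κ q * (a (κ - q) * b q)) ^ 2
      ≤ ∑' κ, S * ∑' q, a (κ - q) ^ 2 * b q ^ 2 := ENNReal.tsum_le_tsum fun κ => by
        refine (tsum_mul_sq_le _ _).trans (mul_le_mul' (hW κ) (le_of_eq ?_))
        exact tsum_congr fun q => mul_pow _ _ _
    _ = S * ∑' q, ∑' κ, a (κ - q) ^ 2 * b q ^ 2 := by
        rw [ENNReal.tsum_mul_left, ENNReal.tsum_comm]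
    _ = S * ((∑' p, a p ^ 2) * ∑' q, b q ^ 2) := by
        congr 1
        rw [← ENNReal.tsum_mul_left]
        refine tsum_congr fun q => ?_
        rw [ENNReal.tsum_mul_right, tsum_sub_right (fun p => a p ^ 2) q]

variable [DecidableEq G] (m : G → ℝ≥0∞)

/-- The inverse of the weight `m`, set to zero at the frequency `0`. -/
noncomputable def invWeight (p : G) : ℝ≥0∞ := if p = 0 then 0 else (m p)⁻¹

variable {m}

theorem invWeight_mul (hm0 : ∀ p ≠ 0, m p ≠ 0) (hm : ∀ p, m p ≠ ∞) {α : G → ℝ≥0∞} (h0 : α 0 = 0)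
    (p : G) : invWeight m p * (m p * α p) = α p := by
  unfold invWeight
  split_ifs with h
  · rw [h, h0, zero_mul]
  · rw [← mul_assoc, ENNReal.inv_mul_cancel (hm0 p h) (hm p), one_mul]

/-- The product of two functions of class `H¹` is square integrable, in terms of Fourier
coefficients. In dimension three the weight `|p|⁻⁴` is summable. -/
theorem tsum_conv_sq_le_one_one (hm0 : ∀ p ≠ 0, m p ≠ 0) (hm : ∀ p, m p ≠ ∞) {α β : G → ℝ≥0∞}
    (hα : α 0 = 0) (hβ : β 0 = 0) :
    ∑' κ, conv α β κ ^ 2 ≤ (∑' p, invWeight m p ^ 4) *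
      ((∑' p, (m p * α p) ^ 2) * ∑' q, (m q * β q) ^ 2) := by
  refine le_trans (le_of_eq ?_) (tsum_weighted_conv_sq_le
    (W := fun κ q => invWeight m (κ - q) * invWeight m q) (fun κ => ?_)
    (fun p => m p * α p) (fun q => m q * β q))
  · refine tsum_congr fun κ => congrArg (· ^ 2) (tsum_congr fun q => ?_)
    rw [mul_mul_mul_comm, invWeight_mul hm0 hm hα, invWeight_mul hm0 hm hβ]
  · have h := tsum_mul_sq_le (fun q => invWeight m (κ - q) ^ 2) (fun q => invWeight m q ^ 2)
    simp only [← pow_mul] at h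
    rw [tsum_sub_left (fun q => invWeight m q ^ (2 * 2)) κ, ← sq] at h
    simp only [mul_pow]
    exact (ENNReal.pow_le_pow_left_iff two_ne_zero).1 h

/-- The product of a function of class `H²` and a square integrable function is square
integrable, in terms of Fourier coefficients. -/
theorem tsum_conv_sq_le_two_zero (hm0 : ∀ p ≠ 0, m p ≠ 0) (hm : ∀ p, m p ≠ ∞) {α β : G → ℝ≥0∞}
    (hα : α 0 = 0) :
    ∑' κ, conv α β κ ^ 2 ≤ (∑' p, invWeight m p ^ 4) *
      ((∑' p, (m p ^ 2 * α p) ^ 2) * ∑' q, β q ^ 2) := by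
  refine le_trans (le_of_eq ?_) (tsum_weighted_conv_sq_le
    (W := fun κ q => invWeight m (κ - q) ^ 2) (fun κ => ?_) (fun p => m p ^ 2 * α p) β)
  · refine tsum_congr fun κ => congrArg (· ^ 2) (tsum_congr fun q => ?_)
    rw [← mul_assoc]
    congr 1
    have h1 := invWeight_mul hm0 hm (α := fun p => m p * α p) (by simp [hα]) (κ - q)
    have h2 := invWeight_mul hm0 hm hα (κ - q)
    rw [sq, sq, mul_assoc, mul_assoc, h1, h2]
  · simp only [← pow_mul]
    exact le_of_eq (tsum_sub_left (fun q => invWeight m q ^ 4) κ)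

/-- The estimate of a product `a ∂b` in the norm of order `k`, in terms of Fourier coefficients:
the weight `|κ|^k` is shared out between the two factors. -/
theorem tsum_weight_conv_sq_le (hm0 : ∀ p ≠ 0, m p ≠ 0) (hm : ∀ p, m p ≠ ∞)
    (hz : m 0 = 0) (hadd : ∀ p q, m p ≤ m (p - q) + m q) {α β : G → ℝ≥0∞} (hα : α 0 = 0) (k : ℕ) :
    ∑' κ, (m κ ^ k * conv α (fun q => m q * β q) κ) ^ 2 ≤
      4 * 4 ^ k * (∑' p, invWeight m p ^ 4) *
        ((∑' p, (m p ^ (k + 1) * α p) ^ 2) * (∑' q, (m q ^ 2 * β q) ^ 2) +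
          (∑' p, (m p ^ 2 * α p) ^ 2) * ∑' q, (m q ^ (k + 1) * β q) ^ 2) := by
  have hpow : ∀ p q, m p ^ k ≤ 2 ^ k * (m (p - q) ^ k + m q ^ k) := fun p q =>
    (pow_le_pow_left' (hadd p q) k).trans (ennreal_add_pow_le _ _ k)
  have hle : ∀ κ, m κ ^ k * conv α (fun q => m q * β q) κ ≤ 2 ^ k *
      (conv (fun p => m p ^ k * α p) (fun q => m q * β q) κ +
        conv α (fun q => m q ^ (k + 1) * β q) κ) := fun κ => by
    unfold conv
    rw [← ENNReal.tsum_mul_left, ← ENNReal.tsum_add, ← ENNReal.tsum_mul_left]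
    refine ENNReal.tsum_le_tsum fun q => ?_
    refine (mul_le_mul_left (hpow κ q) _).trans (le_of_eq ?_)
    ring
  have h1 := tsum_conv_sq_le_one_one hm0 hm (α := fun p => m p ^ k * α p)
    (β := fun q => m q * β q) (by simp [hα]) (by simp [hz])
  have h2 := tsum_conv_sq_le_two_zero hm0 hm (β := fun q => m q ^ (k + 1) * β q) hα
  calc _ ≤ ∑' κ, 4 * 4 ^ k * (conv (fun p => m p ^ k * α p) (fun q => m q * β q) κ ^ 2 +
        conv α (fun q => m q ^ (k + 1) * β q) κ ^ 2) := ENNReal.tsum_le_tsum fun κ => by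
        refine (pow_le_pow_left' (hle κ) 2).trans ?_
        rw [mul_pow, ← pow_mul, mul_comm k 2, pow_mul]
        refine (mul_le_mul_right (ennreal_add_pow_le _ _ 2) _).trans (le_of_eq ?_)
        norm_num
        ring
    _ = 4 * 4 ^ k * (∑' κ, conv (fun p => m p ^ k * α p) (fun q => m q * β q) κ ^ 2 +
        ∑' κ, conv α (fun q => m q ^ (k + 1) * β q) κ ^ 2) := by
        rw [ENNReal.tsum_mul_left, ENNReal.tsum_add]
    _ ≤ _ := (mul_le_mul_right (add_le_add h1 h2) _).trans (le_of_eq ?_)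
  have e1 : ∀ p, m p * (m p ^ k * α p) = m p ^ (k + 1) * α p := fun p => by ring
  have e2 : ∀ p, m p * (m p * β p) = m p ^ 2 * β p := fun p => by ring
  simp only [e1, e2]
  ring

end Convolution

noncomputable section

/-! ### Fourier coefficients on the periodic cell -/

/-- The exponential `x ↦ exp (-2πi κ·x / L)`. -/
def cellChar (L : ℝ) (κ : Fin 3 → ℤ) (x : E3) : ℂ :=
  Complex.exp (-(2 * Real.pi * Complex.I / L) * ∑ i, (κ i : ℂ) * (x i : ℂ))

/-- The Fourier coefficient of `g` on the cell, normalized by the volume of the cell. -/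
def cellCoeff (L : ℝ) (g : E3 → ℂ) (κ : Fin 3 → ℤ) : ℂ :=
  (L ^ 3 : ℝ)⁻¹ • ∫ x, cellChar L κ x * g x ∂(cellMeasure L)

theorem continuous_cellChar (L : ℝ) (κ : Fin 3 → ℤ) : Continuous (cellChar L κ) := by
  unfold cellChar
  fun_prop

/-- The representative in `(0, L]³` of a point of the torus. -/
def torusRep (L : ℝ) (t : UnitAddTorus (Fin 3)) : E3 :=
  L • WithLp.toLp 2 (fun i => (AddCircle.equivIoc 1 0 (t i)).1)

theorem torusRep_coe (L : ℝ) {x : Fin 3 → ℝ} (hx : ∀ i, x i ∈ Ioc (0 : ℝ) (0 + 1)) :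
    torusRep L (fun i => (x i : UnitAddCircle)) = L • WithLp.toLp 2 x := by
  unfold torusRep
  congr 2
  ext i
  exact AddCircle.equivIoc_coe_of_mem (hx i)

theorem measurable_torusRep (L : ℝ) : Measurable (torusRep L) := by
  refine Measurable.const_smul ?_ L
  refine (PiLp.volume_preserving_toLp (Fin 3)).measurable.comp ?_
  refine measurable_pi_lambda _ fun i => ?_
  exact (measurable_subtype_coe.comp (AddCircle.measurableEquivIoc 1 0).measurable).comp
    (measurable_pi_apply i)

theorem torusRep_mem_cell {L : ℝ} (hL : 0 < L) (t : UnitAddTorus (Fin 3)) :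
    torusRep L t ∈ cell L := by
  intro i
  have h := (AddCircle.equivIoc 1 0 (t i)).2
  simp only [torusRep, PiLp.smul_apply, smul_eq_mul]
  exact ⟨mul_nonneg hL.le h.1.le, mul_le_of_le_one_right hL.le (h.2.trans_eq (zero_add 1))⟩

theorem isCompact_cell (L : ℝ) : IsCompact (cell L) := by
  have h : IsCompact (Icc (fun _ : Fin 3 => (0:ℝ)) (fun _ => L)) := isCompact_Icc
  have h2 := h.image (PiLp.continuous_toLp 2 (fun _ : Fin 3 => ℝ))
  convert h2 using 1
  ext x
  simp only [cell, mem_ofPred_eq, mem_image, mem_Icc, Pi.le_def]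
  constructor
  · intro h
    exact ⟨x.ofLp, ⟨fun i => (h i).1, fun i => (h i).2⟩, rfl⟩
  · rintro ⟨y, hy, rfl⟩ i
    exact ⟨hy.1 i, hy.2 i⟩

instance isFiniteMeasure_cellMeasure (L : ℝ) : IsFiniteMeasure (cellMeasure L) :=
  ⟨by rw [cellMeasure, Measure.restrict_apply_univ]; exact (isCompact_cell L).measure_lt_top⟩

theorem setIntegral_cell {F : Type*} [NormedAddCommGroup F] [NormedSpace ℝ F] (L : ℝ)
    (Φ : E3 → F) : ∫ x, Φ x ∂(cellMeasure L) =
      ∫ y in Icc (fun _ : Fin 3 => (0:ℝ)) (fun _ => L), Φ (WithLp.toLp 2 y) := by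
  have h := (PiLp.volume_preserving_toLp (Fin 3)).setIntegral_preimage_emb
    (MeasurableEquiv.toLp 2 (Fin 3 → ℝ)).measurableEmbedding Φ (cell L)
  rw [cellMeasure, ← h]
  congr 2
  ext x
  simp only [cell, mem_Icc, Pi.le_def, mem_preimage, mem_ofPred_eq, forall_and]

local instance : MeasureSpace UnitAddCircle := ⟨AddCircle.haarAddCircle⟩

local instance : IsProbabilityMeasure (volume : Measure UnitAddCircle) :=
  inferInstanceAs (IsProbabilityMeasure AddCircle.haarAddCircle)

open scoped Pointwise in
theorem integral_torusRep {F : Type*} [NormedAddCommGroup F] [NormedSpace ℝ F] {L : ℝ}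
    (hL : 0 < L) (Φ : E3 → F) :
    ∫ t : UnitAddTorus (Fin 3), Φ (torusRep L t) =
      (L ^ 3 : ℝ)⁻¹ • ∫ x, Φ x ∂(cellMeasure L) := by
  rw [UnitAddTorus.integral_preimage _ 0, setIntegral_cell]
  have e1 : ∫ x in {x : Fin 3 → ℝ | ∀ i, x i ∈ Ioc ((0 : Fin 3 → ℝ) i) ((0 : Fin 3 → ℝ) i + 1)},
      Φ (torusRep L fun i => (x i : UnitAddCircle)) =
      ∫ x in {x : Fin 3 → ℝ | ∀ i, x i ∈ Ioc ((0 : Fin 3 → ℝ) i) ((0 : Fin 3 → ℝ) i + 1)},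
      (fun y => Φ (WithLp.toLp 2 y)) (L • x) := by
    refine setIntegral_congr_fun ?_ ?_
    · exact MeasurableSet.univ_pi' (fun i => measurableSet_Ioc)
    · intro x hx
      change Φ _ = Φ _
      rw [torusRep_coe L hx]
      rfl
  have e2 : {x : Fin 3 → ℝ | ∀ i, x i ∈ Ioc ((0 : Fin 3 → ℝ) i) ((0 : Fin 3 → ℝ) i + 1)} =ᵐ[volume]
      Icc (fun _ : Fin 3 => (0:ℝ)) (fun _ => (1:ℝ)) := by
    have := (Measure.univ_pi_Ioc_ae_eq_Icc (μ := fun _ : Fin 3 => (volume : Measure ℝ))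
      (f := fun _ : Fin 3 => (0:ℝ)) (g := fun _ => (1:ℝ)))
    have hs : {x : Fin 3 → ℝ | ∀ i, x i ∈ Ioc ((0 : Fin 3 → ℝ) i) ((0 : Fin 3 → ℝ) i + 1)} =
        univ.pi fun _ => Ioc (0:ℝ) 1 := by
      ext x
      simp
    rw [hs]
    exact this
  rw [e1, setIntegral_congr_set e2,
    Measure.setIntegral_comp_smul_of_pos volume (fun y => Φ (WithLp.toLp 2 y)) _ hL]
  have e3 : L • Icc (fun _ : Fin 3 => (0:ℝ)) (fun _ => (1:ℝ)) =
      Icc (fun _ : Fin 3 => (0:ℝ)) (fun _ => L) := by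
    ext x
    rw [mem_smul_set_iff_inv_smul_mem₀ hL.ne']
    simp only [mem_Icc, Pi.le_def, Pi.smul_apply, smul_eq_mul]
    constructor
    · rintro ⟨h1, h2⟩
      exact ⟨fun i => by have := h1 i; rwa [mul_nonneg_iff_of_pos_left (inv_pos.2 hL)] at this,
        fun i => by have := h2 i; rwa [inv_mul_le_iff₀ hL, mul_one] at this⟩
    · rintro ⟨h1, h2⟩
      exact ⟨fun i => mul_nonneg (inv_nonneg.2 hL.le) (h1 i),
        fun i => by rw [inv_mul_le_iff₀ hL, mul_one]; exact h2 i⟩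
  rw [e3]
  simp

theorem mFourier_eq_cellChar {L : ℝ} (hL : 0 < L) (κ : Fin 3 → ℤ) (t : UnitAddTorus (Fin 3)) :
    UnitAddTorus.mFourier (-κ) t = cellChar L κ (torusRep L t) := by
  have ht : t = fun i => (((AddCircle.equivIoc 1 0 (t i)).1 : ℝ) : UnitAddCircle) := by
    ext i
    exact ((AddCircle.equivIoc 1 0).symm_apply_apply (t i)).symm
  conv_lhs => rw [ht]
  have hL' : (L : ℂ) ≠ 0 := by exact_mod_cast hL.ne'
  simp only [UnitAddTorus.mFourier, ContinuousMap.coe_mk, fourier_coe_apply, cellChar, torusRep,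
    PiLp.smul_apply, smul_eq_mul, ← Complex.exp_sum]
  congr 1
  rw [Finset.mul_sum]
  refine Finset.sum_congr rfl fun i _ => ?_
  push_cast
  simp only [Pi.neg_apply, Int.cast_neg]
  field_simp

theorem mFourierCoeff_torusRep {L : ℝ} (hL : 0 < L) (g : E3 → ℂ) (κ : Fin 3 → ℤ) :
    UnitAddTorus.mFourierCoeff (fun t => g (torusRep L t)) κ = cellCoeff L g κ := by
  rw [cellCoeff, ← integral_torusRep hL]
  unfold UnitAddTorus.mFourierCoeff
  refine integral_congr_ae (Eventually.of_forall fun t => ?_)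
  change _ • _ = _ * _
  rw [mFourier_eq_cellChar hL, smul_eq_mul]

theorem memLp_torusRep {L : ℝ} (hL : 0 < L) {g : E3 → ℂ} (hg : Continuous g) :
    MemLp (fun t => g (torusRep L t)) 2 (volume : Measure (UnitAddTorus (Fin 3))) := by
  obtain ⟨C, hC⟩ := (isCompact_cell L).exists_bound_of_continuousOn hg.continuousOn
  refine MemLp.of_bound ?_ C (Eventually.of_forall fun t => hC _ (torusRep_mem_cell hL t))
  exact (hg.measurable.comp (measurable_torusRep L)).aestronglyMeasurable

/-- Parseval's identity on the cell. -/
theorem hasSum_conj_cellCoeff_mul {L : ℝ} (hL : 0 < L) {f g : E3 → ℂ} (hf : Continuous f)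
    (hg : Continuous g) :
    HasSum (fun κ => starRingEnd ℂ (cellCoeff L f κ) * cellCoeff L g κ)
      ((L ^ 3 : ℝ)⁻¹ • ∫ x, starRingEnd ℂ (f x) * g x ∂(cellMeasure L)) := by
  have h := UnitAddTorus.hasSum_prod_mFourierCoeff (memLp_torusRep hL hf).toLp
    (memLp_torusRep hL hg).toLp
  have key : ∀ {g : E3 → ℂ} (hg : Continuous g) κ,
      UnitAddTorus.mFourierCoeff (memLp_torusRep hL hg).toLp κ = cellCoeff L g κ := by
    intro g hg κ
    rw [← mFourierCoeff_torusRep hL]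
    unfold UnitAddTorus.mFourierCoeff
    refine integral_congr_ae ?_
    filter_upwards [(memLp_torusRep hL hg).coeFn_toLp] with t ht
    rw [ht]
  have e : (fun κ => starRingEnd ℂ (cellCoeff L f κ) * cellCoeff L g κ) = fun κ =>
      starRingEnd ℂ (UnitAddTorus.mFourierCoeff (memLp_torusRep hL hf).toLp κ) *
        UnitAddTorus.mFourierCoeff (memLp_torusRep hL hg).toLp κ :=
    funext fun κ => by rw [key hf κ, key hg κ]
  rw [e]
  convert h using 1
  rw [← integral_torusRep hL]
  refine integral_congr_ae ?_
  filter_upwards [(memLp_torusRep hL hg).coeFn_toLp, (memLp_torusRep hL hf).coeFn_toLp] with t h1 h2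
  rw [h1, h2]

end

noncomputable section

/-! ### Smooth periodic functions -/

variable {F G : Type*} [NormedAddCommGroup F] [NormedSpace ℝ F]
  [NormedAddCommGroup G] [NormedSpace ℝ G]

/-- Smooth functions of period `L` in each coordinate, with values in any normed space. -/
structure SmoothPer (L : ℝ) (g : E3 → F) : Prop where
  smooth : ContDiff ℝ ((⊤ : ℕ∞) : WithTop ℕ∞) g
  periodic : ∀ (i : Fin 3) (x : E3), g (x + L • basisVec i) = g x

/-- The partial derivative `∂_i g` of a function with values in any normed space. -/
def pderiv (i : Fin 3) (g : E3 → F) (x : E3) : F := fderiv ℝ g x (basisVec i)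

theorem IsSolenoidal.smoothPer {L : ℝ} {v : E3 → E3} (h : IsSolenoidal L v) : SmoothPer L v :=
  ⟨h.smooth, h.periodic⟩

theorem SmoothPer.continuous {L : ℝ} {g : E3 → F} (h : SmoothPer L g) : Continuous g :=
  h.smooth.continuous

theorem SmoothPer.differentiable {L : ℝ} {g : E3 → F} (h : SmoothPer L g) :
    Differentiable ℝ g := h.smooth.differentiable (by simp)

theorem SmoothPer.pderiv {L : ℝ} {g : E3 → F} (h : SmoothPer L g) (i : Fin 3) :
    SmoothPer L (pderiv i g) := by
  constructor
  · exact (h.smooth.fderiv_right (m := ((⊤ : ℕ∞) : WithTop ℕ∞)) (by simp)).clm_apply contDiff_const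
  · intro j x
    unfold NavierStokes.pderiv
    rw [← fderiv_comp_add_right, funext (h.periodic j)]

theorem SmoothPer.clm_comp {L : ℝ} {g : E3 → F} (h : SmoothPer L g) (A : F →L[ℝ] G) :
    SmoothPer L (fun x => A (g x)) :=
  ⟨A.contDiff.comp h.smooth, fun i x => by rw [h.periodic]⟩

theorem pderiv_clm_comp {L : ℝ} {g : E3 → F} (h : SmoothPer L g) (A : F →L[ℝ] G) (i : Fin 3)
    (x : E3) : NavierStokes.pderiv i (fun x => A (g x)) x = A (NavierStokes.pderiv i g x) := by
  unfold NavierStokes.pderiv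
  change fderiv ℝ (A ∘ g) x _ = _
  rw [(A.hasFDerivAt.comp x (h.differentiable x).hasFDerivAt).fderiv]
  rfl

theorem SmoothPer.bilin {F' : Type*} [NormedAddCommGroup F'] [NormedSpace ℝ F'] {L : ℝ}
    {g : E3 → F} {h : E3 → F'} (hg : SmoothPer L g) (hh : SmoothPer L h)
    (A : F →L[ℝ] F' →L[ℝ] G) : SmoothPer L (fun x => A (g x) (h x)) :=
  ⟨(A.contDiff.comp hg.smooth).clm_apply hh.smooth, fun i x => by rw [hg.periodic, hh.periodic]⟩

theorem pderiv_bilin {F' : Type*} [NormedAddCommGroup F'] [NormedSpace ℝ F'] {L : ℝ}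
    {g : E3 → F} {h : E3 → F'} (hg : SmoothPer L g) (hh : SmoothPer L h)
    (A : F →L[ℝ] F' →L[ℝ] G) (i : Fin 3) (x : E3) :
    NavierStokes.pderiv i (fun x => A (g x) (h x)) x =
      A (NavierStokes.pderiv i g x) (h x) + A (g x) (NavierStokes.pderiv i h x) := by
  unfold NavierStokes.pderiv
  have := A.hasFDerivAt_of_bilinear (hg.differentiable x).hasFDerivAt
    (hh.differentiable x).hasFDerivAt
  rw [this.fderiv]
  simp [ContinuousLinearMap.precompR, ContinuousLinearMap.precompL, add_comm]

theorem SmoothPer.sum {ι : Type*} {L : ℝ} {g : ι → E3 → F} {s : Finset ι}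
    (hg : ∀ i ∈ s, SmoothPer L (g i)) : SmoothPer L (fun x => ∑ i ∈ s, g i x) :=
  ⟨ContDiff.sum fun i hi => (hg i hi).smooth,
    fun j x => Finset.sum_congr rfl fun i hi => (hg i hi).periodic j x⟩

theorem SmoothPer.const_smul {L : ℝ} {g : E3 → F} (hg : SmoothPer L g) (c : ℝ) :
    SmoothPer L (fun x => c • g x) :=
  ⟨hg.smooth.const_smul c, fun i x => by rw [hg.periodic]⟩

theorem pderiv_sum_smul {ι : Type*} {L : ℝ} {g : ι → E3 → F} {s : Finset ι} (c : ι → ℝ)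
    (hg : ∀ i ∈ s, SmoothPer L (g i)) (i : Fin 3) (x : E3) :
    NavierStokes.pderiv i (fun x => ∑ j ∈ s, c j • g j x) x =
      ∑ j ∈ s, c j • NavierStokes.pderiv i (g j) x := by
  unfold NavierStokes.pderiv
  have : HasFDerivAt (fun x => ∑ j ∈ s, c j • g j x) (∑ j ∈ s, c j • fderiv ℝ (g j) x) x :=
    HasFDerivAt.fun_sum fun j hj => ((hg j hj).differentiable x).hasFDerivAt.const_smul (c j)
  rw [this.fderiv]
  simp

theorem integrable_cell {F : Type*} [NormedAddCommGroup F] {L : ℝ} {g : E3 → F}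
    (hg : Continuous g) : Integrable g (cellMeasure L) :=
  hg.continuousOn.integrableOn_compact (isCompact_cell L)

/-- A partial derivative of a smooth periodic function has zero average: in the divergence theorem
on the cell the contributions of opposite faces cancel. -/
theorem integral_pderiv_eq_zero [CompleteSpace F] {L : ℝ} (hL : 0 < L) {g : E3 → F}
    (hg : SmoothPer L g) (i : Fin 3) : ∫ x, NavierStokes.pderiv i g x ∂(cellMeasure L) = 0 := by
  rw [setIntegral_cell]
  let A : (Fin 3 → ℝ) →L[ℝ] E3 := (EuclideanSpace.equiv (Fin 3) ℝ).symm.toContinuousLinearMap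
  have hA : ∀ y, WithLp.toLp 2 y = A y := fun y => rfl
  have hAs : ∀ j, A (Pi.single j 1) = basisVec j := fun j => by
    rw [← hA]; ext k; simp [basisVec, Pi.single_apply]
  have hd : ∀ y, HasFDerivAt (fun y => g (A y)) ((fderiv ℝ g (A y)).comp A) y := fun y =>
    (hg.differentiable (A y)).hasFDerivAt.comp y A.hasFDerivAt
  have hcont : Continuous fun y => g (A y) := hg.continuous.comp A.continuous
  have key := integral_divergence_of_hasFDerivAt_off_countable' (fun _ : Fin 3 => (0:ℝ))
    (fun _ => L) (fun _ => hL.le) (fun j y => if j = i then g (A y) else 0)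
    (fun j y => if j = i then (fderiv ℝ g (A y)).comp A else 0) ∅ countable_empty
    (fun j => by
      by_cases hj : j = i
      · simp only [hj, if_true]; exact hcont.continuousOn
      · simp only [hj, if_false]; exact continuousOn_const)
    (fun x _ j => by
      by_cases hj : j = i
      · simp only [hj, if_true]; exact hd x
      · simp only [hj, if_false]; exact hasFDerivAt_const _ _)
    (by
      refine ContinuousOn.integrableOn_compact isCompact_Icc (Continuous.continuousOn ?_)
      refine continuous_finsetSum _ fun j _ => ?_
      by_cases hj : j = i
      · simp only [hj, if_true]
        simp only [ContinuousLinearMap.comp_apply, hAs]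
        exact (hg.pderiv i).continuous.comp A.continuous
      · simp only [hj, if_false]; exact continuous_const)
  have hL1 : ∀ y : Fin 3 → ℝ, ∑ j, (if j = i then (fderiv ℝ g (A y)).comp A else 0)
      (Pi.single j 1) = NavierStokes.pderiv i g (WithLp.toLp 2 y) := by
    intro y
    rw [Finset.sum_eq_single i]
    · simp only [if_true, ContinuousLinearMap.comp_apply, hAs]; rfl
    · intro j _ hj; simp [hj]
    · simp
  simp only [hL1] at key
  rw [key]
  refine Finset.sum_eq_zero fun j _ => ?_
  by_cases hj : j = i
  · simp only [hj, if_true]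
    rw [sub_eq_zero]
    congr 1
    ext x
    subst hj
    rw [← hg.periodic j (A (j.insertNth 0 x))]
    congr 1
    ext k
    rcases Fin.eq_self_or_eq_succAbove j k with rfl | ⟨k', rfl⟩
    · simp [basisVec, ← hA]
    · simp [basisVec, ← hA]
  · simp [hj]

/-- Integration by parts for smooth periodic functions. -/
theorem integral_bilin_pderiv {F' : Type*} [NormedAddCommGroup F'] [NormedSpace ℝ F']
    [CompleteSpace G] {L : ℝ} (hL : 0 < L) {g : E3 → F} {h : E3 → F'} (hg : SmoothPer L g)
    (hh : SmoothPer L h) (A : F →L[ℝ] F' →L[ℝ] G) (i : Fin 3) :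
    ∫ x, A (g x) (NavierStokes.pderiv i h x) ∂(cellMeasure L) =
      -∫ x, A (NavierStokes.pderiv i g x) (h x) ∂(cellMeasure L) := by
  have h0 := integral_pderiv_eq_zero hL (hg.bilin hh A) i
  simp only [pderiv_bilin hg hh A i] at h0
  rw [integral_add (integrable_cell ((hg.pderiv i).bilin hh A).continuous)
    (integrable_cell (hg.bilin (hh.pderiv i) A).continuous)] at h0
  rw [eq_neg_iff_add_eq_zero, add_comm]
  exact h0

theorem laplacian_eq_sum_pderiv {L : ℝ} {g : E3 → F} (hg : SmoothPer L g) (x : E3) :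
    Laplacian.laplacian g x = ∑ i, NavierStokes.pderiv i (NavierStokes.pderiv i g) x := by
  rw [InnerProductSpace.laplacian_eq_iteratedFDeriv_orthonormalBasis g
    (EuclideanSpace.basisFun (Fin 3) ℝ)]
  refine Finset.sum_congr rfl fun i _ => ?_
  have hb : EuclideanSpace.basisFun (Fin 3) ℝ i = basisVec i := by
    simp [basisVec, EuclideanSpace.basisFun_apply]
  rw [iteratedFDeriv_two_apply, hb]
  simp only [Matrix.cons_val_zero, Matrix.cons_val_one]
  unfold NavierStokes.pderiv
  have hd : DifferentiableAt ℝ (fderiv ℝ g) x :=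
    (hg.smooth.fderiv_right (m := ((⊤ : ℕ∞) : WithTop ℕ∞)) (by simp)).differentiable (by simp) x
  rw [fderiv_clm_apply hd (differentiableAt_const _)]
  simp

theorem smoothPer_cellChar {L : ℝ} (hL : 0 < L) (κ : Fin 3 → ℤ) : SmoothPer L (cellChar L κ) := by
  have hL' : (L : ℂ) ≠ 0 := by exact_mod_cast hL.ne'
  constructor
  · unfold cellChar
    refine ContDiff.cexp (contDiff_const.mul (ContDiff.sum fun i _ => contDiff_const.mul ?_))
    exact Complex.ofRealCLM.contDiff.comp (EuclideanSpace.proj (𝕜 := ℝ) i).contDiff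
  · intro i x
    unfold cellChar
    have : -(2 * Real.pi * Complex.I / L) * ∑ j, (κ j : ℂ) * ((x + L • basisVec i) j : ℂ) =
        -(2 * Real.pi * Complex.I / L) * ∑ j, (κ j : ℂ) * (x j : ℂ) +
          ((-κ i : ℤ) : ℂ) * (2 * Real.pi * Complex.I) := by
      have h1 : ∑ j, (κ j : ℂ) * ((x + L • basisVec i) j : ℂ) =
          ∑ j, (κ j : ℂ) * (x j : ℂ) + L * κ i := by
        simp only [PiLp.add_apply, PiLp.smul_apply, basisVec, smul_eq_mul, Complex.ofReal_add,
          Complex.ofReal_mul, mul_add, Finset.sum_add_distrib, PiLp.single_apply]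
        congr 1
        rw [Finset.sum_eq_single i]
        · simp; ring
        · intro j _ hj; simp [hj]
        · simp
      rw [h1]
      push_cast
      field_simp
      ring
    rw [this, Complex.exp_add, Complex.exp_int_mul_two_pi_mul_I, mul_one]

theorem pderiv_cellChar {L : ℝ} (κ : Fin 3 → ℤ) (i : Fin 3) (x : E3) :
    NavierStokes.pderiv i (cellChar L κ) x =
      -(2 * Real.pi * Complex.I * κ i / L) * cellChar L κ x := by
  unfold NavierStokes.pderiv
  have h1 : ∀ j : Fin 3, HasFDerivAt (fun x : E3 => (κ j : ℂ) * (x j : ℂ))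
      ((κ j : ℂ) • (Complex.ofRealCLM.comp (EuclideanSpace.proj (𝕜 := ℝ) j))) x := fun j =>
    (Complex.ofRealCLM.comp (EuclideanSpace.proj (𝕜 := ℝ) j)).hasFDerivAt.const_mul _
  have h2 := ((HasFDerivAt.fun_sum (u := Finset.univ) fun j _ => h1 j).const_mul
    (-(2 * Real.pi * Complex.I / L))).cexp
  change fderiv ℝ (fun x => cellChar L κ x) x (basisVec i) = _
  unfold cellChar
  have h3 : (∑ j : Fin 3, (κ j : ℂ) • (Complex.ofRealCLM.comp (EuclideanSpace.proj (𝕜 := ℝ) j)))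
      (basisVec i) = κ i := by
    simp [basisVec, PiLp.single_apply]
    rw [Finset.sum_eq_single i (fun j _ hj => by simp [hj]) (by simp)]
    simp
  rw [h2.fderiv, smul_apply, smul_apply, h3, smul_eq_mul, smul_eq_mul]
  ring

theorem cellCoeff_pderiv {L : ℝ} (hL : 0 < L) {g : E3 → ℂ} (hg : SmoothPer L g) (i : Fin 3)
    (κ : Fin 3 → ℤ) :
    cellCoeff L (NavierStokes.pderiv i g) κ =
      (2 * Real.pi * Complex.I * κ i / L) * cellCoeff L g κ := by
  have h := integral_bilin_pderiv hL (smoothPer_cellChar hL κ) hg (ContinuousLinearMap.mul ℝ ℂ) i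
  simp only [ContinuousLinearMap.mul_apply', pderiv_cellChar] at h
  unfold cellCoeff
  rw [h, mul_smul_comm, ← integral_const_mul, ← integral_neg]
  congr 2
  ext x
  ring

end

noncomputable section

/-! ### Products in terms of Fourier coefficients -/

/-- The modulus `|2πκ/L|` of the wave vector with index `κ`. -/
def waveNorm (L : ℝ) (κ : Fin 3 → ℤ) : ℝ :=
  2 * Real.pi / L * ‖(WithLp.toLp 2 fun i => (κ i : ℝ) : E3)‖

theorem waveNorm_nonneg {L : ℝ} (hL : 0 < L) (κ : Fin 3 → ℤ) : 0 ≤ waveNorm L κ := by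
  unfold waveNorm
  positivity

theorem toLp_intCast_eq_zero_iff (κ : Fin 3 → ℤ) :
    (WithLp.toLp 2 fun i => (κ i : ℝ) : E3) = 0 ↔ κ = 0 := by
  constructor
  · intro h
    ext i
    have := congrArg (fun x : E3 => x i) h
    simpa using this
  · rintro rfl
    ext i
    simp

theorem waveNorm_eq_zero_iff {L : ℝ} (hL : 0 < L) (κ : Fin 3 → ℤ) : waveNorm L κ = 0 ↔ κ = 0 := by
  have h : 2 * Real.pi / L ≠ 0 := by positivity
  rw [waveNorm, mul_eq_zero_iff_left h, norm_eq_zero, toLp_intCast_eq_zero_iff]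

theorem waveNorm_sub_add_le {L : ℝ} (hL : 0 < L) (p q : Fin 3 → ℤ) :
    waveNorm L p ≤ waveNorm L (p - q) + waveNorm L q := by
  unfold waveNorm
  rw [← mul_add]
  refine mul_le_mul_of_nonneg_left ?_ (by positivity)
  refine le_trans (le_of_eq ?_) (norm_add_le _ _)
  congr 1
  ext i
  simp

theorem waveNorm_sq (L : ℝ) (κ : Fin 3 → ℤ) :
    waveNorm L κ ^ 2 = ∑ i, (2 * Real.pi * κ i / L) ^ 2 := by
  rw [waveNorm, mul_pow, EuclideanSpace.norm_sq_eq, Finset.mul_sum]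
  refine Finset.sum_congr rfl fun i _ => ?_
  rw [Real.norm_eq_abs, sq_abs]
  ring

theorem summable_inv_norm_pow_four :
    Summable fun κ : Fin 3 → ℤ => ‖(WithLp.toLp 2 fun i => (κ i : ℝ) : E3)‖⁻¹ ^ 4 := by
  obtain ⟨b, hb⟩ : ∃ b : Module.Basis (Fin 3) ℝ E3, ∀ i, b i = EuclideanSpace.single i 1 :=
    ⟨(EuclideanSpace.basisFun (Fin 3) ℝ).toBasis, fun i => by simp [EuclideanSpace.basisFun_apply]⟩
  have hr : Module.finrank ℤ (Submodule.span ℤ (range b)) < 4 := by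
    rw [ZLattice.rank ℝ]
    simp
  have hs : Summable fun z : Submodule.span ℤ (range b) => ‖(z : E3)‖⁻¹ ^ 4 :=
    ZLattice.summable_norm_pow_inv (Submodule.span ℤ (range b)) 4 hr
  have hmem : ∀ κ : Fin 3 → ℤ, (WithLp.toLp 2 fun i => (κ i : ℝ) : E3) ∈
      Submodule.span ℤ (range b) := by
    intro κ
    have : (WithLp.toLp 2 fun i => (κ i : ℝ) : E3) = ∑ i, κ i • b i := by
      ext j
      simp [hb, Pi.single_apply]
    rw [this]
    exact Submodule.sum_mem _ fun i _ => Submodule.smul_mem _ _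
      (Submodule.subset_span (mem_range_self i))
  have hinj : Function.Injective fun κ : Fin 3 → ℤ =>
      (⟨_, hmem κ⟩ : Submodule.span ℤ (range b)) := fun κ κ' h => by
    have h2 : (WithLp.toLp 2 fun i => (κ i : ℝ) : E3) = WithLp.toLp 2 fun i => (κ' i : ℝ) :=
      congrArg Subtype.val h
    ext i
    have := congrArg (fun x : E3 => x i) h2
    simpa using this
  have h4 := hs.comp_injective hinj
  exact h4

/-- The weight `|2πκ/L|` with values in `[0, ∞]`. -/
def waveWeight (L : ℝ) (κ : Fin 3 → ℤ) : ℝ≥0∞ := ENNReal.ofReal (waveNorm L κ)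

theorem waveWeight_ne_top (L : ℝ) (κ : Fin 3 → ℤ) : waveWeight L κ ≠ ∞ := ENNReal.ofReal_ne_top

theorem waveWeight_zero {L : ℝ} (hL : 0 < L) : waveWeight L 0 = 0 := by
  rw [waveWeight, (waveNorm_eq_zero_iff hL 0).2 rfl, ENNReal.ofReal_zero]

theorem waveWeight_ne_zero {L : ℝ} (hL : 0 < L) : ∀ κ ≠ 0, waveWeight L κ ≠ 0 := by
  intro κ hκ h
  rw [waveWeight, ENNReal.ofReal_eq_zero] at h
  exact hκ ((waveNorm_eq_zero_iff hL κ).1 (le_antisymm h (waveNorm_nonneg hL κ)))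

theorem waveWeight_sub_add_le {L : ℝ} (hL : 0 < L) (p q : Fin 3 → ℤ) :
    waveWeight L p ≤ waveWeight L (p - q) + waveWeight L q := by
  unfold waveWeight
  rw [← ENNReal.ofReal_add (waveNorm_nonneg hL _) (waveNorm_nonneg hL _)]
  exact ENNReal.ofReal_le_ofReal (waveNorm_sub_add_le hL p q)

theorem tsum_invWeight_ne_top {L : ℝ} (hL : 0 < L) :
    ∑' κ, invWeight (waveWeight L) κ ^ 4 ≠ ∞ := by
  have hs := summable_inv_norm_pow_four.mul_left ((2 * Real.pi / L)⁻¹ ^ 4)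
  refine ne_top_of_le_ne_top hs.tsum_ofReal_ne_top (ENNReal.tsum_le_tsum fun κ => ?_)
  unfold invWeight
  split_ifs with h
  · simp
  · have hpos : 0 < waveNorm L κ :=
      lt_of_le_of_ne (waveNorm_nonneg hL κ) fun h' => h ((waveNorm_eq_zero_iff hL κ).1 h'.symm)
    rw [waveWeight, ← ENNReal.ofReal_inv_of_pos hpos, ← ENNReal.ofReal_pow (by positivity)]
    refine le_of_eq (congrArg _ ?_)
    rw [waveNorm, mul_inv, mul_pow]

theorem cellChar_sub {L : ℝ} (κ q : Fin 3 → ℤ) (x : E3) :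
    cellChar L (κ - q) x = starRingEnd ℂ (cellChar L q x) * cellChar L κ x := by
  unfold cellChar
  rw [← Complex.exp_conj, ← Complex.exp_add]
  congr 1
  simp only [map_mul, map_neg, map_div₀, map_sum, Complex.conj_I, Complex.conj_ofReal,
    Pi.sub_apply, Int.cast_sub, sub_mul, Finset.sum_sub_distrib, map_intCast, map_ofNat]
  ring

/-- The Fourier coefficients of a product are dominated by the convolution of the moduli of the
Fourier coefficients of the factors. -/
theorem enorm_cellCoeff_mul_le {L : ℝ} (hL : 0 < L) {f g : E3 → ℂ} (hf : Continuous f)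
    (hg : Continuous g) (κ : Fin 3 → ℤ) :
    ‖cellCoeff L (fun x => f x * g x) κ‖ₑ ≤
      conv (fun p => ‖cellCoeff L f p‖ₑ) (fun p => ‖cellCoeff L g p‖ₑ) κ := by
  have hf' : Continuous fun x => starRingEnd ℂ (cellChar L κ x * f x) :=
    Complex.continuous_conj.comp ((continuous_cellChar L κ).mul hf)
  have h := hasSum_conj_cellCoeff_mul hL hf' hg
  have e1 : ∀ q, starRingEnd ℂ (cellCoeff L (fun x => starRingEnd ℂ (cellChar L κ x * f x)) q) =
      cellCoeff L f (κ - q) := by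
    intro q
    unfold cellCoeff
    rw [Complex.real_smul, map_mul, Complex.conj_ofReal, ← integral_conj, Complex.real_smul]
    congr 2
    ext x
    rw [map_mul, Complex.conj_conj, cellChar_sub]
    ring
  have e2 : (L ^ 3 : ℝ)⁻¹ • ∫ x, starRingEnd ℂ (starRingEnd ℂ (cellChar L κ x * f x)) * g x
      ∂(cellMeasure L) = cellCoeff L (fun x => f x * g x) κ := by
    unfold cellCoeff
    congr 2
    ext x
    rw [Complex.conj_conj, mul_assoc]
  rw [e2] at h
  simp only [e1] at h
  rw [← h.tsum_eq]
  refine enorm_tsum_le_tsum_enorm.trans (le_of_eq ?_)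
  unfold conv
  exact tsum_congr fun q => enorm_mul _ _

end

noncomputable section

/-! ### Fourier coefficients of vector fields and of the Stokes eigenfunctions -/

/-- The `l`-th coordinate of a vector, as a complex number. -/
def coordC (l : Fin 3) : E3 →L[ℝ] ℂ := Complex.ofRealCLM.comp (EuclideanSpace.proj (𝕜 := ℝ) l)

theorem coordC_apply (l : Fin 3) (x : E3) : coordC l x = (x l : ℂ) := rfl

/-- The Fourier coefficient with index `κ` of the `l`-th coordinate of a vector field. -/
def fieldCoeff (L : ℝ) (v : E3 → E3) (l : Fin 3) (κ : Fin 3 → ℤ) : ℂ :=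
  cellCoeff L (fun x => coordC l (v x)) κ

/-- The square of the `k`-th Sobolev norm in terms of Fourier coefficients. -/
def fourierEnergy (L : ℝ) (k : ℕ) (v : E3 → E3) : ℝ≥0∞ :=
  ∑ l, ∑' κ, (waveWeight L κ ^ k * ‖fieldCoeff L v l κ‖ₑ) ^ 2

theorem tsum_coord_prod (f : Fin 3 → (Fin 3 → ℤ) → ℝ≥0∞) :
    ∑' p : Fin 3 × (Fin 3 → ℤ), f p.1 p.2 = ∑ l, ∑' κ, f l κ := by
  rw [ENNReal.tsum_prod, tsum_fintype]

theorem inner_eq_sum_coord (x y : E3) : inner ℝ x y = ∑ l, x l * y l := by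
  rw [PiLp.inner_apply]
  exact Finset.sum_congr rfl fun l _ => by simp [mul_comm]

theorem pairing_comm {L : ℝ} (u v : E3 → E3) : pairing L u v = pairing L v u := by
  unfold pairing
  simp only [real_inner_comm]

theorem pairing_eq_sum {L : ℝ} {v u : E3 → E3} (hv : Continuous v) (hu : Continuous u) :
    ((pairing L v u : ℝ) : ℂ) =
      ∑ l, ∫ x, starRingEnd ℂ (coordC l (v x)) * coordC l (u x) ∂(cellMeasure L) := by
  have h1 : ∀ l : Fin 3, Continuous fun x => starRingEnd ℂ (coordC l (v x)) * coordC l (u x) :=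
    fun l => (Complex.continuous_conj.comp ((coordC l).continuous.comp hv)).mul
      ((coordC l).continuous.comp hu)
  rw [← integral_finsetSum _ fun l _ => integrable_cell (h1 l), pairing, ← integral_complex_ofReal]
  congr 1
  ext x
  rw [inner_eq_sum_coord]
  simp [coordC_apply]

theorem fieldCoeff_sum_smul {ι : Type*} {L : ℝ} {s : Finset ι} {v : ι → E3 → E3}
    (hv : ∀ j ∈ s, Continuous (v j)) (c : ι → ℝ) (l : Fin 3) (κ : Fin 3 → ℤ) :
    fieldCoeff L (fun x => ∑ j ∈ s, c j • v j x) l κ =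
      ∑ j ∈ s, (c j : ℂ) * fieldCoeff L (v j) l κ := by
  unfold fieldCoeff cellCoeff
  have : ∀ x, cellChar L κ x * coordC l (∑ j ∈ s, c j • v j x) =
      ∑ j ∈ s, (c j : ℂ) * (cellChar L κ x * coordC l (v j x)) := by
    intro x
    rw [map_sum, Finset.mul_sum]
    refine Finset.sum_congr rfl fun j _ => ?_
    rw [map_smul, Complex.real_smul]
    ring
  simp only [this]
  rw [integral_finsetSum]
  · rw [Finset.smul_sum]
    refine Finset.sum_congr rfl fun j _ => ?_
    rw [integral_const_mul, mul_smul_comm]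
  · intro j hj
    exact (integrable_cell ((continuous_cellChar L κ).mul
      ((coordC l).continuous.comp (hv j hj)))).const_mul _

theorem fieldCoeff_pderiv {L : ℝ} (hL : 0 < L) {v : E3 → E3} (hv : SmoothPer L v) (i l : Fin 3)
    (κ : Fin 3 → ℤ) : fieldCoeff L (pderiv i v) l κ =
      (2 * Real.pi * Complex.I * κ i / L) * fieldCoeff L v l κ := by
  unfold fieldCoeff
  rw [← cellCoeff_pderiv hL (hv.clm_comp (coordC l))]
  congr 1
  ext x
  rw [pderiv_clm_comp hv]

theorem fieldCoeff_laplacian {L : ℝ} (hL : 0 < L) {v : E3 → E3} (hv : SmoothPer L v) (l : Fin 3)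
    (κ : Fin 3 → ℤ) : fieldCoeff L (Laplacian.laplacian v) l κ =
      -((waveNorm L κ ^ 2 : ℝ) : ℂ) * fieldCoeff L v l κ := by
  have h1 : Laplacian.laplacian v = fun x => ∑ i, (1:ℝ) • pderiv i (pderiv i v) x := by
    ext1 x
    rw [laplacian_eq_sum_pderiv hv]
    simp
  rw [h1, fieldCoeff_sum_smul fun i _ => ((hv.pderiv i).pderiv i).continuous, waveNorm_sq]
  push_cast
  rw [← Finset.sum_neg_distrib, Finset.sum_mul]
  refine Finset.sum_congr rfl fun i _ => ?_
  rw [fieldCoeff_pderiv hL (hv.pderiv i), fieldCoeff_pderiv hL hv]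
  linear_combination (2 * (Real.pi:ℂ) * κ i / L) ^ 2 * fieldCoeff L v l κ * Complex.I_sq

namespace StokesBasis

variable {L : ℝ} (S : StokesBasis L)

theorem smoothPer (j : ℕ) : SmoothPer L (S.w j) := (S.solenoidal j).smoothPer

/-- The linear combination of the first `n` eigenfunctions with coefficients `x`. -/
def combo (n : ℕ) (x : ℕ → ℝ) (y : E3) : E3 := ∑ j ∈ Finset.range n, x j • S.w j y

theorem smoothPer_combo (n : ℕ) (x : ℕ → ℝ) : SmoothPer L (S.combo n x) :=
  SmoothPer.sum fun j _ => (S.smoothPer j).const_smul (x j)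

theorem fieldCoeff_combo (n : ℕ) (x : ℕ → ℝ) (l : Fin 3) (κ : Fin 3 → ℤ) :
    fieldCoeff L (S.combo n x) l κ =
      ∑ j ∈ Finset.range n, (x j : ℂ) * fieldCoeff L (S.w j) l κ :=
  fieldCoeff_sum_smul (fun j _ => (S.smoothPer j).continuous) x l κ

theorem fieldCoeff_zero (j : ℕ) (l : Fin 3) : fieldCoeff L (S.w j) l 0 = 0 := by
  unfold fieldCoeff cellCoeff
  have h : ∀ x, cellChar L 0 x = 1 := fun x => by simp [cellChar]
  simp only [h, one_mul]
  rw [(coordC l).integral_comp_comm (integrable_cell (S.smoothPer j).continuous),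
    (S.solenoidal j).zero_mean, map_zero, smul_zero]

theorem waveNorm_sq_mul_fieldCoeff (hL : 0 < L) (j : ℕ) (l : Fin 3) (κ : Fin 3 → ℤ) :
    ((waveNorm L κ ^ 2 : ℝ) : ℂ) * fieldCoeff L (S.w j) l κ =
      S.ev j * fieldCoeff L (S.w j) l κ := by
  have h1 := fieldCoeff_laplacian hL (S.smoothPer j) l κ
  have h2 : Laplacian.laplacian (S.w j) =
      fun x => ∑ _i ∈ ({()} : Finset Unit), (-S.ev j) • S.w j x := by
    ext1 x
    rw [Finset.sum_singleton, neg_smul, ← S.eigen j x, neg_neg]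
  rw [h2, fieldCoeff_sum_smul (v := fun _ => S.w j) (fun _ _ => (S.smoothPer j).continuous),
    Finset.sum_singleton] at h1
  push_cast at h1 ⊢
  linear_combination h1

theorem waveNorm_pow_mul_fieldCoeff (hL : 0 < L) (k j : ℕ) (l : Fin 3) (κ : Fin 3 → ℤ) :
    (((waveNorm L κ ^ k) ^ 2 : ℝ) : ℂ) * fieldCoeff L (S.w j) l κ =
      ((S.ev j ^ k : ℝ) : ℂ) * fieldCoeff L (S.w j) l κ := by
  induction k with
  | zero => simp
  | succ k ih =>
    have h := S.waveNorm_sq_mul_fieldCoeff hL j l κ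
    push_cast at ih h ⊢
    calc _ = (waveNorm L κ : ℂ) ^ 2 * (((waveNorm L κ : ℂ) ^ k) ^ 2 * fieldCoeff L (S.w j) l κ) := by
          ring
      _ = (S.ev j : ℂ) ^ k * ((waveNorm L κ : ℂ) ^ 2 * fieldCoeff L (S.w j) l κ) := by rw [ih]; ring
      _ = _ := by rw [h]; ring

theorem waveNorm_pow_mul_fieldCoeff_combo (hL : 0 < L) (k n : ℕ) (x : ℕ → ℝ) (l : Fin 3)
    (κ : Fin 3 → ℤ) :
    (((waveNorm L κ ^ k) ^ 2 : ℝ) : ℂ) * fieldCoeff L (S.combo n x) l κ =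
      fieldCoeff L (S.combo n fun j => S.ev j ^ k * x j) l κ := by
  rw [fieldCoeff_combo, fieldCoeff_combo, Finset.mul_sum]
  refine Finset.sum_congr rfl fun j _ => ?_
  rw [mul_left_comm, S.waveNorm_pow_mul_fieldCoeff hL]
  push_cast
  ring

theorem pairing_combo {g : E3 → E3} (hg : Continuous g) (n : ℕ) (x : ℕ → ℝ) :
    pairing L g (S.combo n x) = ∑ j ∈ Finset.range n, x j * pairing L g (S.w j) := by
  unfold pairing combo
  simp only [inner_sum, inner_smul_right]
  rw [integral_finsetSum]
  · exact Finset.sum_congr rfl fun j _ => integral_const_mul _ _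
  · intro j _
    exact (integrable_cell (hg.inner (S.smoothPer j).continuous)).const_mul _

theorem pairing_combo_w (n : ℕ) (x : ℕ → ℝ) {j : ℕ} (hj : j ∈ Finset.range n) :
    pairing L (S.combo n x) (S.w j) = x j := by
  rw [pairing_comm, S.pairing_combo (S.smoothPer j).continuous]
  rw [Finset.sum_eq_single j]
  · simp [S.orthonormal]
  · intro i _ hi
    simp [S.orthonormal, hi.symm]
  · exact fun h => absurd hj h

theorem pairing_combo_combo (n : ℕ) (x y : ℕ → ℝ) :
    pairing L (S.combo n x) (S.combo n y) = ∑ j ∈ Finset.range n, y j * x j := by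
  rw [S.pairing_combo (S.smoothPer_combo n x).continuous]
  exact Finset.sum_congr rfl fun j hj => by rw [S.pairing_combo_w n x hj]

end StokesBasis

/-- The Parseval identity for one coordinate of two vector fields. -/
theorem hasSum_conj_fieldCoeff_mul {L : ℝ} (hL : 0 < L) {v u : E3 → E3} (hv : Continuous v)
    (hu : Continuous u) (l : Fin 3) :
    HasSum (fun κ => starRingEnd ℂ (fieldCoeff L v l κ) * fieldCoeff L u l κ)
      ((L ^ 3 : ℝ)⁻¹ • ∫ x, starRingEnd ℂ (coordC l (v x)) * coordC l (u x) ∂(cellMeasure L)) :=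
  hasSum_conj_cellCoeff_mul hL ((coordC l).continuous.comp hv) ((coordC l).continuous.comp hu)

namespace StokesBasis

variable {L : ℝ} (S : StokesBasis L)

theorem ev_pos (hL : 0 < L) (j : ℕ) : 0 < S.ev j := by
  have hc := (S.smoothPer j).continuous
  -- Some Fourier coefficient of `w j` does not vanish, and the one of index `0` does.
  obtain ⟨l, κ, hne⟩ : ∃ l κ, fieldCoeff L (S.w j) l κ ≠ 0 := by
    by_contra! h0
    have h1 := pairing_eq_sum hc hc (L := L)
    rw [S.orthonormal, if_pos rfl] at h1
    have h2 : ∀ l, ∫ x, starRingEnd ℂ (coordC l (S.w j x)) * coordC l (S.w j x)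
        ∂(cellMeasure L) = 0 := by
      intro l
      have h3 := hasSum_conj_fieldCoeff_mul hL hc hc l
      simp only [h0, mul_zero] at h3
      have h4 := h3.unique hasSum_zero
      exact (smul_eq_zero.1 h4).resolve_left (by positivity)
    simp [h2] at h1
  have hκ : κ ≠ 0 := by
    rintro rfl
    exact hne (S.fieldCoeff_zero j l)
  have h := mul_right_cancel₀ hne (S.waveNorm_sq_mul_fieldCoeff hL j l κ)
  have h' : waveNorm L κ ^ 2 = S.ev j := by exact_mod_cast h
  rw [← h']
  have := (waveNorm_eq_zero_iff hL κ).not.2 hκ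
  positivity

/-- On finite combinations of eigenfunctions the Sobolev norms are given by the eigenvalues. -/
theorem fourierEnergy_combo (hL : 0 < L) (k n : ℕ) (x : ℕ → ℝ) :
    fourierEnergy L k (S.combo n x) =
      ENNReal.ofReal ((L ^ 3)⁻¹ * ∑ j ∈ Finset.range n, S.ev j ^ k * x j ^ 2) := by
  have hc := (S.smoothPer_combo n x).continuous
  have hc' := (S.smoothPer_combo n fun j => S.ev j ^ k * x j).continuous
  obtain ⟨r, hr⟩ : ∃ r : Fin 3 → ℂ, r = fun l => (L ^ 3 : ℝ)⁻¹ • ∫ y,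
    starRingEnd ℂ (coordC l (S.combo n x y)) *
      coordC l (S.combo n (fun j => S.ev j ^ k * x j) y) ∂(cellMeasure L) := ⟨_, rfl⟩
  have h1 : ∀ l, HasSum (fun κ => (waveNorm L κ ^ k * ‖fieldCoeff L (S.combo n x) l κ‖) ^ 2)
      (r l).re := by
    intro l
    have h := Complex.hasSum_re (hasSum_conj_fieldCoeff_mul hL hc hc' l)
    rw [hr]
    convert h using 1
    ext κ
    rw [← S.waveNorm_pow_mul_fieldCoeff_combo hL, mul_left_comm, Complex.conj_mul', mul_pow]
    norm_cast
  have h2 : ∑ l, (r l).re = (L ^ 3)⁻¹ * ∑ j ∈ Finset.range n, S.ev j ^ k * x j ^ 2 := by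
    have h := pairing_eq_sum hc hc' (L := L)
    rw [S.pairing_combo_combo] at h
    rw [← Complex.re_sum, hr, ← Finset.smul_sum, ← h, Complex.real_smul, Complex.re_ofReal_mul,
      Complex.ofReal_re]
    congr 1
    exact Finset.sum_congr rfl fun j _ => by ring
  rw [← h2, ENNReal.ofReal_sum_of_nonneg fun l _ => (h1 l).nonneg fun κ => by positivity]
  unfold fourierEnergy
  refine Finset.sum_congr rfl fun l _ => ?_
  rw [← (h1 l).tsum_eq, ENNReal.ofReal_tsum_of_nonneg (fun κ => by positivity) (h1 l).summable]
  refine tsum_congr fun κ => ?_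
  have h0 := waveNorm_nonneg hL κ
  rw [ENNReal.ofReal_pow (by positivity), ENNReal.ofReal_mul (by positivity),
    ENNReal.ofReal_pow h0, ofReal_norm]
  rfl

/-- The eigenfunction coefficients of a field are controlled by its Sobolev norms, although the
field need not be divergence free: pair it with `∑ λ_j^k (g, w_j) w_j`. -/
theorem ofReal_sum_le_fourierEnergy (hL : 0 < L) (k n : ℕ) {g : E3 → E3} (hg : Continuous g) :
    ENNReal.ofReal ((L ^ 3)⁻¹ * ∑ j ∈ Finset.range n, S.ev j ^ k * pairing L g (S.w j) ^ 2) ≤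
      fourierEnergy L k g := by
  obtain ⟨d, hd⟩ : ∃ d : ℕ → ℝ, d = fun j => pairing L g (S.w j) := ⟨_, rfl⟩
  obtain ⟨X, hX⟩ : ∃ X : ℝ, X = (L ^ 3)⁻¹ * ∑ j ∈ Finset.range n, S.ev j ^ k * d j ^ 2 := ⟨_, rfl⟩
  have hX0 : 0 ≤ X := by
    rw [hX]
    exact mul_nonneg (by positivity) (Finset.sum_nonneg fun j _ =>
      mul_nonneg (pow_nonneg (S.ev_pos hL j).le _) (sq_nonneg _))
  have hc' := (S.smoothPer_combo n fun j => S.ev j ^ k * d j).continuous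
  have hXc : (X : ℂ) = ∑ l, ∑' κ, starRingEnd ℂ (fieldCoeff L g l κ) *
      fieldCoeff L (S.combo n fun j => S.ev j ^ k * d j) l κ := by
    have h := pairing_eq_sum hg hc' (L := L)
    rw [S.pairing_combo hg] at h
    simp only [(hasSum_conj_fieldCoeff_mul hL hg hc' _).tsum_eq]
    rw [← Finset.smul_sum, ← h, hX, Complex.real_smul]
    push_cast
    congr 1
    refine Finset.sum_congr rfl fun j _ => ?_
    rw [hd]
    ring
  have hXe : ENNReal.ofReal X ≤ ∑' p : Fin 3 × (Fin 3 → ℤ),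
      (waveWeight L p.2 ^ k * ‖fieldCoeff L g p.1 p.2‖ₑ) *
        (waveWeight L p.2 ^ k * ‖fieldCoeff L (S.combo n d) p.1 p.2‖ₑ) := by
    have h1 : ENNReal.ofReal X = ‖(X : ℂ)‖ₑ := by
      rw [← ofReal_norm, Complex.norm_real, Real.norm_of_nonneg hX0]
    rw [h1, hXc, tsum_coord_prod fun l κ => (waveWeight L κ ^ k * ‖fieldCoeff L g l κ‖ₑ) *
        (waveWeight L κ ^ k * ‖fieldCoeff L (S.combo n d) l κ‖ₑ)]
    refine (enorm_sum_le _ _).trans (Finset.sum_le_sum fun l _ => ?_)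
    refine enorm_tsum_le_tsum_enorm.trans (le_of_eq (tsum_congr fun κ => ?_))
    have h0 := waveNorm_nonneg hL κ
    rw [← S.waveNorm_pow_mul_fieldCoeff_combo hL, enorm_mul, enorm_mul, RCLike.enorm_conj]
    have h2 : ‖(((waveNorm L κ ^ k) ^ 2 : ℝ) : ℂ)‖ₑ = waveWeight L κ ^ k * waveWeight L κ ^ k := by
      rw [← ofReal_norm, Complex.norm_real, Real.norm_of_nonneg (by positivity),
        ENNReal.ofReal_pow (by positivity), ENNReal.ofReal_pow h0, sq]
      rfl
    rw [h2]
    ring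
  have hsq : ENNReal.ofReal X ^ 2 ≤ fourierEnergy L k g * ENNReal.ofReal X := by
    refine (pow_le_pow_left' hXe 2).trans ((tsum_mul_sq_le _ _).trans (le_of_eq ?_))
    rw [hX, ← S.fourierEnergy_combo hL,
      tsum_coord_prod fun l κ => (waveWeight L κ ^ k * ‖fieldCoeff L g l κ‖ₑ) ^ 2,
      tsum_coord_prod fun l κ => (waveWeight L κ ^ k * ‖fieldCoeff L (S.combo n d) l κ‖ₑ) ^ 2]
    rfl
  have hX' : (L ^ 3)⁻¹ * ∑ j ∈ Finset.range n, S.ev j ^ k * pairing L g (S.w j) ^ 2 = X := by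
    rw [hX, hd]
  rw [hX']
  rcases eq_or_ne (ENNReal.ofReal X) 0 with h | h
  · rw [h]
    exact zero_le
  · rw [sq] at hsq
    exact (ENNReal.mul_le_mul_iff_left h ENNReal.ofReal_ne_top).1 hsq

end StokesBasis

end

noncomputable section

/-! ### Sobolev estimates for the convective term -/

/-- The convective term `(a · ∇) b` of smooth fields. -/
def convField (a b : E3 → E3) (x : E3) : E3 := ∑ i, a x i • pderiv i b x

theorem smoothPer_convField {L : ℝ} {a b : E3 → E3} (ha : SmoothPer L a) (hb : SmoothPer L b) :
    SmoothPer L (convField a b) := by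
  refine SmoothPer.sum fun i _ => ?_
  exact (ha.clm_comp (EuclideanSpace.proj (𝕜 := ℝ) i)).bilin (hb.pderiv i)
    (ContinuousLinearMap.lsmul ℝ ℝ)

theorem conv_sum_left {G : Type*} [AddCommGroup G] {ι : Type*} (s : Finset ι) (α : ι → G → ℝ≥0∞)
    (β : G → ℝ≥0∞) (κ : G) : ∑ i ∈ s, conv (α i) β κ = conv (fun p => ∑ i ∈ s, α i p) β κ := by
  unfold conv
  rw [← Summable.tsum_finsetSum fun i _ => ENNReal.summable]
  exact tsum_congr fun q => by rw [Finset.sum_mul]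

theorem conv_mono_right {G : Type*} [AddCommGroup G] (α : G → ℝ≥0∞) {β γ : G → ℝ≥0∞}
    (h : ∀ q, β q ≤ γ q) (κ : G) : conv α β κ ≤ conv α γ κ :=
  ENNReal.tsum_le_tsum fun q => mul_le_mul_right (h q) _

theorem enorm_fieldCoeff_pderiv_le {L : ℝ} (hL : 0 < L) {v : E3 → E3} (hv : SmoothPer L v)
    (i l : Fin 3) (κ : Fin 3 → ℤ) :
    ‖fieldCoeff L (pderiv i v) l κ‖ₑ ≤ waveWeight L κ * ‖fieldCoeff L v l κ‖ₑ := by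
  rw [fieldCoeff_pderiv hL hv, enorm_mul]
  refine mul_le_mul_left ?_ _
  rw [← ofReal_norm]
  refine ENNReal.ofReal_le_ofReal ?_
  refine abs_le_of_sq_le_sq' ?_ (waveNorm_nonneg hL κ) |>.2
  rw [waveNorm_sq]
  have h : ‖2 * (Real.pi:ℂ) * Complex.I * κ i / L‖ ^ 2 = (2 * Real.pi * κ i / L) ^ 2 := by
    have : 2 * (Real.pi:ℂ) * Complex.I * κ i / L =
        ((2 * Real.pi * κ i / L : ℝ) : ℂ) * Complex.I := by
      push_cast; ring
    rw [this, norm_mul, Complex.norm_I, mul_one, Complex.norm_real, Real.norm_eq_abs, sq_abs]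
  rw [h]
  exact Finset.single_le_sum (f := fun i => (2 * Real.pi * κ i / L) ^ 2)
    (fun j _ => sq_nonneg _) (Finset.mem_univ i)

/-- The moduli of the Fourier coefficients of a field, summed over the coordinates. -/
def coeffSum (L : ℝ) (a : E3 → E3) (κ : Fin 3 → ℤ) : ℝ≥0∞ := ∑ i, ‖fieldCoeff L a i κ‖ₑ

theorem enorm_fieldCoeff_convField_le {L : ℝ} (hL : 0 < L) {a b : E3 → E3} (ha : SmoothPer L a)
    (hb : SmoothPer L b) (l : Fin 3) (κ : Fin 3 → ℤ) :
    ‖fieldCoeff L (convField a b) l κ‖ₑ ≤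
      conv (coeffSum L a) (fun q => waveWeight L q * ‖fieldCoeff L b l q‖ₑ) κ := by
  have hc : ∀ i, Continuous fun x => coordC i (a x) * coordC l (pderiv i b x) := fun i =>
    ((coordC i).continuous.comp ha.continuous).mul
      ((coordC l).continuous.comp (hb.pderiv i).continuous)
  have h1 : fieldCoeff L (convField a b) l κ =
      ∑ i, cellCoeff L (fun x => coordC i (a x) * coordC l (pderiv i b x)) κ := by
    unfold fieldCoeff cellCoeff
    have hi : ∀ i ∈ Finset.univ, Integrable
        (fun x => cellChar L κ x * (coordC i (a x) * coordC l (pderiv i b x))) (cellMeasure L) :=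
      fun i _ => integrable_cell ((continuous_cellChar L κ).mul (hc i))
    rw [← Finset.smul_sum, ← integral_finsetSum _ hi]
    congr 2
    ext x
    rw [← Finset.mul_sum]
    congr 1
    change coordC l (∑ i, a x i • pderiv i b x) = _
    rw [map_sum]
    refine Finset.sum_congr rfl fun i _ => ?_
    rw [map_smul, Complex.real_smul, coordC_apply]
    rfl
  rw [h1]
  refine (enorm_sum_le _ _).trans ?_
  unfold coeffSum
  rw [← conv_sum_left]
  refine Finset.sum_le_sum fun i _ => ?_
  refine (enorm_cellCoeff_mul_le hL ((coordC i).continuous.comp ha.continuous)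
    ((coordC l).continuous.comp (hb.pderiv i).continuous) κ).trans ?_
  exact conv_mono_right _ (fun q => enorm_fieldCoeff_pderiv_le hL hb i l q) κ

theorem sq_sum_le_three (f : Fin 3 → ℝ≥0∞) : (∑ i, f i) ^ 2 ≤ 3 * ∑ i, f i ^ 2 := by
  have h := tsum_mul_sq_le (fun _ : Fin 3 => (1 : ℝ≥0∞)) f
  simp only [tsum_fintype, one_mul, one_pow] at h
  simpa using h

theorem tsum_coeffSum_le (L : ℝ) (k : ℕ) (a : E3 → E3) :
    ∑' κ, (waveWeight L κ ^ k * coeffSum L a κ) ^ 2 ≤ 3 * fourierEnergy L k a := by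
  unfold fourierEnergy coeffSum
  rw [← Summable.tsum_finsetSum fun i _ => ENNReal.summable, ← ENNReal.tsum_mul_left]
  refine ENNReal.tsum_le_tsum fun κ => ?_
  rw [Finset.mul_sum]
  exact sq_sum_le_three _

theorem fourierEnergy_convField_one_two {L : ℝ} (hL : 0 < L) {a b : E3 → E3} (ha : SmoothPer L a)
    (hb : SmoothPer L b) (ha0 : ∀ l, fieldCoeff L a l 0 = 0) :
    fourierEnergy L 0 (convField a b) ≤ (∑' p, invWeight (waveWeight L) p ^ 4) *
      (3 * fourierEnergy L 1 a * fourierEnergy L 2 b) := by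
  have hα : coeffSum L a 0 = 0 := by simp [coeffSum, ha0]
  conv_rhs => rw [fourierEnergy.eq_def L 2, Finset.mul_sum, Finset.mul_sum]
  rw [fourierEnergy.eq_def L 0]
  refine Finset.sum_le_sum fun l _ => ?_
  refine (ENNReal.tsum_le_tsum fun κ => ?_).trans ((tsum_conv_sq_le_one_one (waveWeight_ne_zero hL)
    (waveWeight_ne_top L) (α := coeffSum L a)
    (β := fun q => waveWeight L q * ‖fieldCoeff L b l q‖ₑ) hα ?_).trans ?_)
  · rw [pow_zero, one_mul]
    exact pow_le_pow_left' (enorm_fieldCoeff_convField_le hL ha hb l κ) 2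
  · rw [waveWeight_zero hL, zero_mul]
  · refine mul_le_mul_right (mul_le_mul' ?_ (le_of_eq ?_)) _
    · simpa only [pow_one] using tsum_coeffSum_le L 1 a
    · refine tsum_congr fun κ => ?_
      rw [← mul_assoc, ← sq]

theorem fourierEnergy_convField_two_one {L : ℝ} (hL : 0 < L) {a b : E3 → E3} (ha : SmoothPer L a)
    (hb : SmoothPer L b) (ha0 : ∀ l, fieldCoeff L a l 0 = 0) :
    fourierEnergy L 0 (convField a b) ≤ (∑' p, invWeight (waveWeight L) p ^ 4) *
      (3 * fourierEnergy L 2 a * fourierEnergy L 1 b) := by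
  have hα : coeffSum L a 0 = 0 := by simp [coeffSum, ha0]
  conv_rhs => rw [fourierEnergy.eq_def L 1, Finset.mul_sum, Finset.mul_sum]
  rw [fourierEnergy.eq_def L 0]
  refine Finset.sum_le_sum fun l _ => ?_
  refine (ENNReal.tsum_le_tsum fun κ => ?_).trans ((tsum_conv_sq_le_two_zero (waveWeight_ne_zero hL)
    (waveWeight_ne_top L) (α := coeffSum L a)
    (β := fun q => waveWeight L q * ‖fieldCoeff L b l q‖ₑ) hα).trans ?_)
  · rw [pow_zero, one_mul]
    exact pow_le_pow_left' (enorm_fieldCoeff_convField_le hL ha hb l κ) 2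
  · refine mul_le_mul_right (mul_le_mul' (tsum_coeffSum_le L 2 a) (le_of_eq ?_)) _
    refine tsum_congr fun κ => ?_
    rw [pow_one]

theorem fourierEnergy_convField_le {L : ℝ} (hL : 0 < L) (k : ℕ) {a b : E3 → E3}
    (ha : SmoothPer L a) (hb : SmoothPer L b) (ha0 : ∀ l, fieldCoeff L a l 0 = 0) :
    fourierEnergy L k (convField a b) ≤
      4 * 4 ^ k * (∑' p, invWeight (waveWeight L) p ^ 4) *
        (3 * fourierEnergy L (k + 1) a * fourierEnergy L 2 b +
          3 * fourierEnergy L 2 a * fourierEnergy L (k + 1) b) := by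
  have hα : coeffSum L a 0 = 0 := by simp [coeffSum, ha0]
  conv_rhs => rw [fourierEnergy.eq_def L 2 b, fourierEnergy.eq_def L (k + 1) b, Finset.mul_sum,
    Finset.mul_sum, ← Finset.sum_add_distrib, Finset.mul_sum]
  rw [fourierEnergy.eq_def L k]
  refine Finset.sum_le_sum fun l _ => ?_
  refine (ENNReal.tsum_le_tsum fun κ => ?_).trans ((tsum_weight_conv_sq_le (waveWeight_ne_zero hL)
    (waveWeight_ne_top L) (waveWeight_zero hL) (waveWeight_sub_add_le hL) (α := coeffSum L a)
    (β := fun q => ‖fieldCoeff L b l q‖ₑ) hα k).trans ?_)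
  · exact pow_le_pow_left' (mul_le_mul_right (enorm_fieldCoeff_convField_le hL ha hb l κ) _) 2
  · exact mul_le_mul_right (add_le_add (mul_le_mul_left (tsum_coeffSum_le L (k + 1) a) _)
      (mul_le_mul_left (tsum_coeffSum_le L 2 a) _)) _

namespace StokesBasis

variable {L : ℝ} (S : StokesBasis L)

theorem fourierEnergy_combo_eq_energy (hL : 0 < L) (k n : ℕ) (x : ℕ → ℝ) :
    fourierEnergy L k (S.combo n x) =
      ENNReal.ofReal (L ^ 3)⁻¹ * energy S.ev k (headSeq n x) := by
  rw [S.fourierEnergy_combo hL, energy_eq_sum (S.ev_pos hL) k n,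
    ENNReal.ofReal_mul (by positivity)]
  · congr 2
    refine Finset.sum_congr rfl fun j hj => ?_
    rw [headSeq, if_pos (Finset.mem_range.1 hj)]
  · intro j hj
    rw [headSeq, if_neg (not_lt.2 hj)]

theorem energy_pairing_le (hL : 0 < L) (k : ℕ) {g : E3 → E3} (hg : Continuous g) :
    energy S.ev k (fun j => pairing L g (S.w j)) ≤
      ENNReal.ofReal (L ^ 3) * fourierEnergy L k g := by
  refine ENNReal.tsum_le_of_sum_range_le fun n => ?_
  rw [← ENNReal.ofReal_sum_of_nonneg fun j _ =>
    mul_nonneg (pow_nonneg (S.ev_pos hL j).le _) (sq_nonneg _)]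
  have h := S.ofReal_sum_le_fourierEnergy hL k n hg
  refine le_trans (le_of_eq ?_) (mul_le_mul_right h _)
  rw [← ENNReal.ofReal_mul (by positivity), mul_inv_cancel_left₀ (by positivity)]

theorem fieldCoeff_combo_zero (n : ℕ) (x : ℕ → ℝ) (l : Fin 3) :
    fieldCoeff L (S.combo n x) l 0 = 0 := by
  rw [S.fieldCoeff_combo]
  exact Finset.sum_eq_zero fun j _ => by rw [S.fieldCoeff_zero, mul_zero]

theorem exists_energy_convField_one_two (hL : 0 < L) : ∃ C : ℝ≥0∞, C ≠ ∞ ∧ ∀ n x y,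
    energy S.ev 0 (fun j => pairing L (convField (S.combo n x) (S.combo n y)) (S.w j)) ≤
      C * (energy S.ev 1 (headSeq n x) * energy S.ev 2 (headSeq n y)) := by
  refine ⟨ENNReal.ofReal (L ^ 3) * ((∑' p, invWeight (waveWeight L) p ^ 4) *
    (3 * ENNReal.ofReal (L ^ 3)⁻¹ * ENNReal.ofReal (L ^ 3)⁻¹)), ?_, fun n x y => ?_⟩
  · exact ENNReal.mul_ne_top ENNReal.ofReal_ne_top (ENNReal.mul_ne_top (tsum_invWeight_ne_top hL)
      (ENNReal.mul_ne_top (ENNReal.mul_ne_top (by norm_num) ENNReal.ofReal_ne_top)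
        ENNReal.ofReal_ne_top))
  · have hx := S.smoothPer_combo n x
    have hy := S.smoothPer_combo n y
    refine (S.energy_pairing_le hL 0 (smoothPer_convField hx hy).continuous).trans ?_
    refine (mul_le_mul_right (fourierEnergy_convField_one_two hL hx hy
      (S.fieldCoeff_combo_zero n x)) _).trans (le_of_eq ?_)
    rw [S.fourierEnergy_combo_eq_energy hL, S.fourierEnergy_combo_eq_energy hL]
    ring

theorem exists_energy_convField_two_one (hL : 0 < L) : ∃ C : ℝ≥0∞, C ≠ ∞ ∧ ∀ n x y,
    energy S.ev 0 (fun j => pairing L (convField (S.combo n x) (S.combo n y)) (S.w j)) ≤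
      C * (energy S.ev 2 (headSeq n x) * energy S.ev 1 (headSeq n y)) := by
  refine ⟨ENNReal.ofReal (L ^ 3) * ((∑' p, invWeight (waveWeight L) p ^ 4) *
    (3 * ENNReal.ofReal (L ^ 3)⁻¹ * ENNReal.ofReal (L ^ 3)⁻¹)), ?_, fun n x y => ?_⟩
  · exact ENNReal.mul_ne_top ENNReal.ofReal_ne_top (ENNReal.mul_ne_top (tsum_invWeight_ne_top hL)
      (ENNReal.mul_ne_top (ENNReal.mul_ne_top (by norm_num) ENNReal.ofReal_ne_top)
        ENNReal.ofReal_ne_top))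
  · have hx := S.smoothPer_combo n x
    have hy := S.smoothPer_combo n y
    refine (S.energy_pairing_le hL 0 (smoothPer_convField hx hy).continuous).trans ?_
    refine (mul_le_mul_right (fourierEnergy_convField_two_one hL hx hy
      (S.fieldCoeff_combo_zero n x)) _).trans (le_of_eq ?_)
    rw [S.fourierEnergy_combo_eq_energy hL, S.fourierEnergy_combo_eq_energy hL]
    ring

theorem exists_energy_convField (hL : 0 < L) (k : ℕ) : ∃ C : ℝ≥0∞, C ≠ ∞ ∧ ∀ n x y,
    energy S.ev (k + 1) (fun j => pairing L (convField (S.combo n x) (S.combo n y)) (S.w j)) ≤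
      C * (energy S.ev (k + 2) (headSeq n x) * energy S.ev (k + 2) (headSeq n y)) := by
  obtain ⟨C₂, hC₂, h₂⟩ := exists_energy_le_mul (S.ev_pos hL) S.mono (i := 2) (k := k + 2) (by omega)
  obtain ⟨D, hD⟩ : ∃ D : ℝ≥0∞, D = ENNReal.ofReal (L ^ 3) * (4 * 4 ^ (k + 1) *
    (∑' p, invWeight (waveWeight L) p ^ 4) *
      (3 * ENNReal.ofReal (L ^ 3)⁻¹ * ENNReal.ofReal (L ^ 3)⁻¹)) := ⟨_, rfl⟩
  refine ⟨D * (2 * C₂), ?_, fun n x y => ?_⟩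
  · rw [hD]
    refine ENNReal.mul_ne_top (ENNReal.mul_ne_top ENNReal.ofReal_ne_top (ENNReal.mul_ne_top
      (ENNReal.mul_ne_top (ENNReal.mul_ne_top (by norm_num) (ENNReal.pow_ne_top (by norm_num)))
        (tsum_invWeight_ne_top hL))
      (ENNReal.mul_ne_top (ENNReal.mul_ne_top (by norm_num) ENNReal.ofReal_ne_top)
        ENNReal.ofReal_ne_top))) (ENNReal.mul_ne_top (by norm_num) hC₂)
  · have hx := S.smoothPer_combo n x
    have hy := S.smoothPer_combo n y
    refine (S.energy_pairing_le hL (k + 1) (smoothPer_convField hx hy).continuous).trans ?_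
    refine (mul_le_mul_right (fourierEnergy_convField_le hL (k + 1) hx hy
      (S.fieldCoeff_combo_zero n x)) _).trans ?_
    simp only [S.fourierEnergy_combo_eq_energy hL]
    calc _ = D * (energy S.ev (k + 1 + 1) (headSeq n x) * energy S.ev 2 (headSeq n y) +
          energy S.ev 2 (headSeq n x) * energy S.ev (k + 1 + 1) (headSeq n y)) := by
          rw [hD]; ring
      _ ≤ D * (energy S.ev (k + 2) (headSeq n x) * (C₂ * energy S.ev (k + 2) (headSeq n y)) +
          (C₂ * energy S.ev (k + 2) (headSeq n x)) * energy S.ev (k + 2) (headSeq n y)) :=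
          mul_le_mul_right (add_le_add (mul_le_mul_right (h₂ _) _) (mul_le_mul_left (h₂ _) _)) _
      _ = _ := by ring

end StokesBasis

end

noncomputable section

/-! ### Continuous fields as elements of `[L²(Q)]³` -/

theorem memLp_cell {F : Type*} [NormedAddCommGroup F] {L : ℝ} {g : E3 → F} (hg : Continuous g)
    (p : ℝ≥0∞) : MemLp g p (cellMeasure L) := by
  obtain ⟨C, hC⟩ := (isCompact_cell L).exists_bound_of_continuousOn hg.continuousOn
  refine MemLp.of_bound (hg.continuousOn.aestronglyMeasurable_of_isCompact (isCompact_cell L)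
    (isCompact_cell L).isClosed.measurableSet) C ?_
  exact (ae_restrict_iff' (isCompact_cell L).isClosed.measurableSet).2 (Eventually.of_forall hC)

/-- The element of `[L²(Q)]³` given by a continuous field. -/
def fieldLp (L : ℝ) {g : E3 → E3} (hg : Continuous g) : L2 L := (memLp_cell hg 2).toLp g

theorem coeFn_fieldLp (L : ℝ) {g : E3 → E3} (hg : Continuous g) :
    fieldLp L hg =ᵐ[cellMeasure L] g := MemLp.coeFn_toLp _

theorem inner_eq_pairing {L : ℝ} (u v : L2 L) : inner ℝ u v = pairing L u v :=
  MeasureTheory.L2.inner_def u v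

theorem pairing_congr {L : ℝ} {u u' v v' : E3 → E3} (hu : u =ᵐ[cellMeasure L] u')
    (hv : v =ᵐ[cellMeasure L] v') : pairing L u v = pairing L u' v' := by
  unfold pairing
  refine integral_congr_ae ?_
  filter_upwards [hu, hv] with x h1 h2
  rw [h1, h2]

theorem pairing_eq_inner_fieldLp {L : ℝ} (u : L2 L) {g : E3 → E3} (hg : Continuous g) :
    pairing L u g = inner ℝ (fieldLp L hg) u := by
  rw [inner_eq_pairing, pairing_comm]
  exact pairing_congr (coeFn_fieldLp L hg).symm EventuallyEq.rfl

theorem integrable_inner_L2 {L : ℝ} (u : L2 L) {g : E3 → E3} (hg : Continuous g) :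
    Integrable (fun x => inner ℝ (u x) (g x)) (cellMeasure L) := by
  refine (MeasureTheory.L2.integrable_inner u (fieldLp L hg)).congr ?_
  filter_upwards [coeFn_fieldLp L hg] with x hx
  rw [hx]

theorem pairing_sum_right {ι : Type*} {L : ℝ} (u : L2 L) {s : Finset ι} {g : ι → E3 → E3}
    (hg : ∀ i ∈ s, Continuous (g i)) :
    pairing L u (fun x => ∑ i ∈ s, g i x) = ∑ i ∈ s, pairing L u (g i) := by
  unfold pairing
  simp only [inner_sum]
  exact integral_finsetSum _ fun i hi => integrable_inner_L2 u (hg i hi)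

theorem pairing_smul_right {L : ℝ} (u g : E3 → E3) (c : ℝ) :
    pairing L u (fun x => c • g x) = c * pairing L u g := by
  unfold pairing
  simp only [inner_smul_right]
  exact integral_const_mul _ _

theorem norm_fieldLp_sq {L : ℝ} {g : E3 → E3} (hg : Continuous g) :
    ‖fieldLp L hg‖ ^ 2 = pairing L g g := by
  rw [← real_inner_self_eq_norm_sq, inner_eq_pairing]
  exact pairing_congr (coeFn_fieldLp L hg) (coeFn_fieldLp L hg)

theorem fieldLp_congr {L : ℝ} {g h : E3 → E3} (hg : Continuous g) (hh : Continuous h)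
    (e : ∀ x, g x = h x) : fieldLp L hg = fieldLp L hh := by
  have : g = h := funext e
  subst this
  rfl

theorem fieldLp_sub {L : ℝ} {g h : E3 → E3} (hg : Continuous g) (hh : Continuous h) :
    fieldLp L hg - fieldLp L hh = fieldLp L (hg.sub hh) := by
  ext1
  filter_upwards [Lp.coeFn_sub (fieldLp L hg) (fieldLp L hh), coeFn_fieldLp L hg,
    coeFn_fieldLp L hh, coeFn_fieldLp L (hg.sub hh)] with x h1 h2 h3 h4
  rw [h1, h4, Pi.sub_apply, h2, h3, Pi.sub_apply]

/-- Pointwise application of a continuous field of matrices, as an operator on `[L²(Q)]³`. -/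
def mulOp (L : ℝ) {A : E3 → E3 →L[ℝ] E3} (hA : Continuous A) : L2 L →L[ℝ] L2 L :=
  (ContinuousLinearMap.id ℝ (E3 →L[ℝ] E3)).holderL (cellMeasure L) ∞ 2 2 ((memLp_cell hA ∞).toLp A)

theorem coeFn_mulOp (L : ℝ) {A : E3 → E3 →L[ℝ] E3} (hA : Continuous A) (u : L2 L) :
    mulOp L hA u =ᵐ[cellMeasure L] fun x => A x (u x) := by
  have h := (ContinuousLinearMap.id ℝ (E3 →L[ℝ] E3)).coeFn_holder (r := 2)
    ((memLp_cell hA ∞).toLp A : Lp (E3 →L[ℝ] E3) ∞ (cellMeasure L)) u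
  filter_upwards [h, MemLp.coeFn_toLp (memLp_cell (L := L) hA ∞)] with x h1 h2
  refine h1.trans ?_
  rw [h2]
  rfl

/-- The matrix field `v ↦ (v · ∇) φ`. -/
def gradMat (φ : E3 → E3) (x : E3) : E3 →L[ℝ] E3 :=
  ∑ i, (EuclideanSpace.proj (𝕜 := ℝ) i : E3 →L[ℝ] ℝ).smulRight (pderiv i φ x)

theorem gradMat_apply (φ : E3 → E3) (x v : E3) : gradMat φ x v = ∑ i, v i • pderiv i φ x := by
  simp [gradMat]

theorem continuous_gradMat {L : ℝ} {φ : E3 → E3} (hφ : SmoothPer L φ) :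
    Continuous (gradMat φ) := by
  refine continuous_finsetSum _ fun i _ => ?_
  exact ((ContinuousLinearMap.smulRightL ℝ E3 E3 (EuclideanSpace.proj i)).continuous).comp
    (hφ.pderiv i).continuous

/-- The matrix field `v ↦ (v · φ) e_i`. -/
def coordMat (i : Fin 3) (φ : E3 → E3) (x : E3) : E3 →L[ℝ] E3 :=
  (innerSL ℝ (φ x)).smulRight (basisVec i)

theorem continuous_coordMat {i : Fin 3} {φ : E3 → E3} (hφ : Continuous φ) :
    Continuous (coordMat i φ) := by
  have h : Continuous fun x => innerSL ℝ (φ x) := (innerSL ℝ).continuous.comp hφ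
  exact (ContinuousLinearMap.smulRightL ℝ E3 E3).continuous₂.comp (h.prodMk continuous_const)

/-- The trilinear form `((x · ∇) y, φ)`, with the derivative moved to the smooth field `φ`. -/
def trilin (L : ℝ) {φ : E3 → E3} (hφ : SmoothPer L φ) : L2 L →L[ℝ] L2 L →L[ℝ] ℝ :=
  -(innerSL ℝ).comp (mulOp L (continuous_gradMat hφ))

theorem trilin_apply {L : ℝ} {φ : E3 → E3} (hφ : SmoothPer L φ) (x y : L2 L) :
    trilin L hφ x y = -inner ℝ (mulOp L (continuous_gradMat hφ) x) y := rfl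

theorem trilin_fieldLp_left {L : ℝ} {φ a : E3 → E3} (hφ : SmoothPer L φ) (ha : SmoothPer L a)
    (y : L2 L) : trilin L hφ (fieldLp L ha.continuous) y = -pairing L y (convField a φ) := by
  rw [trilin_apply, inner_eq_pairing, pairing_comm]
  congr 1
  refine pairing_congr EventuallyEq.rfl ?_
  filter_upwards [coeFn_mulOp L (continuous_gradMat hφ) (fieldLp L ha.continuous),
    coeFn_fieldLp L ha.continuous] with x h1 h2
  rw [h1, h2, gradMat_apply]
  rfl

/-! ### Weak derivatives and integration by parts -/

theorem isWeakPartial_fieldLp {L : ℝ} (hL : 0 < L) {b : E3 → E3} (hb : SmoothPer L b) (i : Fin 3) :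
    IsWeakPartial L i (fieldLp L hb.continuous) (fieldLp L (hb.pderiv i).continuous) := by
  intro ψ hψ hp
  have hψ' : SmoothPer L ψ := ⟨hψ, hp⟩
  rw [pairing_congr (coeFn_fieldLp L hb.continuous) EventuallyEq.rfl,
    pairing_congr (coeFn_fieldLp L (hb.pderiv i).continuous) EventuallyEq.rfl]
  exact integral_bilin_pderiv hL hb hψ' (innerSL ℝ) i

/-- Integration by parts in the convective term with a divergence-free transporting field. -/
theorem pairing_convField_of_isWeakPartial {L : ℝ} {u : L2 L} {g : Fin 3 → L2 L}
    (hg : ∀ i, IsWeakPartial L i u (g i)) {a φ : E3 → E3} (ha : SmoothPer L a)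
    (hdiv : ∀ x, ∑ i, pderiv i a x i = 0) (hφ : SmoothPer L φ) :
    pairing L u (convField a φ) = -∑ i, pairing L (g i) (fun x => a x i • φ x) := by
  have ha' : ∀ i, SmoothPer L fun x => a x i := fun i =>
    ha.clm_comp (EuclideanSpace.proj (𝕜 := ℝ) i)
  have hs : ∀ i, SmoothPer L fun x => a x i • φ x := fun i =>
    (ha' i).bilin hφ (ContinuousLinearMap.lsmul ℝ ℝ)
  have hd : ∀ i x, pderiv i (fun x => a x i • φ x) x =
      pderiv i a x i • φ x + a x i • pderiv i φ x := by
    intro i x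
    have h1 := pderiv_bilin (ha' i) hφ (ContinuousLinearMap.lsmul ℝ ℝ) i x
    simp only [ContinuousLinearMap.lsmul_apply] at h1
    have h2 : pderiv i (fun x => a x i) x = pderiv i a x i :=
      pderiv_clm_comp ha (EuclideanSpace.proj (𝕜 := ℝ) i) i x
    rw [h1, h2]
  have hconv : convField a φ = fun x => ∑ i, pderiv i (fun x => a x i • φ x) x := by
    ext1 x
    simp only [hd, Finset.sum_add_distrib, ← Finset.sum_smul, hdiv x, zero_smul, zero_add]
    rfl
  rw [hconv, pairing_sum_right u fun i _ => ((hs i).pderiv i).continuous, ← Finset.sum_neg_distrib]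
  exact Finset.sum_congr rfl fun i _ => hg i _ (hs i).smooth (hs i).periodic

theorem pairing_convField_antisymm {L : ℝ} (hL : 0 < L) {a b φ : E3 → E3} (ha : SmoothPer L a)
    (hdiv : ∀ x, ∑ i, pderiv i a x i = 0) (hb : SmoothPer L b) (hφ : SmoothPer L φ) :
    pairing L b (convField a φ) = -pairing L (convField a b) φ := by
  have h := pairing_convField_of_isWeakPartial (isWeakPartial_fieldLp hL hb) ha hdiv hφ
  rw [pairing_congr (coeFn_fieldLp L hb.continuous) EventuallyEq.rfl] at h
  rw [h]
  congr 1
  have hc : ∀ i : Fin 3, Continuous fun x => a x i • φ x := fun i =>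
    ((EuclideanSpace.proj (𝕜 := ℝ) i).continuous.comp ha.continuous).smul hφ.continuous
  have hint : ∀ i ∈ Finset.univ, Integrable
      (fun x => inner ℝ (pderiv i b x) (a x i • φ x)) (cellMeasure L) := fun i _ =>
    integrable_cell ((hb.pderiv i).continuous.inner (hc i))
  simp only [fun i => pairing_congr (coeFn_fieldLp L (hb.pderiv i).continuous)
    (EventuallyEq.refl (ae (cellMeasure L)) fun x => a x i • φ x)]
  unfold pairing convField
  rw [← integral_finsetSum _ hint]
  congr 1
  ext x
  rw [sum_inner]
  exact Finset.sum_congr rfl fun i _ => by rw [inner_smul_left, inner_smul_right]; rfl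

end

noncomputable section

namespace StokesBasis

variable {L : ℝ} (S : StokesBasis L)

/-! ### The Stokes eigenfunctions as a Hilbert basis of `H` -/

/-- The eigenfunction `w_j` as an element of `[L²(Q)]³`. -/
def e (j : ℕ) : L2 L := fieldLp L (S.smoothPer j).continuous

theorem inner_e (j : ℕ) (u : L2 L) : inner ℝ (S.e j) u = pairing L u (S.w j) :=
  (pairing_eq_inner_fieldLp u _).symm

theorem orthonormal_e : Orthonormal ℝ S.e := by
  rw [orthonormal_iff_ite]
  intro i j
  have h : pairing L (S.e j) (S.w i) = pairing L (S.w j) (S.w i) :=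
    pairing_congr (coeFn_fieldLp L (S.smoothPer j).continuous) EventuallyEq.rfl
  rw [inner_e, h, S.orthonormal]
  simp only [eq_comm]

theorem e_mem_H (j : ℕ) : S.e j ∈ H L :=
  Submodule.le_topologicalClosure _
    (Submodule.subset_span ⟨S.w j, S.solenoidal j, coeFn_fieldLp L _⟩)

/-- The partial sum of the expansion with coefficients `x`, as an element of `[L²(Q)]³`. -/
def comboLp (n : ℕ) (x : ℕ → ℝ) : L2 L := fieldLp L (S.smoothPer_combo n x).continuous

theorem comboLp_eq_sum (n : ℕ) (x : ℕ → ℝ) :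
    S.comboLp n x = ∑ j ∈ Finset.range n, x j • S.e j := by
  induction n with
  | zero =>
    rw [Finset.sum_range_zero]
    ext1
    filter_upwards [coeFn_fieldLp L (S.smoothPer_combo 0 x).continuous,
      Lp.coeFn_zero E3 2 (cellMeasure L)] with y h1 h2
    refine h1.trans ?_
    rw [h2]
    simp [combo]
  | succ n ih =>
    rw [Finset.sum_range_succ, ← ih]
    ext1
    filter_upwards [coeFn_fieldLp L (S.smoothPer_combo (n + 1) x).continuous,
      coeFn_fieldLp L (S.smoothPer_combo n x).continuous,
      coeFn_fieldLp L (S.smoothPer n).continuous,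
      Lp.coeFn_add (S.comboLp n x) (x n • S.e n), Lp.coeFn_smul (x n) (S.e n)] with y h1 h2 h3 h4 h5
    refine h1.trans ?_
    rw [h4, Pi.add_apply, h5, Pi.smul_apply]
    refine Eq.trans ?_ (congrArg₂ (fun a b : E3 => a + x n • b) h2.symm h3.symm)
    exact Finset.sum_range_succ _ _

theorem tendsto_comboLp {u : L2 L} (hu : u ∈ H L) :
    Tendsto (fun n => S.comboLp n fun j => pairing L u (S.w j)) atTop (𝓝 u) := by
  have hcl : IsClosed (H L : Set (L2 L)) := Submodule.isClosed_topologicalClosure _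
  have : CompleteSpace (H L) := hcl.completeSpace_coe
  obtain ⟨v, hv⟩ : ∃ v : ℕ → H L, ∀ j, (v j : L2 L) = S.e j :=
    ⟨fun j => ⟨S.e j, S.e_mem_H j⟩, fun j => rfl⟩
  have hvo : Orthonormal ℝ v := by
    rw [orthonormal_iff_ite]
    intro i j
    rw [Submodule.coe_inner, hv, hv]
    exact orthonormal_iff_ite.1 S.orthonormal_e i j
  have hbot : (Submodule.span ℝ (range v))ᗮ = ⊥ := by
    rw [eq_bot_iff]
    intro x hx
    rw [Submodule.mem_bot]
    have h0 := S.complete x x.2 fun j => by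
      rw [← S.inner_e, ← hv, ← Submodule.coe_inner]
      exact (Submodule.mem_orthogonal _ x).1 hx _ (Submodule.subset_span (mem_range_self j))
    exact Subtype.ext h0
  have hb := (HilbertBasis.mkOfOrthogonalEqBot hvo hbot).hasSum_repr ⟨u, hu⟩
  have hb2 := (hb.mapL (H L).subtypeL).tendsto_sum_nat
  refine hb2.congr fun n => ?_
  rw [S.comboLp_eq_sum]
  refine Finset.sum_congr rfl fun j _ => ?_
  rw [HilbertBasis.repr_apply_apply, HilbertBasis.coe_mkOfOrthogonalEqBot]
  change inner ℝ (v j) (⟨u, hu⟩ : H L) • (v j : L2 L) = _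
  rw [Submodule.coe_inner, hv, S.inner_e]

/-! ### Weak derivatives of the elements of `V` -/

theorem div_combo (n : ℕ) (x : ℕ → ℝ) (y : E3) : ∑ i, pderiv i (S.combo n x) y i = 0 := by
  have h : ∀ i, pderiv i (S.combo n x) y = ∑ j ∈ Finset.range n, x j • pderiv i (S.w j) y :=
    fun i => pderiv_sum_smul x (fun j _ => S.smoothPer j) i y
  simp only [h, WithLp.ofLp_sum, Finset.sum_apply, PiLp.smul_apply]
  rw [Finset.sum_comm]
  refine Finset.sum_eq_zero fun j _ => ?_
  have h2 : ∑ i, pderiv i (S.w j) y i = 0 := (S.solenoidal j).div_free y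
  rw [← Finset.smul_sum, h2, smul_zero]

theorem pairing_laplacian (u : E3 → E3) (j : ℕ) :
    pairing L u (Laplacian.laplacian (S.w j)) = -S.ev j * pairing L u (S.w j) := by
  rw [← pairing_smul_right]
  congr 1
  ext1 x
  rw [neg_smul, ← S.eigen, neg_neg]

theorem laplacian_combo (n : ℕ) (x : ℕ → ℝ) (y : E3) :
    ∑ i, pderiv i (pderiv i (S.combo n x)) y = -S.combo n (fun j => S.ev j * x j) y := by
  have h1 : ∀ i, pderiv i (S.combo n x) = fun y => ∑ j ∈ Finset.range n, x j • pderiv i (S.w j) y :=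
    fun i => funext fun y => pderiv_sum_smul x (fun j _ => S.smoothPer j) i y
  have h2 : ∀ i, pderiv i (pderiv i (S.combo n x)) y =
      ∑ j ∈ Finset.range n, x j • pderiv i (pderiv i (S.w j)) y := fun i => by
    rw [h1]
    exact pderiv_sum_smul x (fun j _ => (S.smoothPer j).pderiv i) i y
  simp only [h2]
  rw [Finset.sum_comm, combo, ← Finset.sum_neg_distrib]
  refine Finset.sum_congr rfl fun j _ => ?_
  rw [← Finset.smul_sum, ← laplacian_eq_sum_pderiv (S.smoothPer j),
    show Laplacian.laplacian (S.w j) y = -(S.ev j • S.w j y) by rw [← S.eigen, neg_neg], smul_neg,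
    smul_smul, mul_comm]

theorem sum_pairing_pderiv_combo (hL : 0 < L) (n : ℕ) (x : ℕ → ℝ) :
    ∑ i, pairing L (pderiv i (S.combo n x)) (pderiv i (S.combo n x)) =
      ∑ j ∈ Finset.range n, S.ev j * x j ^ 2 := by
  have hv := S.smoothPer_combo n x
  have h1 : ∀ i, pairing L (pderiv i (S.combo n x)) (pderiv i (S.combo n x)) =
      -∫ y, inner ℝ (S.combo n x y) (pderiv i (pderiv i (S.combo n x)) y) ∂(cellMeasure L) :=
    fun i => neg_eq_iff_eq_neg.1 (integral_bilin_pderiv hL hv (hv.pderiv i) (innerSL ℝ) i).symm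
  rw [Finset.sum_congr rfl fun i _ => h1 i, Finset.sum_neg_distrib,
    ← integral_finsetSum _ fun i _ => integrable_cell
      (hv.continuous.inner ((hv.pderiv i).pderiv i).continuous)]
  simp only [← inner_sum, S.laplacian_combo, inner_neg_right]
  rw [integral_neg, neg_neg]
  change pairing L (S.combo n x) (S.combo n _) = _
  rw [S.pairing_combo_combo]
  exact Finset.sum_congr rfl fun j _ => by ring

theorem norm_fieldLp_pderiv_combo_sq_le (hL : 0 < L) (n : ℕ) (x : ℕ → ℝ) (i : Fin 3) :
    ‖fieldLp L ((S.smoothPer_combo n x).pderiv i).continuous‖ ^ 2 ≤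
      ∑ j ∈ Finset.range n, S.ev j * x j ^ 2 := by
  have h : ∑ i, pairing L (pderiv i (S.combo n x)) (pderiv i (S.combo n x)) =
      ∑ i, ‖fieldLp L ((S.smoothPer_combo n x).pderiv i).continuous‖ ^ 2 :=
    Finset.sum_congr rfl fun i _ => (norm_fieldLp_sq _).symm
  rw [← S.sum_pairing_pderiv_combo hL, h]
  exact Finset.single_le_sum
    (f := fun i => ‖fieldLp L ((S.smoothPer_combo n x).pderiv i).continuous‖ ^ 2)
    (fun j _ => sq_nonneg _) (Finset.mem_univ i)

/-- The elements of `V` have weak partial derivatives: those of the partial sums of the expansion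
form a Cauchy sequence. -/
theorem exists_isWeakPartial (hL : 0 < L) {u : L2 L} (hu : u ∈ H L)
    (h1 : energy S.ev 1 (fun j => pairing L u (S.w j)) ≠ ∞) (i : Fin 3) :
    ∃ g, IsWeakPartial L i u g := by
  obtain ⟨c, hc⟩ : ∃ c : ℕ → ℝ, c = fun j => pairing L u (S.w j) := ⟨_, rfl⟩
  obtain ⟨d, hd⟩ : ∃ d : ℕ → L2 L, d = fun n =>
    fieldLp L ((S.smoothPer_combo n c).pderiv i).continuous := ⟨_, rfl⟩
  have hsum : Summable fun j => S.ev j * c j ^ 2 := by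
    have h2 := ENNReal.summable_toReal h1
    refine h2.congr fun j => ?_
    rw [ENNReal.toReal_ofReal (mul_nonneg (pow_nonneg (S.ev_pos hL j).le _) (sq_nonneg _)),
      pow_one, hc]
  have hpart := hsum.hasSum.tendsto_sum_nat.cauchySeq
  have hdiff : ∀ m n, m ≤ n → dist (d n) (d m) ^ 2 ≤
      ∑ j ∈ Finset.range n, S.ev j * c j ^ 2 - ∑ j ∈ Finset.range m, S.ev j * c j ^ 2 := by
    intro m n hmn
    have hcomb : ∀ y, S.combo n c y - S.combo m c y = S.combo n (tailSeq m c) y := by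
      intro y
      have hz : ∑ j ∈ Finset.range m, tailSeq m c j • S.w j y = 0 :=
        Finset.sum_eq_zero fun j hj => by
          rw [tailSeq, if_pos (Finset.mem_range.1 hj), zero_smul]
      rw [combo, combo, combo, ← Finset.sum_range_add_sum_Ico _ hmn, add_sub_cancel_left,
        ← Finset.sum_range_add_sum_Ico _ hmn, hz, zero_add]
      refine Finset.sum_congr rfl fun j hj => ?_
      rw [tailSeq, if_neg (not_lt.2 (Finset.mem_Ico.1 hj).1)]
    have hder : ∀ y, pderiv i (S.combo n c) y - pderiv i (S.combo m c) y =
        pderiv i (S.combo n (tailSeq m c)) y := by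
      intro y
      have h3 : S.combo n (tailSeq m c) = fun y => S.combo n c y - S.combo m c y :=
        funext fun y => (hcomb y).symm
      rw [h3]
      unfold pderiv
      rw [fderiv_fun_sub ((S.smoothPer_combo n c).differentiable y)
        ((S.smoothPer_combo m c).differentiable y)]
      rfl
    have hdd : d n - d m =
        fieldLp L ((S.smoothPer_combo n (tailSeq m c)).pderiv i).continuous := by
      rw [hd]
      dsimp only
      rw [fieldLp_sub]
      exact fieldLp_congr _ _ hder
    rw [dist_eq_norm, hdd]
    refine (S.norm_fieldLp_pderiv_combo_sq_le hL n _ i).trans (le_of_eq ?_)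
    have hz : ∑ j ∈ Finset.range m, S.ev j * tailSeq m c j ^ 2 = 0 :=
      Finset.sum_eq_zero fun j hj => by
        rw [tailSeq, if_pos (Finset.mem_range.1 hj), sq, zero_mul, mul_zero]
    rw [← Finset.sum_range_add_sum_Ico _ hmn, hz, zero_add,
      ← Finset.sum_range_add_sum_Ico (fun j => S.ev j * c j ^ 2) hmn, add_sub_cancel_left]
    refine Finset.sum_congr rfl fun j hj => ?_
    rw [tailSeq, if_neg (not_lt.2 (Finset.mem_Ico.1 hj).1)]
  have hcau : CauchySeq d := by
    rw [Metric.cauchySeq_iff']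
    intro ε hε
    obtain ⟨N, hN⟩ := Metric.cauchySeq_iff'.1 hpart (ε ^ 2) (by positivity)
    refine ⟨N, fun n hn => ?_⟩
    have h2 := (hdiff N n hn).trans_lt ((le_abs_self _).trans_lt (hN n hn))
    exact lt_of_pow_lt_pow_left₀ 2 hε.le h2
  obtain ⟨g, hg⟩ := cauchySeq_tendsto_of_complete hcau
  refine ⟨g, fun ψ hψ hp => ?_⟩
  have hψ' : SmoothPer L ψ := ⟨hψ, hp⟩
  have hψi : Continuous (partialDeriv i ψ) := (hψ'.pderiv i).continuous
  rw [pairing_eq_inner_fieldLp u hψi, pairing_eq_inner_fieldLp g hψ'.continuous]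
  have hu' := S.tendsto_comboLp hu
  rw [← hc] at hu'
  have t1 := ((innerSL ℝ (fieldLp L hψi)).continuous.tendsto u).comp hu'
  have t2 := (((innerSL ℝ (fieldLp L hψ'.continuous)).continuous.tendsto g).comp hg).neg
  refine tendsto_nhds_unique t1 (t2.congr fun n => ?_)
  have h3 := isWeakPartial_fieldLp hL (S.smoothPer_combo n c) i ψ hψ hp
  rw [pairing_eq_inner_fieldLp _ hψi, pairing_eq_inner_fieldLp _ hψ'.continuous] at h3
  rw [hd]
  exact h3.symm

theorem isWeakPartial_weakPartial (hL : 0 < L) {u : L2 L} (hu : u ∈ H L)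
    (h1 : energy S.ev 1 (fun j => pairing L u (S.w j)) ≠ ∞) (i : Fin 3) :
    IsWeakPartial L i u (weakPartial L i u) := by
  have h := S.exists_isWeakPartial hL hu h1 i
  rw [weakPartial, dif_pos h]
  exact h.choose_spec

/-- The pairing of the convective term `(u · ∇) u` with `w_k` for `u ∈ V`. -/
theorem pairing_convect (hL : 0 < L) {u : L2 L} (hu : u ∈ H L)
    (h1 : energy S.ev 1 (fun j => pairing L u (S.w j)) ≠ ∞) (k : ℕ) :
    pairing L (convect L u u) (S.w k) = trilin L (S.smoothPer k) u u := by
  have hw := S.smoothPer k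
  obtain ⟨g, hg, hgw⟩ : ∃ g : Fin 3 → L2 L, (∀ i, g i = weakPartial L i u) ∧
      ∀ i, IsWeakPartial L i u (g i) :=
    ⟨fun i => weakPartial L i u, fun _ => rfl, S.isWeakPartial_weakPartial hL hu h1⟩
  have hcm : ∀ i : Fin 3, Continuous (coordMat i (S.w k)) := fun i =>
    continuous_coordMat hw.continuous
  -- As a functional of the transporting field, the pairing is continuous on `[L²(Q)]³`.
  have hM : ∀ (i : Fin 3) (a : L2 L), inner ℝ (mulOp L (hcm i) (g i)) a =
      ∫ x, inner ℝ (a x i • g i x) (S.w k x) ∂(cellMeasure L) := by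
    intro i a
    rw [inner_eq_pairing]
    refine integral_congr_ae ?_
    filter_upwards [coeFn_mulOp L (hcm i) (g i)] with x hx
    rw [hx, coordMat, ContinuousLinearMap.smulRight_apply, innerSL_apply_apply, inner_smul_left,
      inner_smul_left, basisVec, EuclideanSpace.inner_single_left, real_inner_comm (g i x)]
    simp [mul_comm]
  have hMi : ∀ i ∈ Finset.univ, Integrable
      (fun x => inner ℝ (u x i • g i x) (S.w k x)) (cellMeasure L) := by
    intro i _
    refine (MeasureTheory.L2.integrable_inner (𝕜 := ℝ) (mulOp L (hcm i) (g i)) u).congr ?_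
    filter_upwards [coeFn_mulOp L (hcm i) (g i)] with x hx
    rw [hx, coordMat, ContinuousLinearMap.smulRight_apply, innerSL_apply_apply, inner_smul_left,
      inner_smul_left, basisVec, EuclideanSpace.inner_single_left, real_inner_comm (g i x)]
    simp [mul_comm]
  have hlhs : pairing L (convect L u u) (S.w k) = ∑ i, inner ℝ (mulOp L (hcm i) (g i)) u := by
    simp only [hM]
    rw [← integral_finsetSum _ hMi]
    unfold pairing convect
    simp only [sum_inner, hg]
  rw [hlhs]
  have hu' := S.tendsto_comboLp hu
  have t1 : Tendsto (fun n => ∑ i, inner ℝ (mulOp L (hcm i) (g i))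
      (S.comboLp n fun j => pairing L u (S.w j))) atTop
      (𝓝 (∑ i, inner ℝ (mulOp L (hcm i) (g i)) u)) :=
    tendsto_finsetSum _ fun i _ =>
      ((innerSL ℝ (mulOp L (hcm i) (g i))).continuous.tendsto u).comp hu'
  have t2 : Tendsto (fun n => trilin L hw (S.comboLp n fun j => pairing L u (S.w j)) u) atTop
      (𝓝 (trilin L hw u u)) :=
    (((trilin L hw).flip u).continuous.tendsto u).comp hu'
  refine tendsto_nhds_unique t1 (t2.congr fun n => ?_)
  have ha := S.smoothPer_combo n fun j => pairing L u (S.w j)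
  rw [comboLp, trilin_fieldLp_left hw ha,
    pairing_convField_of_isWeakPartial hgw ha (S.div_combo n _) hw,
    neg_neg]
  refine Finset.sum_congr rfl fun i _ => ?_
  rw [hM]
  refine integral_congr_ae ?_
  filter_upwards [coeFn_fieldLp L ha.continuous] with x hx
  rw [hx, inner_smul_left, inner_smul_right]
  rfl

end StokesBasis

end

noncomputable section

/-! ### The Navier-Stokes system as an abstract Galerkin scheme -/

theorem tendsto_clm_apply₂ {E : Type*} [NormedAddCommGroup E] [NormedSpace ℝ E]
    (B : E →L[ℝ] E →L[ℝ] ℝ) {a b : ℕ → E} {x y : E} (ha : Tendsto a atTop (𝓝 x))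
    (hb : Tendsto b atTop (𝓝 y)) : Tendsto (fun n => B (a n) (b n)) atTop (𝓝 (B x y)) :=
  (B.continuous₂.tendsto (x, y)).comp (ha.prodMk_nhds hb)

namespace StokesBasis

variable {L : ℝ} (S : StokesBasis L)

theorem trilin_comboLp (hL : 0 < L) (n k : ℕ) (x y : ℕ → ℝ) :
    trilin L (S.smoothPer k) (S.comboLp n x) (S.comboLp n y) =
      pairing L (convField (S.combo n x) (S.combo n y)) (S.w k) := by
  have hx := S.smoothPer_combo n x
  have hy := S.smoothPer_combo n y
  rw [comboLp, comboLp, trilin_fieldLp_left (S.smoothPer k) hx,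
    pairing_congr (coeFn_fieldLp L hy.continuous) EventuallyEq.rfl,
    pairing_convField_antisymm hL hx (S.div_combo n x) hy (S.smoothPer k), neg_neg]

/-- An estimate of the trilinear form for finite combinations extends to all of `H`. -/
theorem energy_trilin_le (hL : 0 < L) {k i l : ℕ} {C : ℝ≥0∞}
    (h : ∀ n x y,
      energy S.ev k (fun j => pairing L (convField (S.combo n x) (S.combo n y)) (S.w j)) ≤
        C * (energy S.ev i (headSeq n x) * energy S.ev l (headSeq n y)))
    {x y : L2 L} (hx : x ∈ H L) (hy : y ∈ H L) :
    energy S.ev k (fun j => trilin L (S.smoothPer j) x y) ≤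
      C * (energy S.ev i (fun j => inner ℝ (S.e j) x) *
        energy S.ev l (fun j => inner ℝ (S.e j) y)) := by
  simp only [S.inner_e]
  refine GalerkinFrame.energy_le_of_tendsto (a := fun n j => trilin L (S.smoothPer j)
    (S.comboLp n fun j => pairing L x (S.w j)) (S.comboLp n fun j => pairing L y (S.w j)))
    (fun j => ?_) (Eventually.of_forall fun n => ?_)
  · exact tendsto_clm_apply₂ (trilin L (S.smoothPer j)) (S.tendsto_comboLp hx)
      (S.tendsto_comboLp hy)
  · simp only [S.trilin_comboLp hL]
    refine (h n _ _).trans (mul_le_mul_right (mul_le_mul' ?_ ?_) _)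
    · exact energy_headSeq_le (S.ev_pos hL) n i _
    · exact energy_headSeq_le (S.ev_pos hL) n l _

theorem sum_trilin_comboLp (hL : 0 < L) (n : ℕ) (x : ℕ → ℝ) :
    ∑ k ∈ Finset.range n, trilin L (S.smoothPer k) (S.comboLp n x) (S.comboLp n x) * x k = 0 := by
  have hx := S.smoothPer_combo n x
  have hcx : Continuous (convField (S.combo n x) (S.combo n x)) :=
    (smoothPer_convField hx hx).continuous
  simp only [S.trilin_comboLp hL, mul_comm _ (x _)]
  rw [← S.pairing_combo hcx]
  have h := pairing_convField_antisymm hL hx (S.div_combo n x) hx hx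
  rw [pairing_comm] at h
  linarith

/-- The Stokes eigenfunctions, their eigenvalues and the convective term as a Galerkin frame. -/
def frame (hL : 0 < L) : GalerkinFrame (L2 L) where
  e := S.e
  lam := S.ev
  T := fun k => trilin L (S.smoothPer k)
  K := H L
  orthonormal := S.orthonormal_e
  e_mem := S.e_mem_H
  lam_pos := S.ev_pos hL
  lam_mono := S.mono
  est_one_two := by
    obtain ⟨C, hC, h⟩ := S.exists_energy_convField_one_two hL
    exact ⟨C, hC, fun x hx y hy => S.energy_trilin_le hL h hx hy⟩
  est_two_one := by
    obtain ⟨C, hC, h⟩ := S.exists_energy_convField_two_one hL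
    exact ⟨C, hC, fun x hx y hy => S.energy_trilin_le hL h hx hy⟩
  est := fun k => by
    obtain ⟨C, hC, h⟩ := S.exists_energy_convField hL k
    exact ⟨C, hC, fun x hx y hy => S.energy_trilin_le hL h hx hy⟩
  skew := fun n c => by
    obtain ⟨x, hx⟩ : ∃ x : ℕ → ℝ, ∀ k : Fin n, x k = c k :=
      ⟨fun j => if h : j < n then c ⟨j, h⟩ else 0, fun k => by simp⟩
    have h1 : ∑ j : Fin n, c j • S.e j = S.comboLp n x := by
      rw [S.comboLp_eq_sum, ← Fin.sum_univ_eq_sum_range fun j => x j • S.e j]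
      simp only [hx]
    rw [h1, ← S.sum_trilin_comboLp hL n x, ← Fin.sum_univ_eq_sum_range fun k =>
      trilin L (S.smoothPer k) (S.comboLp n x) (S.comboLp n x) * x k]
    simp only [hx]

theorem frame_coef (hL : 0 < L) (u : L2 L) (j : ℕ) :
    (S.frame hL).coef u j = pairing L u (S.w j) := S.inner_e j u

theorem frame_normSq (hL : 0 < L) (k : ℕ) (u : L2 L) :
    (S.frame hL).normSq k u = energy S.ev k fun j => pairing L u (S.w j) := by
  rw [GalerkinFrame.normSq, funext fun j => S.frame_coef hL u j]
  rfl

theorem vNorm_eq (hL : 0 < L) (k : ℕ) (u : L2 L) :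
    S.vNorm k u = (S.frame hL).normSq k u ^ (1 / 2 : ℝ) := by
  rw [frame_normSq]
  rfl

theorem vNorm_lt_top_iff (hL : 0 < L) (k : ℕ) (u : L2 L) :
    S.vNorm k u < ∞ ↔ (S.frame hL).normSq k u ≠ ∞ := by
  rw [S.vNorm_eq hL, ENNReal.rpow_lt_top_iff_of_pos (by norm_num), lt_top_iff_ne_top]

/-- The right-hand side of the equation in the component `w_k`, for a field of class `V`. -/
theorem rhs_eq (hL : 0 < L) (ν : ℝ) (f : L2 L) {u : L2 L} (hu : u ∈ H L)
    (h1 : (S.frame hL).normSq 1 u ≠ ∞) (k : ℕ) :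
    rhs L ν f u (S.w k) = (S.frame hL).coef f k -
      ν * (S.frame hL).lam k * (S.frame hL).coef u k - (S.frame hL).T k u u := by
  rw [S.frame_normSq] at h1
  rw [rhs, S.pairing_laplacian, S.pairing_convect hL hu h1, S.frame_coef, S.frame_coef]
  change _ = _ - ν * S.ev k * _ - trilin L (S.smoothPer k) u u
  ring

theorem mem_galerkinSpace_iff (n : ℕ) (v : L2 L) :
    v ∈ S.galerkinSpace n ↔ ∃ c : Fin n → ℝ, v = ∑ j, c j • S.e j := by
  refine exists_congr fun c => ?_
  obtain ⟨x, hx⟩ : ∃ x : ℕ → ℝ, ∀ k : Fin n, x k = c k :=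
    ⟨fun j => if h : j < n then c ⟨j, h⟩ else 0, fun k => by simp⟩
  have h1 : ∑ j : Fin n, c j • S.e j = S.comboLp n x := by
    rw [S.comboLp_eq_sum, ← Fin.sum_univ_eq_sum_range fun j => x j • S.e j]
    simp only [hx]
  have h2 : ∀ y, ∑ j : Fin n, c j • S.w j y = S.combo n x y := fun y => by
    rw [combo, ← Fin.sum_univ_eq_sum_range fun j => x j • S.w j y]
    simp only [hx]
  have h3 : S.comboLp n x =ᵐ[cellMeasure L] S.combo n x := coeFn_fieldLp L _
  simp only [h2]
  rw [h1]
  constructor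
  · intro h
    exact Lp.ext (EventuallyEq.trans h h3.symm)
  · rintro rfl
    exact h3

theorem normSq_ne_top_of_sum (hL : 0 < L) (k n : ℕ) (c : Fin n → ℝ) :
    (S.frame hL).normSq k (∑ j, c j • S.e j) ≠ ∞ := by
  have h : ∀ j, n ≤ j → (S.frame hL).coef (∑ j, c j • S.e j) j = 0 := fun j hj => by
    have := (S.frame hL).coef_sum_fin c j
    rwa [dif_neg (not_lt.2 hj)] at this
  rw [GalerkinFrame.normSq, energy_eq_sum (S.frame hL).lam_pos k n h]
  exact ENNReal.ofReal_ne_top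

theorem isGalerkinSolution_iff (hL : 0 < L) (n : ℕ) (ν T : ℝ) (u₀ : L2 L) (f v : ℝ → L2 L) :
    S.IsGalerkinSolution n ν T u₀ f v ↔ (S.frame hL).IsGalerkin n ν T u₀ f v := by
  have key : (∀ t ∈ Icc 0 T, ∃ c : Fin n → ℝ, v t = ∑ j, c j • S.e j) → ∀ k, ∀ t ∈ Icc 0 T,
      ∫ s in (0 : ℝ)..t, rhs L ν (f s) (v s) (S.w k) =
      ∫ s in (0 : ℝ)..t, ((S.frame hL).coef (f s) k -
        ν * (S.frame hL).lam k * (S.frame hL).coef (v s) k - (S.frame hL).T k (v s) (v s)) := by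
    intro h k t ht
    refine intervalIntegral.integral_congr fun s hs => ?_
    rw [uIcc_of_le ht.1] at hs
    obtain ⟨c, hc⟩ := h s ⟨hs.1, hs.2.trans ht.2⟩
    refine S.rhs_eq hL ν (f s) ?_ ?_ k
    · rw [hc]
      exact Submodule.sum_mem _ fun j _ => Submodule.smul_mem _ _ (S.e_mem_H j)
    · rw [hc]
      exact S.normSq_ne_top_of_sum hL 1 n c
  constructor
  · intro h
    have hm : ∀ t ∈ Icc 0 T, ∃ c : Fin n → ℝ, v t = ∑ j, c j • S.e j := fun t ht =>
      (S.mem_galerkinSpace_iff n _).1 (h.mem_space t ht)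
    refine ⟨hm, h.continuousOn, fun k hk t ht => ?_⟩
    rw [← key hm k t ht, S.frame_coef, S.frame_coef]
    exact h.equation k hk t ht
  · intro h
    refine ⟨fun t ht => (S.mem_galerkinSpace_iff n _).2 (h.mem_span t ht), h.continuousOn,
      fun k hk t ht => ?_⟩
    rw [key h.mem_span k t ht, ← S.frame_coef hL, ← S.frame_coef hL]
    exact h.equation k hk t ht

end StokesBasis

end

noncomputable section

namespace StokesBasis

variable {L : ℝ} (S : StokesBasis L)

/-! ### Norms of time-dependent fields -/

theorem restrict_Ioo_eq (T : ℝ) :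
    (volume : Measure ℝ).restrict (Ioo 0 T) = volume.restrict (Ioc 0 T) :=
  Measure.restrict_congr_set Ioo_ae_eq_Ioc

theorem bochnerNorm_two (hL : 0 < L) (k : ℕ) (T : ℝ) (v : ℝ → L2 L) :
    S.bochnerNorm 2 k T v = (∫⁻ s in Ioc 0 T, (S.frame hL).normSq k (v s)) ^ (1 / 2 : ℝ) := by
  rw [bochnerNorm, restrict_Ioo_eq,
    eLpNorm_eq_lintegral_rpow_enorm_toReal (by norm_num) (by norm_num)]
  congr 1
  refine lintegral_congr fun s => ?_
  rw [S.vNorm_eq hL, enorm_eq_self, ← ENNReal.rpow_mul]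
  norm_num

theorem bochnerNorm_top_le (hL : 0 < L) (k : ℕ) {T : ℝ} {v : ℝ → L2 L} {M : ℝ≥0∞}
    (h : ∀ t ∈ Icc 0 T, (S.frame hL).normSq k (v t) ≤ M) :
    S.bochnerNorm ∞ k T v ≤ M ^ (1 / 2 : ℝ) := by
  rw [bochnerNorm, eLpNorm_exponent_top]
  refine eLpNormEssSup_le_of_ae_enorm_bound ?_
  filter_upwards [ae_restrict_mem measurableSet_Ioo] with s hs
  rw [S.vNorm_eq hL, enorm_eq_self]
  exact ENNReal.rpow_le_rpow (h s (Ioo_subset_Icc_self hs)) (by norm_num)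

theorem ae_normSq_le (hL : 0 < L) (k : ℕ) (T : ℝ) (v : ℝ → L2 L) :
    ∀ᵐ s ∂(volume.restrict (Ioc 0 T)),
      (S.frame hL).normSq k (v s) ≤ S.bochnerNorm ∞ k T v ^ (2 : ℝ) := by
  rw [← restrict_Ioo_eq, bochnerNorm, eLpNorm_exponent_top]
  filter_upwards [enorm_ae_le_eLpNormEssSup (fun t => S.vNorm k (v t)) (volume.restrict (Ioo 0 T))]
    with s hs
  rw [enorm_eq_self, S.vNorm_eq hL] at hs
  have h := ENNReal.rpow_le_rpow hs (z := 2) (by norm_num)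
  rw [← ENNReal.rpow_mul] at h
  norm_num at h ⊢
  exact h

theorem lintegral_normSq_ne_top (hL : 0 < L) {k : ℕ} {T : ℝ} {v : ℝ → L2 L}
    (h : S.bochnerNorm 2 k T v < ∞) : ∫⁻ s in Ioc 0 T, (S.frame hL).normSq k (v s) ≠ ∞ := by
  rw [S.bochnerNorm_two hL, ENNReal.rpow_lt_top_iff_of_pos (by norm_num)] at h
  exact h.ne

theorem memBochner_top (hL : 0 < L) {k : ℕ} {T : ℝ} {v : ℝ → L2 L}
    (hm : AEStronglyMeasurable v (volume.restrict (Ioc 0 T))) (hH : ∀ t ∈ Icc 0 T, v t ∈ H L)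
    {M : ℝ≥0∞} (hM : M ≠ ∞) (h : ∀ t ∈ Icc 0 T, (S.frame hL).normSq k (v t) ≤ M) :
    S.MemBochner ∞ k T v := by
  refine ⟨by rwa [restrict_Ioo_eq], ?_, ?_⟩
  · filter_upwards [ae_restrict_mem measurableSet_Ioo] with s hs
    have hs' := Ioo_subset_Icc_self hs
    exact ⟨hH s hs', (S.vNorm_lt_top_iff hL k _).2 (ne_top_of_le_ne_top hM (h s hs'))⟩
  · exact (S.bochnerNorm_top_le hL k h).trans_lt
      (ENNReal.rpow_lt_top_of_nonneg (by norm_num) hM)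

theorem memBochner_two (hL : 0 < L) {k : ℕ} {T : ℝ} {v : ℝ → L2 L}
    (hm : AEStronglyMeasurable v (volume.restrict (Ioc 0 T))) (hH : ∀ t ∈ Icc 0 T, v t ∈ H L)
    (h : ∫⁻ s in Ioc 0 T, (S.frame hL).normSq k (v s) ≠ ∞) : S.MemBochner 2 k T v := by
  refine ⟨by rwa [restrict_Ioo_eq], ?_, ?_⟩
  · have h1 := ae_lt_top' ((S.frame hL).aemeasurable_normSq hm k) h
    rw [← restrict_Ioo_eq] at h1
    filter_upwards [ae_restrict_mem measurableSet_Ioo, h1] with s hs hs1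
    exact ⟨hH s (Ioo_subset_Icc_self hs), (S.vNorm_lt_top_iff hL k _).2 hs1.ne⟩
  · rw [S.bochnerNorm_two hL]
    exact ENNReal.rpow_lt_top_of_nonneg (by norm_num) h

end StokesBasis

/-- A Galerkin approximation is bounded in time in every norm. -/
theorem GalerkinFrame.IsGalerkin.exists_normSq_le {E : Type*} [NormedAddCommGroup E]
    [InnerProductSpace ℝ E] {D : GalerkinFrame E} {n : ℕ} {ν T : ℝ} {u₀ : E} {f v : ℝ → E}
    (h : D.IsGalerkin n ν T u₀ f v) (k : ℕ) :
    ∃ M : ℝ≥0∞, M ≠ ∞ ∧ ∀ t ∈ Icc 0 T, D.normSq k (v t) ≤ M := by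
  have hc : ContinuousOn (fun t => ∑ j ∈ Finset.range n, D.lam j ^ k * D.coef (v t) j ^ 2)
      (Icc 0 T) :=
    continuousOn_finsetSum _ fun j _ => continuousOn_const.mul ((h.continuousOn_coef j).pow 2)
  obtain ⟨C, hC⟩ := isCompact_Icc.exists_bound_of_continuousOn hc
  refine ⟨ENNReal.ofReal C, ENNReal.ofReal_ne_top, fun t ht => ?_⟩
  rw [GalerkinFrame.normSq_un_eq h k ht]
  exact ENNReal.ofReal_le_ofReal ((le_abs_self _).trans (hC t ht))

namespace StokesBasis

variable {L : ℝ} {S : StokesBasis L}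

/-- A strong solution together with its Galerkin approximations is a Galerkin scheme. -/
theorem IsStrongSolution.scheme (hL : 0 < L) {ν T : ℝ} (hν : 0 < ν) (hT : 0 < T)
    {u₀ : L2 L} {f u : ℝ → L2 L} (hu : S.IsStrongSolution ν T u₀ f u)
    (hfm : AEStronglyMeasurable f (volume.restrict (Ioc 0 T)))
    (hfi : ∀ k, IntervalIntegrable (fun s => (S.frame hL).coef (f s) k) volume 0 T)
    {un : ℕ → ℝ → L2 L} (hun : ∀ n, (S.frame hL).IsGalerkin n ν T u₀ f (un n)) :
    (S.frame hL).Scheme ν T u₀ f u un := by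
  obtain ⟨D, hD⟩ : ∃ D, D = S.frame hL := ⟨_, rfl⟩
  have hDK : ∀ x, x ∈ H L → x ∈ D.K := by rw [hD]; exact fun x hx => hx
  have hum : AEStronglyMeasurable u (volume.restrict (Ioc 0 T)) := by
    rw [← restrict_Ioo_eq]
    exact hu.mem_V_one.measurable
  have h2 := S.lintegral_normSq_ne_top hL hu.mem_V_two.norm_lt_top
  have h1 := S.ae_normSq_le hL 1 T u
  have hM : S.bochnerNorm ∞ 1 T u ^ (2 : ℝ) ≠ ∞ :=
    (ENNReal.rpow_lt_top_of_nonneg (by norm_num) hu.mem_V_one.norm_lt_top.ne).ne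
  have heq : ∀ k, ∀ t ∈ Icc 0 T, (S.frame hL).coef (u t) k = (S.frame hL).coef u₀ k +
      ∫ s in (0 : ℝ)..t, ((S.frame hL).coef (f s) k -
        ν * (S.frame hL).lam k * (S.frame hL).coef (u s) k - (S.frame hL).T k (u s) (u s)) := by
    intro k t ht
    rw [S.frame_coef, S.frame_coef, hu.equation _ (S.solenoidal k) t ht]
    congr 1
    refine intervalIntegral.integral_congr_ae ?_
    rw [uIoc_of_le ht.1, ← ae_restrict_iff' measurableSet_Ioc]
    have h1' := ae_mono (Measure.restrict_mono (Ioc_subset_Ioc_right ht.2) le_rfl) h1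
    filter_upwards [h1', ae_restrict_mem measurableSet_Ioc] with s hs hsm
    exact S.rhs_eq hL ν (f s) (hu.mem_H s ⟨hsm.1.le, hsm.2.trans ht.2⟩)
      (ne_top_of_le_ne_top hM hs) k
  rw [← hD] at h1 h2 hfi hun heq ⊢
  have hTi : ∫⁻ s in Ioc 0 T, D.bilinNormSq 0 (u s) (u s) ≠ ∞ := by
    obtain ⟨C, hC, hle⟩ := D.est_one_two
    refine ne_top_of_le_ne_top (?_ : ∫⁻ s in Ioc 0 T,
      C * S.bochnerNorm ∞ 1 T u ^ (2 : ℝ) * D.normSq 2 (u s) ≠ ∞) (lintegral_mono_ae ?_)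
    · rw [lintegral_const_mul' _ _ (ENNReal.mul_ne_top hC hM)]
      exact ENNReal.mul_ne_top (ENNReal.mul_ne_top hC hM) h2
    · filter_upwards [h1, ae_restrict_mem measurableSet_Ioc] with s hs hsm
      have hmem := hDK _ (hu.mem_H s (Ioc_subset_Icc_self hsm))
      refine (hle _ hmem _ hmem).trans ?_
      rw [mul_assoc]
      exact mul_le_mul_right (mul_le_mul_left hs _) _
  have hint : ∀ k, IntervalIntegrable (fun s => D.coef (f s) k -
      ν * D.lam k * D.coef (u s) k - D.T k (u s) (u s)) volume 0 T := fun k =>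
    ((hfi k).sub ((intervalIntegrable_of_energy D.lam_pos hT.le (D.aemeasurable_coef hum) h2
      k).const_mul _)).sub
      (intervalIntegrable_of_energy D.lam_pos hT.le (D.aemeasurable_bilin hum) hTi k)
  refine ⟨hν, hT.le, hfm, hum, hfi, fun t ht => hDK _ (hu.mem_H t ht), fun k => ?_, heq, hun⟩
  have hcont : ContinuousOn (fun t => D.coef u₀ k + ∫ s in (0 : ℝ)..t, (D.coef (f s) k -
      ν * D.lam k * D.coef (u s) k - D.T k (u s) (u s))) (Icc 0 T) := by
    refine continuousOn_const.add ?_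
    have h := intervalIntegral.continuousOn_primitive_interval' (hint k) left_mem_uIcc
    rwa [uIcc_of_le hT.le] at h
  exact hcont.congr fun t ht => heq k t ht

end StokesBasis

end

end NavierStokes

theorem mainTheorem3 (L ν T : ℝ) (hL : 0 < L) (hν : 0 < ν) (hT : 0 < T)
    (S : NavierStokes.StokesBasis L) (m : ℕ) (hm : 3 ≤ m)
    (u₀ : NavierStokes.L2 L) (hu₀ : u₀ ∈ S.V m)
    (f : ℝ → NavierStokes.L2 L) (hf : S.MemBochner 2 m T f)
    (u : ℝ → NavierStokes.L2 L) (hu : S.IsStrongSolution ν T u₀ f u) :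
    ∃ un : ℕ → ℝ → NavierStokes.L2 L,
      (∀ n, S.IsGalerkinSolution n ν T u₀ f (un n) ∧
        ∀ v, S.IsGalerkinSolution n ν T u₀ f v → ∀ t ∈ Icc 0 T, v t = un n t) ∧
      (∀ n, S.MemBochner ∞ m T (un n) ∧ S.MemBochner 2 (m + 1) T (un n)) ∧
      S.MemBochner ∞ m T u ∧ S.MemBochner 2 (m + 1) T u ∧
      Tendsto (fun n => S.bochnerNorm ∞ m T (fun t => un n t - u t)) atTop (𝓝 0) ∧
      Tendsto (fun n => S.bochnerNorm 2 (m + 1) T (fun t => un n t - u t)) atTop (𝓝 0) := by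
  have hfm : AEStronglyMeasurable f (volume.restrict (Ioc 0 T)) := by
    rw [← NavierStokes.StokesBasis.restrict_Ioo_eq]
    exact hf.measurable
  have hfE := S.lintegral_normSq_ne_top hL hf.norm_lt_top
  have hfi : ∀ k, IntervalIntegrable (fun s => (S.frame hL).coef (f s) k) volume 0 T := fun k =>
    NavierStokes.intervalIntegrable_of_energy (S.frame hL).lam_pos hT.le
      ((S.frame hL).aemeasurable_coef hfm) hfE k
  choose un hun huniq using fun n => (S.frame hL).galerkin_exists_unique n hν.le hT.le u₀ hfi
  have hscheme := hu.scheme hL hν hT hfm hfi hun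
  obtain ⟨p, rfl⟩ : ∃ p, m = p + 1 := ⟨m - 1, by omega⟩
  -- Only `L²(0, T; V^(m-1))` is needed of the force.
  have hfp : ∫⁻ s in Ioc 0 T, (S.frame hL).normSq p (f s) ≠ ∞ := by
    obtain ⟨C, hC, hle⟩ := NavierStokes.exists_energy_le_mul (S.frame hL).lam_pos
      (S.frame hL).lam_mono (Nat.le_succ p)
    refine ne_top_of_le_ne_top (?_ : ∫⁻ s in Ioc 0 T, C * (S.frame hL).normSq (p + 1) (f s) ≠ ∞)
      (lintegral_mono fun s => hle _)
    rw [lintegral_const_mul' _ _ hC]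
    exact ENNReal.mul_ne_top hC hfE
  have hlevel := hscheme.levelConv hfp ((S.vNorm_lt_top_iff hL _ _).1 hu₀.2)
    (ENNReal.rpow_lt_top_of_nonneg (by norm_num) hu.mem_V_one.norm_lt_top.ne).ne
    (S.ae_normSq_le hL 1 T u) (S.lintegral_normSq_ne_top hL hu.mem_V_two.norm_lt_top)
  have hsqrt : Tendsto (fun x : ℝ≥0∞ => x ^ (1 / 2 : ℝ)) (𝓝 0) (𝓝 0) := by
    have h := (ENNReal.continuous_rpow_const (y := (1 / 2 : ℝ))).tendsto 0
    rwa [ENNReal.zero_rpow_of_pos (by norm_num)] at h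
  obtain ⟨M, hM, hMle⟩ := hlevel.bound
  refine ⟨un, fun n => ⟨(S.isGalerkinSolution_iff hL n ν T u₀ f _).2 (hun n), fun v hv =>
    huniq n v ((S.isGalerkinSolution_iff hL n ν T u₀ f v).1 hv)⟩, fun n => ⟨?_, ?_⟩,
    S.memBochner_top hL hscheme.u_meas hu.mem_H hM hMle,
    S.memBochner_two hL hscheme.u_meas hu.mem_H hlevel.integral, ?_, ?_⟩
  · obtain ⟨M', hM', hle⟩ := (hun n).exists_normSq_le (p + 1)
    exact S.memBochner_top hL (hun n).meas (fun t ht => (hun n).mem_K ht) hM' hle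
  · obtain ⟨M', hM', hle⟩ := (hun n).exists_normSq_le (p + 1 + 1)
    refine S.memBochner_two hL (hun n).meas (fun t ht => (hun n).mem_K ht)
      (ne_top_of_le_ne_top (?_ : ∫⁻ s in Ioc 0 T, M' ≠ ∞) (setLIntegral_mono' measurableSet_Ioc
        fun s hs => hle s (Ioc_subset_Icc_self hs)))
    rw [setLIntegral_const]
    exact ENNReal.mul_ne_top hM' measure_Ioc_lt_top.ne
  · refine tendsto_of_tendsto_of_tendsto_of_le_of_le tendsto_const_nhds
      (hsqrt.comp hlevel.tendsto_sup) (fun _ => zero_le) fun n => ?_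
    exact S.bochnerNorm_top_le hL (p + 1) fun t ht =>
      le_iSup₂ (f := fun t (_ : t ∈ Icc 0 T) => (S.frame hL).normSq (p + 1) (un n t - u t)) t ht
  · simp only [S.bochnerNorm_two hL]
    exact hsqrt.comp hlevel.tendsto_integral
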